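/- All manifolds are smooth, finite-dimensional, without boundary, Hausdorff and second countable; submanifolds are embedded. For a smooth field $C$ of tangent hyperplanes on a manifold $N$ let $\tau_C\colon C\wedge C\to TN/C$ be the form $\tau_C(u,v)=[u,v]\bmod C$ (for sections $u,v$ of $C$). The field $C$ is a contact structure if $\tau_C$ is non-degenerate at every point. The characteristic directions of $C$ at a point are the vectors in the kernel of $\tau_C$ there, and the characteristic through a point $x$ is the set of points that can be reached from $x$ along piecewise smooth curves tangent to characteristic directions. A Legendre submanifold of a contact manifold $(N,C)$ is a submanifold $L$ with $TL\subset C$ and $\dim N=2\dim L+1$. Let $(M,C)$ be a contact manifold and let a Lie group $G$ with Lie algebra $\mathfrak g$ act smoothly on $M$, preserving $C$ and locally freely (all stabilizers are discrete). Let $M_{\mathfrak g}\subset M$ be the ($G$-invariant) set of points $x$ at which the image of $\mathfrak g\to T_xM$ is contained in $C_x$. Then: (1) $M_{\mathfrak g}$ is a submanifold of $M$ of codimension $\dim G$, and if it is nonempty then $\dim M\ge 2\dim G+1$. $C$ touches it nowhere, i.e. $T_xM_{\mathfrak g}\not\subset C_x$ for all $x\in M_{\mathfrak g}$, and so $C_{\mathfrak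 g}:=C\cap TM_{\mathfrak g}$ is a smooth field of hyperplanes on $M_{\mathfrak g}$. (2) The characteristic directions of $C_{\mathfrak g}$ at $x\in M_{\mathfrak g}$ are exactly the vectors tangent to the orbit $Gx$, and the characteristic of $C_{\mathfrak g}$ through $x$ is the orbit of $x$ under the identity component of $G$ (hence $Gx$ itself if $G$ is connected). (3) Every $G$-invariant Legendre submanifold of $M$ is contained in $M_{\mathfrak g}$. (4) Suppose that $G$ acts properly on $M_{\mathfrak g}$. If it also acts freely on $M_{\mathfrak g}$, then $M/\!/G:=M_{\mathfrak g}/G$ (with the quotient topology) is a manifold of dimension $\dim M-2\dim G$ such that the projection $\pi\colon M_{\mathfrak g}\to M/\!/G$ is a submersion. More generally, if $M_{\mathfrak g}$ is nonempty, then whenever $M/\!/G$ has a smooth manifold structure for which $\pi$ is a submersion, $\dim M/\!/G=\dim M-2\dim G$, there is a contact structure $C'$ on $M/\!/G$ with $(d\pi)^{-1}(C')=C_{\mathfrak g}$, and a subset $L\subset M$ is a $G$-invariant Legendre submanifold of $M$ if and only if $L=\pi^{-1}(\Lambda)$ for a Legendre submanifold $\Lambda$ of $(M/\!/G,C')$.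 -/

import Mathlib

open scoped Manifold ContDiff Topology

noncomputable section

namespace ContactReduction

/-! All manifolds are smooth, without boundary, and of a fixed finite dimension `n`, that is,
modelled on `𝓡 n`. -/

/-- A field of tangent subspaces on an `n`-dimensional manifold. -/
abbrev SubspaceField (n : ℕ) (M : Type*) [TopologicalSpace M]
    [ChartedSpace (EuclideanSpace ℝ (Fin n)) M] : Type _ :=
  (x : M) → Submodule ℝ (TangentSpace (𝓡 n) x)

section Fields

variable {n : ℕ} {M : Type*} [TopologicalSpace M] [ChartedSpace (EuclideanSpace ℝ (Fin n)) M]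

/-- A smooth field of hyperplanes: locally the kernel of a nowhere vanishing smooth 1-form.
Smoothness of the 1-form is smoothness of the corresponding function on the tangent bundle. -/
def IsHyperplaneField [IsManifold (𝓡 n) ∞ M] (C : SubspaceField n M) : Prop :=
  ∀ x₀ : M, ∃ U : Set M, IsOpen U ∧ x₀ ∈ U ∧
    ∃ α : (x : M) → (TangentSpace (𝓡 n) x →L[ℝ] ℝ),
      ContMDiffOn (𝓡 n).tangent 𝓘(ℝ, ℝ) ∞
        (fun p : TangentBundle (𝓡 n) M => α p.1 p.2) {p | p.1 ∈ U} ∧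
      ∀ x ∈ U, α x ≠ 0 ∧ ∀ v : TangentSpace (𝓡 n) x, v ∈ C x ↔ α x v = 0

/-- `V` is a smooth section of `C` in some neighbourhood of `x`. -/
def IsLocalSection [IsManifold (𝓡 n) ∞ M] (C : SubspaceField n M)
    (V : (y : M) → TangentSpace (𝓡 n) y) (x : M) : Prop :=
  ∃ U : Set M, IsOpen U ∧ x ∈ U ∧
    ContMDiffOn (𝓡 n) (𝓡 n).tangent ∞ (fun y => (⟨y, V y⟩ : TangentBundle (𝓡 n) M)) U ∧
    ∀ y ∈ U, V y ∈ C y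

/-- `τ_C(u, v) = 0`, where `τ_C : C ∧ C → TM / C` is given by `τ_C(u, v) = [U, V] mod C` for
arbitrary local sections `U`, `V` of `C` extending `u` and `v`. -/
def TauVanishes [IsManifold (𝓡 n) ∞ M] (C : SubspaceField n M) (x : M)
    (u v : TangentSpace (𝓡 n) x) : Prop :=
  ∀ U V : (y : M) → TangentSpace (𝓡 n) y, IsLocalSection C U x → IsLocalSection C V x →
    U x = u → V x = v → VectorField.mlieBracket (𝓡 n) U V x ∈ C x

/-- The characteristic directions at `x`: the kernel of `τ_C` at `x`. -/
def characteristicDirections [IsManifold (𝓡 n) ∞ M] (C : SubspaceField n M) (x : M) :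
    Set (TangentSpace (𝓡 n) x) :=
  {u | u ∈ C x ∧ ∀ v ∈ C x, TauVanishes C x u v}

/-- A contact structure: a smooth field of hyperplanes whose form `τ_C` is regular everywhere. -/
def IsContact [IsManifold (𝓡 n) ∞ M] (C : SubspaceField n M) : Prop :=
  IsHyperplaneField C ∧ ∀ x : M, ∀ u ∈ characteristicDirections C x, u = 0

/-- The characteristic (leaf) through `x`: all points that can be reached from `x` along
finitely many smooth curves that are everywhere tangent to the characteristic directions. -/
def characteristicLeaf [IsManifold (𝓡 n) ∞ M] (C : SubspaceField n M) (x : M) : Set M :=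
  {y | Relation.ReflTransGen (fun a b : M => ∃ γ : ℝ → M,
      ContMDiff 𝓘(ℝ, ℝ) (𝓡 n) ∞ γ ∧ γ 0 = a ∧ γ 1 = b ∧
      ∀ t : ℝ, mfderiv 𝓘(ℝ, ℝ) (𝓡 n) γ t (1 : ℝ) ∈ characteristicDirections C (γ t)) x y}

/-- A Legendre submanifold: an embedded submanifold `L` with `TL ⊆ C` and `dim M = 2 dim L + 1`. -/
def IsLegendre [IsManifold (𝓡 n) ∞ M] (C : SubspaceField n M) (L : Set M) : Prop :=
  ∃ l : ℕ, n = 2 * l + 1 ∧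
    ∃ _ : ChartedSpace (EuclideanSpace ℝ (Fin l)) L,
      IsManifold (𝓡 l) ∞ L ∧
      Manifold.IsSmoothEmbedding (𝓡 l) (𝓡 n) ∞ (Subtype.val : L → M) ∧
      ∀ (x : L) (v : TangentSpace (𝓡 l) x),
        mfderiv (𝓡 l) (𝓡 n) (Subtype.val : L → M) x v ∈ C x.1

/-- The field of tangent subspaces cut out by `C` on `N` via `f : N → M`, namely `df⁻¹(C)`. -/
def pullback (d : ℕ) {N : Type*} [TopologicalSpace N]
    [ChartedSpace (EuclideanSpace ℝ (Fin d)) N] (f : N → M) (C : SubspaceField n M) :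
    SubspaceField d N :=
  fun x => (C (f x)).comap (mfderiv (𝓡 d) (𝓡 n) f x).toLinearMap

end Fields

/-- The action of `G` on `M` is locally free: all stabilizers are discrete. -/
def IsLocallyFree (G M : Type*) [TopologicalSpace G] [Group G] [MulAction G M] : Prop :=
  ∀ x : M, DiscreteTopology (MulAction.stabilizer G x)

section Action

variable {n k : ℕ} {M : Type*} [TopologicalSpace M] [ChartedSpace (EuclideanSpace ℝ (Fin n)) M]
  (G : Type*) [TopologicalSpace G] [ChartedSpace (EuclideanSpace ℝ (Fin k)) G] [Group G]
  [MulAction G M]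

/-- The action of `G` respects the field `C`. -/
def Preserves (C : SubspaceField n M) : Prop :=
  ∀ (g : G) (x : M), ∀ v ∈ C x, mfderiv (𝓡 n) (𝓡 n) (fun y : M => g • y) x v ∈ C (g • x)

/-- The infinitesimal action `𝔤 → T_x M`, the differential at `1` of `g ↦ g • x`. -/
def infinitesimalAction (x : M) : GroupLieAlgebra (𝓡 k) G →L[ℝ] TangentSpace (𝓡 n) x :=
  mfderiv (𝓡 k) (𝓡 n) (fun g : G => g • x) 1

theorem infinitesimalAction_smul_mem [LieGroup (𝓡 k) ∞ G]
    [ContMDiffSMul (𝓡 k) (𝓡 n) ∞ G M] {C : SubspaceField n M} (hC : Preserves G C)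
    (g : G) {x : M} (hx : ∀ ξ : GroupLieAlgebra (𝓡 k) G, infinitesimalAction G x ξ ∈ C x)
    (ξ : GroupLieAlgebra (𝓡 k) G) : infinitesimalAction G (g • x) ξ ∈ C (g • x) := by
  have hconj : ContMDiff (𝓡 k) (𝓡 k) ∞ (fun h : G => g⁻¹ * h * g) :=
    (contMDiff_const.mul contMDiff_id).mul contMDiff_const
  have horb : ContMDiff (𝓡 k) (𝓡 n) ∞ (fun h : G => h • x) :=
    contMDiff_id.smul contMDiff_const
  have hg : ContMDiff (𝓡 n) (𝓡 n) ∞ (fun y : M => g • y) :=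
    ContMDiffSMul.contMDiff_const_smul (I := 𝓡 k) g
  have h1 : g⁻¹ * 1 * g = 1 := by simp
  have e : (fun h : G => h • (g • x)) =
      (fun y : M => g • y) ∘ ((fun h : G => h • x) ∘ (fun h : G => g⁻¹ * h * g)) := by
    funext h
    simp [smul_smul, mul_assoc]
  have hco : MDifferentiableAt (𝓡 k) (𝓡 n)
      ((fun h : G => h • x) ∘ (fun h : G => g⁻¹ * h * g)) 1 :=
    ((horb.comp hconj).mdifferentiable (by simp)) 1
  have key : infinitesimalAction G (g • x) ξ =
      mfderiv (𝓡 n) (𝓡 n) (fun y : M => g • y) ((g⁻¹ * 1 * g) • x)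
        (mfderiv (𝓡 k) (𝓡 n) (fun h : G => h • x) (g⁻¹ * 1 * g)
          (mfderiv (𝓡 k) (𝓡 k) (fun h : G => g⁻¹ * h * g) 1 ξ)) := by
    unfold infinitesimalAction
    rw [e, mfderiv_comp (1 : G) ((hg.mdifferentiable (by simp)) _) hco,
      mfderiv_comp (1 : G) ((horb.mdifferentiable (by simp)) _)
        ((hconj.mdifferentiable (by simp)) _)]
    rfl
  rw [key]
  have aux : ∀ a : G, a = 1 → ∀ η : TangentSpace (𝓡 k) a,
      mfderiv (𝓡 n) (𝓡 n) (fun y : M => g • y) (a • x)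
        (mfderiv (𝓡 k) (𝓡 n) (fun h : G => h • x) a η) ∈ C (g • x) := by
    rintro a rfl η
    have := hC g x _ (hx η)
    have e1 : ∀ y : M, y = x → ∀ v : EuclideanSpace ℝ (Fin n),
        (mfderiv (𝓡 n) (𝓡 n) (fun y : M => g • y) x v : EuclideanSpace ℝ (Fin n)) =
        mfderiv (𝓡 n) (𝓡 n) (fun y : M => g • y) y v := by
      rintro y rfl v; rfl
    exact (e1 _ (one_smul G x) _) ▸ this
  exact aux _ h1 _

variable (k) in
/-- The locus `M_𝔤` of the points at which the image of `𝔤` is contained in `C`. It is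
`G`-invariant, hence carries an action of `G`. -/
def reductionLocus [LieGroup (𝓡 k) ∞ G] [ContMDiffSMul (𝓡 k) (𝓡 n) ∞ G M]
    (C : SubspaceField n M) (hC : Preserves G C) : SubMulAction G M where
  carrier := {x | ∀ ξ : GroupLieAlgebra (𝓡 k) G, infinitesimalAction G x ξ ∈ C x}
  smul_mem' g _ hx := infinitesimalAction_smul_mem G hC g hx

variable (k) in
/-- The orbit space `M//G = M_𝔤 / G`, with the quotient topology. -/
abbrev ReducedSpace [LieGroup (𝓡 k) ∞ G] [ContMDiffSMul (𝓡 k) (𝓡 n) ∞ G M]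
    (C : SubspaceField n M) (hC : Preserves G C) : Type _ :=
  MulAction.orbitRel.Quotient G (reductionLocus k G C hC)

variable (k) in
/-- The inclusion `M_𝔤 → M`. -/
abbrev reductionIncl [LieGroup (𝓡 k) ∞ G] [ContMDiffSMul (𝓡 k) (𝓡 n) ∞ G M]
    (C : SubspaceField n M) (hC : Preserves G C) : reductionLocus k G C hC → M :=
  Subtype.val

variable (k) in
/-- The projection `M_𝔤 → M_𝔤 / G`. -/
def reductionProj [LieGroup (𝓡 k) ∞ G] [ContMDiffSMul (𝓡 k) (𝓡 n) ∞ G M]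
    (C : SubspaceField n M) (hC : Preserves G C) (x : reductionLocus k G C hC) :
    ReducedSpace k G C hC :=
  Quotient.mk _ x

end Action

end ContactReduction

end

open ContactReduction

/-!
Near a point of `M` write `C = ker α` for a 1-form `α`. Two vectors `u`, `v` of `C` then satisfy
`τ_C(u, v) = 0` if and only if `dα(u, v) = 0` (`characteristicDirections_eq`), so that the bracket
of sections can be replaced by the exterior derivative, which commutes with pullbacks.

The function `μ = momentum G α`, with values in the dual of the Lie algebra, is given by
`μ(y)(ξ) = α(ξ_y)`, where `ξ_y` is the infinitesimal action of `ξ` at `y`; its zero set is the locus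
`M_𝔤`. As `C` is invariant, `dα(ξ_x, w) = -dμ(w)(ξ)` for `x ∈ M_𝔤` and `w ∈ C_x`
(`dForm_infinitesimalAction`); no invariance of `α` itself is needed. As the action is locally free,
`ξ ↦ ξ_x` is injective (`infinitesimalAction_injective`), and as `dα` is non-degenerate on `C_x`,
the restriction of `dμ` to `C_x` is surjective. What follows at the single point `x` is linear
algebra (`LinearReduction`): `dμ` is surjective, so `M_𝔤` is a submanifold of codimension `dim G`;
its tangent space `ker dμ` is not contained in `C_x`; the kernel of `dα` on `C_x ∩ ker dμ` is the
orthogonal of an orthogonal, namely the space of all `ξ_x`; and `2 dim G + 1 ≤ dim M`.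

In suitable coordinates the orbits are the plaques of a product (`IsFlowBox`). A curve whose
velocity is tangent to the orbits therefore moves by group elements close to the identity, which
gives the description of the characteristics (`characteristicLeaf_eq`). If the action is proper,
points of one orbit that are close to each other differ by a group element close to the stabilizer.
For a free action the transversal of a flow box thus meets each orbit at most once and is a chart of
the orbit space (`exists_chartedSpace_quotient`). In general, whenever the projection `π` to the
orbit space is a submersion, the kernel of `dπ` consists of the vectors tangent to the orbits
(`mfderiv_eq_zero_iff_of_isSubmersion`), which are the characteristic directions of the field on
`M_𝔤`. That field therefore descends, and pulling back a defining form along local sections of `π`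
shows that the descended field is a contact structure (`isContact_of_pullback_eq`).

An invariant Legendre submanifold `L` contains the orbits of its points, and its tangent spaces lie
in `C`; so `L ⊆ M_𝔤`, and `L` is the preimage of a set `Λ`. As `π` is a submersion, `Λ` is a
submanifold if and only if `L` is one (`HasSliceChart.preimage`, `HasSliceChart.of_preimage`), and
the tangency conditions on `L` and `Λ` correspond
(`isLegendre_image_preimage`, `exists_isLegendre_preimage`).
-/

namespace ContactReduction

open Set Manifold Topology

set_option linter.unusedSectionVars false

/-! ### Complements of linear maps -/

section LinearAlgebra

variable {E F K : Type*} [NormedAddCommGroup E] [NormedSpace ℝ E] [FiniteDimensional ℝ E]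
  [NormedAddCommGroup F] [NormedSpace ℝ F] [FiniteDimensional ℝ F]
  [NormedAddCommGroup K] [NormedSpace ℝ K] [FiniteDimensional ℝ K]

/-- An injective linear map extends to a linear isomorphism `F × K → E`. -/
theorem exists_complement_param (A : F →L[ℝ] E) (hA : Function.Injective A)
    (hdim : Module.finrank ℝ F + Module.finrank ℝ K = Module.finrank ℝ E) :
    ∃ ι : K →L[ℝ] E, Function.Bijective (A.coprod ι) := by
  obtain ⟨W, hW⟩ := Submodule.exists_isCompl A.toLinearMap.range
  have h1 : Module.finrank ℝ A.toLinearMap.range = Module.finrank ℝ F :=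
    LinearMap.finrank_range_of_inj hA
  have h2 := Submodule.finrank_add_eq_of_isCompl hW
  have h3 : Module.finrank ℝ K = Module.finrank ℝ W := by omega
  let e : K ≃ₗ[ℝ] W := LinearEquiv.ofFinrankEq K W h3
  let ι : K →L[ℝ] E := (W.subtype ∘ₗ e.toLinearMap).toContinuousLinearMap
  have hι : ∀ x, ι x = (e x : E) := fun x => rfl
  have hinj : Function.Injective (A.coprod ι) := by
    rw [injective_iff_map_eq_zero]
    rintro ⟨u, w⟩ h
    have h' : A u + ι w = 0 := by simpa using h
    have hm : A u ∈ A.toLinearMap.range ⊓ W := by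
      refine ⟨⟨u, rfl⟩, ?_⟩
      have : A u = -(e w : E) := by rw [← hι]; exact eq_neg_of_add_eq_zero_left h'
      rw [this]; exact W.neg_mem (e w).2
    rw [hW.inf_eq_bot, Submodule.mem_bot] at hm
    have hu : u = 0 := (injective_iff_map_eq_zero A).1 hA u hm
    have hw : (e w : E) = 0 := by rw [← hι]; simpa [hm] using h'
    have hw' : w = 0 := by simpa using hw
    simp [hu, hw']
  refine ⟨ι, hinj, ?_⟩
  have : Module.finrank ℝ (F × K) = Module.finrank ℝ E := by
    rw [Module.finrank_prod, hdim]
  exact (LinearMap.injective_iff_surjective_of_finrank_eq_finrank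
    (f := (A.coprod ι).toLinearMap) this).1 hinj

/-- A surjective linear map is the second component of a linear isomorphism `E → F × K`. -/
theorem exists_complement_coord (B : E →L[ℝ] K) (hB : Function.Surjective B)
    (hdim : Module.finrank ℝ F + Module.finrank ℝ K = Module.finrank ℝ E) :
    ∃ q : E →L[ℝ] F, Function.Bijective (q.prod B) := by
  have h1 := B.toLinearMap.finrank_range_add_finrank_ker
  rw [LinearMap.range_eq_top.2 hB, finrank_top] at h1
  have h3 : Module.finrank ℝ F = Module.finrank ℝ B.toLinearMap.ker := by omega
  let e : B.toLinearMap.ker ≃ₗ[ℝ] F := LinearEquiv.ofFinrankEq _ _ h3.symm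
  obtain ⟨p, hp⟩ := B.toLinearMap.ker.exists_isCompl
  let q : E →L[ℝ] F := (e.toLinearMap ∘ₗ
    Submodule.projectionOnto B.toLinearMap.ker p hp).toContinuousLinearMap
  have hinj : Function.Injective (q.prod B) := by
    rw [injective_iff_map_eq_zero]
    intro v hv
    have hv1 : e (Submodule.projectionOnto _ p hp v) = 0 := congrArg Prod.fst hv
    have hv2 : v ∈ B.toLinearMap.ker := congrArg Prod.snd hv
    have := Submodule.projectionOnto_apply_left hp ⟨v, hv2⟩
    rw [LinearEquiv.map_eq_zero_iff] at hv1
    simp only at this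
    rw [hv1] at this
    exact (congrArg Subtype.val this).symm
  refine ⟨q, hinj, ?_⟩
  have : Module.finrank ℝ E = Module.finrank ℝ (F × K) := by
    rw [Module.finrank_prod, hdim]
  exact (LinearMap.injective_iff_surjective_of_finrank_eq_finrank
    (f := (q.prod B).toLinearMap) this).1 hinj

end LinearAlgebra

/-! ### The inverse function theorem on manifolds -/

section InverseFunction

variable {E : Type*} [NormedAddCommGroup E] [NormedSpace ℝ E]
  {E' : Type*} [NormedAddCommGroup E'] [NormedSpace ℝ E']
  {E'' : Type*} [NormedAddCommGroup E''] [NormedSpace ℝ E'']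
  {N : Type*} [TopologicalSpace N] [ChartedSpace E N]
  {P : Type*} [TopologicalSpace P] [ChartedSpace E' P]
  {Q : Type*} [TopologicalSpace Q] [ChartedSpace E'' Q]

variable (E E') in
/-- A homeomorphism between open subsets of two manifolds which is smooth in both directions. -/
structure IsDiffeo (Ψ : OpenPartialHomeomorph N P) : Prop where
  contMDiffOn : ContMDiffOn 𝓘(ℝ, E) 𝓘(ℝ, E') ∞ Ψ Ψ.source
  contMDiffOn_symm : ContMDiffOn 𝓘(ℝ, E') 𝓘(ℝ, E) ∞ Ψ.symm Ψ.target

namespace IsDiffeo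

theorem symm {Ψ : OpenPartialHomeomorph N P} (h : IsDiffeo E E' Ψ) : IsDiffeo E' E Ψ.symm :=
  ⟨h.2, h.1⟩

theorem restr {Ψ : OpenPartialHomeomorph N P} (h : IsDiffeo E E' Ψ) {s : Set N} (hs : IsOpen s) :
    IsDiffeo E E' (Ψ.restrOpen s hs) :=
  ⟨h.1.mono (by simp), h.2.mono (by simp)⟩

theorem trans {Ψ : OpenPartialHomeomorph N P} {Ξ : OpenPartialHomeomorph P Q} (h : IsDiffeo E E' Ψ)
    (h' : IsDiffeo E' E'' Ξ) : IsDiffeo E E'' (Ψ.trans Ξ) := by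
  constructor
  · rw [OpenPartialHomeomorph.coe_trans]
    exact h'.1.comp (h.1.mono (by simp)) (by intro x hx; simp at hx; simp [hx])
  · rw [OpenPartialHomeomorph.coe_trans_symm]
    exact h.2.comp (h'.2.mono (by intro x hx; simp at hx; simp [hx]))
      (by intro x hx; simp at hx; simp [hx])

theorem chartAt [IsManifold 𝓘(ℝ, E) ∞ N] (x : N) : IsDiffeo E E (chartAt E x) :=
  ⟨contMDiffOn_chart, contMDiffOn_chart_symm⟩

theorem mem_maximalAtlas [IsManifold 𝓘(ℝ, E) ∞ N] {Ψ : OpenPartialHomeomorph N E}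
    (h : IsDiffeo E E Ψ) : Ψ ∈ IsManifold.maximalAtlas 𝓘(ℝ, E) ∞ N :=
  Ψ.mem_maximalAtlas_of_contMDiffOn h.1 h.2

theorem of_mem_maximalAtlas {Ψ : OpenPartialHomeomorph N E}
    (h : Ψ ∈ IsManifold.maximalAtlas 𝓘(ℝ, E) ∞ N) : IsDiffeo E E Ψ :=
  ⟨contMDiffOn_of_mem_maximalAtlas h, contMDiffOn_symm_of_mem_maximalAtlas h⟩

theorem contMDiffAt {Ψ : OpenPartialHomeomorph N P} (h : IsDiffeo E E' Ψ) {x : N}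
    (hx : x ∈ Ψ.source) : ContMDiffAt 𝓘(ℝ, E) 𝓘(ℝ, E') ∞ Ψ x :=
  h.1.contMDiffAt (Ψ.open_source.mem_nhds hx)

theorem contMDiffAt_symm {Ψ : OpenPartialHomeomorph N P} (h : IsDiffeo E E' Ψ) {y : P}
    (hy : y ∈ Ψ.target) : ContMDiffAt 𝓘(ℝ, E') 𝓘(ℝ, E) ∞ Ψ.symm y :=
  h.2.contMDiffAt (Ψ.open_target.mem_nhds hy)

theorem mdifferentiableAt {Ψ : OpenPartialHomeomorph N P} (h : IsDiffeo E E' Ψ) {x : N}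
    (hx : x ∈ Ψ.source) : MDifferentiableAt 𝓘(ℝ, E) 𝓘(ℝ, E') Ψ x :=
  (h.contMDiffAt hx).mdifferentiableAt (by simp)

theorem mdifferentiableAt_symm {Ψ : OpenPartialHomeomorph N P} (h : IsDiffeo E E' Ψ) {y : P}
    (hy : y ∈ Ψ.target) : MDifferentiableAt 𝓘(ℝ, E') 𝓘(ℝ, E) Ψ.symm y :=
  (h.contMDiffAt_symm hy).mdifferentiableAt (by simp)

theorem mfderiv_symm_apply_mfderiv {Ψ : OpenPartialHomeomorph N P} (h : IsDiffeo E E' Ψ) {x : N}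
    (hx : x ∈ Ψ.source) (v : TangentSpace 𝓘(ℝ, E) x) :
    (mfderiv 𝓘(ℝ, E') 𝓘(ℝ, E) Ψ.symm (Ψ x) (mfderiv 𝓘(ℝ, E) 𝓘(ℝ, E') Ψ x v) : E) = v := by
  have h1 := mfderiv_comp_apply (I := 𝓘(ℝ, E)) (I' := 𝓘(ℝ, E')) (I'' := 𝓘(ℝ, E)) x
    (h.mdifferentiableAt_symm (Ψ.map_source hx)) (h.mdifferentiableAt hx) v
  have h2 : (Ψ.symm ∘ Ψ) =ᶠ[𝓝 x] id := by
    filter_upwards [Ψ.open_source.mem_nhds hx] with y hy using Ψ.left_inv hy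
  rw [h2.mfderiv_eq, mfderiv_id] at h1
  exact h1.symm

theorem mfderiv_apply_mfderiv_symm {Ψ : OpenPartialHomeomorph N P} (h : IsDiffeo E E' Ψ) {y : P}
    (hy : y ∈ Ψ.target) (w : TangentSpace 𝓘(ℝ, E') y) :
    (mfderiv 𝓘(ℝ, E) 𝓘(ℝ, E') Ψ (Ψ.symm y) (mfderiv 𝓘(ℝ, E') 𝓘(ℝ, E) Ψ.symm y w) : E') = w :=
  h.symm.mfderiv_symm_apply_mfderiv hy w

theorem mfderiv_injective {Ψ : OpenPartialHomeomorph N P} (h : IsDiffeo E E' Ψ) {x : N}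
    (hx : x ∈ Ψ.source) : Function.Injective (mfderiv 𝓘(ℝ, E) 𝓘(ℝ, E') Ψ x) := by
  intro v w hvw
  have h1 := h.mfderiv_symm_apply_mfderiv hx v
  have h2 := h.mfderiv_symm_apply_mfderiv hx w
  rw [hvw] at h1
  exact h1.symm.trans h2

theorem mfderiv_surjective {Ψ : OpenPartialHomeomorph N P} (h : IsDiffeo E E' Ψ) {x : N}
    (hx : x ∈ Ψ.source) : Function.Surjective (mfderiv 𝓘(ℝ, E) 𝓘(ℝ, E') Ψ x) := by
  intro w
  have := h.mfderiv_apply_mfderiv_symm (Ψ.map_source hx) w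
  rw [Ψ.left_inv hx] at this
  exact ⟨_, this⟩

end IsDiffeo

theorem isDiffeo_of_continuousLinearEquiv (e : E ≃L[ℝ] E') :
    IsDiffeo E E' e.toHomeomorph.toOpenPartialHomeomorph :=
  ⟨e.contDiff.contMDiff.contMDiffOn, e.symm.contDiff.contMDiff.contMDiffOn⟩

/-- The inverse function theorem in a normed space, with a local inverse that is smooth on its
whole domain: the source consists of points at which the differential is invertible. -/
theorem isDiffeo_of_contDiffOn [CompleteSpace E] {f : E → E'} {s : Set E} (hs : IsOpen s)
    (hf : ContDiffOn ℝ ∞ f s) {x : E} (hx : x ∈ s) {f' : E ≃L[ℝ] E'}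
    (hf' : HasFDerivAt f (f' : E →L[ℝ] E') x) :
    ∃ Ψ : OpenPartialHomeomorph E E', x ∈ Ψ.source ∧ Ψ.source ⊆ s ∧ (Ψ : E → E') = f ∧
      IsDiffeo E E' Ψ := by
  have hfx : ContDiffAt ℝ ∞ f x := hf.contDiffAt (hs.mem_nhds hx)
  set Ψ₀ := hfx.toOpenPartialHomeomorph f hf' (by simp) with hΨ₀
  have hopen : IsOpen (s ∩ (fderiv ℝ f) ⁻¹' range ((↑) : (E ≃L[ℝ] E') → E →L[ℝ] E')) :=
    ((hf.continuousOn_fderiv_of_isOpen hs (by simp)).isOpen_inter_preimage hs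
      (ContinuousLinearEquiv.isOpen))
  set t := s ∩ (fderiv ℝ f) ⁻¹' range ((↑) : (E ≃L[ℝ] E') → E →L[ℝ] E') with ht
  have hcoe : (Ψ₀ : E → E') = f := rfl
  refine ⟨Ψ₀.restrOpen t hopen, ?_, ?_, hcoe, ?_, ?_⟩
  · exact ⟨hfx.mem_toOpenPartialHomeomorph_source hf' (by simp), hx, ⟨f', hf'.fderiv.symm⟩⟩
  · rintro y ⟨_, hy, _⟩; exact hy
  · rw [contMDiffOn_iff_contDiffOn]
    exact hf.mono (by rintro y ⟨_, hy, _⟩; exact hy)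
  · rw [contMDiffOn_iff_contDiffOn]
    intro y hy
    have hy' := (Ψ₀.restrOpen t hopen).map_target hy
    obtain ⟨_, hy2, ⟨e, he⟩⟩ := hy'
    have hd := hf.contDiffAt (hs.mem_nhds hy2)
    refine ((Ψ₀.restrOpen t hopen).contDiffAt_symm hy (f₀' := e) ?_ hd).contDiffWithinAt
    rw [he]
    exact (hd.differentiableAt (by simp)).hasFDerivAt

/-- The inverse function theorem: a smooth map whose differential at a point is bijective restricts
to a diffeomorphism between neighbourhoods of the point and its image. -/
theorem exists_isDiffeo [FiniteDimensional ℝ E] [FiniteDimensional ℝ E']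
    [IsManifold 𝓘(ℝ, E) ∞ N] [IsManifold 𝓘(ℝ, E') ∞ P] {f : N → P} {U : Set N} (hU : IsOpen U)
    {x : N} (hx : x ∈ U) (hf : ContMDiffOn 𝓘(ℝ, E) 𝓘(ℝ, E') ∞ f U)
    (hbij : Function.Bijective (mfderiv 𝓘(ℝ, E) 𝓘(ℝ, E') f x)) :
    ∃ Ψ : OpenPartialHomeomorph N P, x ∈ Ψ.source ∧ Ψ.source ⊆ U ∧ EqOn Ψ f Ψ.source ∧
      IsDiffeo E E' Ψ := by
  have : CompleteSpace E := FiniteDimensional.complete ℝ E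
  set φ := chartAt E x with hφ
  set ψ := chartAt E' (f x) with hψ
  set V := U ∩ f ⁻¹' ψ.source with hV
  have hVo : IsOpen V := hf.continuousOn.isOpen_inter_preimage hU ψ.open_source
  have hxV : x ∈ V := ⟨hx, mem_chart_source E' (f x)⟩
  set s := φ.target ∩ φ.symm ⁻¹' V with hs
  have hso : IsOpen s := φ.isOpen_inter_preimage_symm hVo
  have hxs : φ x ∈ s := ⟨mem_chart_target E x, by
    simpa [hφ, φ.left_inv (mem_chart_source E x)] using hxV⟩
  have hF : ContDiffOn ℝ ∞ (ψ ∘ f ∘ φ.symm) s := by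
    rw [← contMDiffOn_iff_contDiffOn]
    refine (IsDiffeo.chartAt (f x)).1.comp (hf.comp ((IsDiffeo.chartAt x).2.mono ?_) ?_) ?_
    · exact fun y hy => hy.1
    · exact fun y hy => hy.2.1
    · exact fun y hy => hy.2.2
  have hmd : MDifferentiableAt 𝓘(ℝ, E) 𝓘(ℝ, E') f x :=
    (hf.contMDiffAt (hU.mem_nhds hx)).mdifferentiableAt (by simp)
  have hder : fderiv ℝ (ψ ∘ f ∘ φ.symm) (φ x) = mfderiv 𝓘(ℝ, E) 𝓘(ℝ, E') f x := by
    simp only [mfderiv, hmd]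
    simp [writtenInExtChartAt, fderivWithin_univ, hφ, hψ, mfld_simps]
  have hbij' : Function.Bijective (fderiv ℝ (ψ ∘ f ∘ φ.symm) (φ x)) := by
    rw [hder]; exact hbij
  obtain ⟨Ψ, h1, h2, h3, h4⟩ := isDiffeo_of_contDiffOn hso hF hxs
    (f' := (LinearEquiv.ofBijective
      (fderiv ℝ (ψ ∘ f ∘ φ.symm) (φ x)).toLinearMap hbij').toContinuousLinearEquiv)
    ((hF.contDiffAt (hso.mem_nhds hxs)).differentiableAt (by simp)).hasFDerivAt
  refine ⟨(φ.trans Ψ).trans ψ.symm, ?_, ?_, ?_, ?_⟩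
  · have : f (φ.symm (φ x)) ∈ ψ.source := hxs.2.2
    simp only [OpenPartialHomeomorph.trans_source, mem_inter_iff, mem_preimage,
      OpenPartialHomeomorph.symm_source, OpenPartialHomeomorph.coe_trans, Function.comp]
    refine ⟨⟨mem_chart_source E x, h1⟩, ?_⟩
    rw [h3]
    exact ψ.map_source this
  · rintro y ⟨⟨hy1, hy2⟩, -⟩
    have h5 : φ.symm (φ y) ∈ U := (h2 hy2).2.1
    rwa [φ.left_inv hy1] at h5
  · rintro y ⟨⟨hy1, hy2⟩, -⟩
    have h5 : f (φ.symm (φ y)) ∈ ψ.source := (h2 hy2).2.2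
    simp only [OpenPartialHomeomorph.coe_trans, Function.comp, h3]
    rw [ψ.left_inv h5, φ.left_inv hy1]
  · exact ((IsDiffeo.chartAt x).trans h4).trans (IsDiffeo.chartAt (f x)).symm

end InverseFunction

/-! ### The differentials of products and immersions -/

section Derivatives

variable {E : Type*} [NormedAddCommGroup E] [NormedSpace ℝ E]
  {E' : Type*} [NormedAddCommGroup E'] [NormedSpace ℝ E']
  {F : Type*} [NormedAddCommGroup F] [NormedSpace ℝ F]
  {K : Type*} [NormedAddCommGroup K] [NormedSpace ℝ K]
  {N : Type*} [TopologicalSpace N] [ChartedSpace E N]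
  {P : Type*} [TopologicalSpace P] [ChartedSpace E' P]

theorem mfderiv_prodMk_space_apply {f : N → F} {g : N → K} {x : N}
    (hf : MDifferentiableAt 𝓘(ℝ, E) 𝓘(ℝ, F) f x) (hg : MDifferentiableAt 𝓘(ℝ, E) 𝓘(ℝ, K) g x)
    (v : TangentSpace 𝓘(ℝ, E) x) :
    (mfderiv 𝓘(ℝ, E) 𝓘(ℝ, F × K) (fun y => (f y, g y)) x v : F × K) =
      (mfderiv 𝓘(ℝ, E) 𝓘(ℝ, F) f x v, mfderiv 𝓘(ℝ, E) 𝓘(ℝ, K) g x v) := by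
  have hp := hf.prodMk_space hg
  have h1 := mfderiv_comp_apply (I := 𝓘(ℝ, E)) (I' := 𝓘(ℝ, F × K)) (I'' := 𝓘(ℝ, F)) x
    ((ContinuousLinearMap.fst ℝ F K).mdifferentiableAt) hp v
  have h2 := mfderiv_comp_apply (I := 𝓘(ℝ, E)) (I' := 𝓘(ℝ, F × K)) (I'' := 𝓘(ℝ, K)) x
    ((ContinuousLinearMap.snd ℝ F K).mdifferentiableAt) hp v
  rw [ContinuousLinearMap.mfderiv_eq] at h1 h2
  exact Prod.ext h1.symm h2.symm

theorem IsDiffeo.finrank_eq {Ψ : OpenPartialHomeomorph N P} (h : IsDiffeo E E' Ψ) {x : N}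
    (hx : x ∈ Ψ.source) : Module.finrank ℝ E = Module.finrank ℝ E' := by
  let A : E →L[ℝ] E' := mfderiv 𝓘(ℝ, E) 𝓘(ℝ, E') Ψ x
  exact (LinearEquiv.ofBijective A.toLinearMap
    ⟨h.mfderiv_injective hx, h.mfderiv_surjective hx⟩).finrank_eq

/-- The normal form `u ↦ (u, 0)` has a left inverse, so the differential of an immersion is
injective. -/
theorem mfderiv_injective_of_isImmersionAt [IsManifold 𝓘(ℝ, E) ∞ N] [IsManifold 𝓘(ℝ, E') ∞ P]
    {f : N → P} {x : N}
    (hf : IsImmersionAt 𝓘(ℝ, E) 𝓘(ℝ, E') ∞ f x) :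
    Function.Injective (mfderiv 𝓘(ℝ, E) 𝓘(ℝ, E') f x) := by
  have hφ := IsDiffeo.of_mem_maximalAtlas hf.domChart_mem_maximalAtlas
  have hψ := IsDiffeo.of_mem_maximalAtlas hf.codChart_mem_maximalAtlas
  have hx := hf.mem_domChart_source
  have hfx := hf.mem_codChart_source
  let l : E' →L[ℝ] E :=
    (ContinuousLinearMap.fst ℝ E hf.complement).comp (hf.equiv.symm : E' →L[ℝ] E × hf.complement)
  have hl : (l ∘ hf.codChart) ∘ f =ᶠ[𝓝 x] hf.domChart := by
    filter_upwards [hf.domChart.open_source.mem_nhds hx] with y hy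
    have h1 := hf.writtenInCharts
      (show hf.domChart y ∈ (hf.domChart.extend 𝓘(ℝ, E)).target by
        simpa using hf.domChart.map_source hy)
    simp only [Function.comp, OpenPartialHomeomorph.extend_coe,
      OpenPartialHomeomorph.extend_coe_symm, modelWithCornersSelf_coe,
      modelWithCornersSelf_coe_symm,
      id, hf.domChart.left_inv hy] at h1
    simp [l, h1]
  have hcomp := mfderiv_comp (I := 𝓘(ℝ, E)) (I' := 𝓘(ℝ, E')) (I'' := 𝓘(ℝ, E)) x
    (l.mdifferentiableAt.comp (f x) (hψ.mdifferentiableAt hfx))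
    (hf.contMDiffAt.mdifferentiableAt (by simp))
  rw [hl.mfderiv_eq] at hcomp
  have hinj := hφ.mfderiv_injective hx
  rw [hcomp] at hinj
  exact Function.Injective.of_comp hinj

end Derivatives

/-! ### Slice charts and embedded submanifolds -/

section Slices

variable {E : Type*} [NormedAddCommGroup E] [NormedSpace ℝ E] [FiniteDimensional ℝ E]
  {F : Type*} [NormedAddCommGroup F] [NormedSpace ℝ F] [FiniteDimensional ℝ F]
  {K : Type*} [NormedAddCommGroup K] [NormedSpace ℝ K] [FiniteDimensional ℝ K]
  {N : Type*} [TopologicalSpace N] [ChartedSpace E N]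

variable (E F K) in
/-- There is a slice chart for `L ⊆ N` at `x`: a diffeomorphism from a neighbourhood of `x` to an
open subset of `F × K` which maps `L` to `F × {0}`. -/
def HasSliceChart (L : Set N) (x : N) : Prop :=
  ∃ Ψ : OpenPartialHomeomorph N (F × K), x ∈ Ψ.source ∧ IsDiffeo E (F × K) Ψ ∧
    ∀ y ∈ Ψ.source, (y ∈ L ↔ (Ψ y).2 = 0)

/-- A regular zero set has slice charts. -/
theorem hasSliceChart_of_zeroSet [IsManifold 𝓘(ℝ, E) ∞ N] {L U : Set N} (hU : IsOpen U) {x : N}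
    (hx : x ∈ U) {h : N → K} (hh : ContMDiffOn 𝓘(ℝ, E) 𝓘(ℝ, K) ∞ h U)
    (hsurj : Function.Surjective (mfderiv 𝓘(ℝ, E) 𝓘(ℝ, K) h x))
    (hL : ∀ y ∈ U, (y ∈ L ↔ h y = 0))
    (hdim : Module.finrank ℝ F + Module.finrank ℝ K = Module.finrank ℝ E) :
    HasSliceChart E F K L x := by
  let B : E →L[ℝ] K := mfderiv 𝓘(ℝ, E) 𝓘(ℝ, K) h x
  obtain ⟨q, hq⟩ := exists_complement_coord (F := F) B hsurj hdim
  have hφ := IsDiffeo.chartAt (E := E) x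
  have hqφ : ContMDiffOn 𝓘(ℝ, E) 𝓘(ℝ, F) ∞ (q ∘ chartAt E x) (chartAt E x).source :=
    q.contMDiff.comp_contMDiffOn hφ.1
  have hΘ : ContMDiffOn 𝓘(ℝ, E) 𝓘(ℝ, F × K) ∞ (fun y => ((q ∘ chartAt E x) y, h y))
      (U ∩ (chartAt E x).source) :=
    (hqφ.mono inter_subset_right).prodMk_space (hh.mono inter_subset_left)
  have hd : ∀ v : TangentSpace 𝓘(ℝ, E) x,
      (mfderiv 𝓘(ℝ, E) 𝓘(ℝ, F × K) (fun y => ((q ∘ chartAt E x) y, h y)) x v : F × K) =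
        (q.prod B) v := by
    intro v
    have hm := hφ.mdifferentiableAt (mem_chart_source E x)
    rw [mfderiv_prodMk_space_apply (q.mdifferentiableAt.comp x hm)
      ((hh.contMDiffAt (hU.mem_nhds hx)).mdifferentiableAt (by simp)),
      mfderiv_comp_apply x q.mdifferentiableAt hm, ContinuousLinearMap.mfderiv_eq]
    have h1 : mfderiv 𝓘(ℝ, E) 𝓘(ℝ, E) (chartAt E x) x v = v := by
      have := mfderiv_extChartAt_self (I := 𝓘(ℝ, E)) (x := x)
      simp only [mfld_simps] at this
      rw [this]; rfl
    rw [h1]; rfl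
  obtain ⟨Ψ, h1, h2, h3, h4⟩ := exists_isDiffeo (hU.inter (chartAt E x).open_source)
    ⟨hx, mem_chart_source E x⟩ hΘ (by
      have : (mfderiv 𝓘(ℝ, E) 𝓘(ℝ, F × K) (fun y => ((q ∘ chartAt E x) y, h y)) x : E → F × K) =
        q.prod B := funext hd
      rw [this]; exact hq)
  refine ⟨Ψ, h1, h4, fun y hy => ?_⟩
  rw [h3 hy, hL y (h2 hy).1]

variable {Y : Type*} [TopologicalSpace Y]

/-- The image of an injective immersion which is a topological embedding has slice charts. -/
theorem hasSliceChart_range [IsManifold 𝓘(ℝ, E) ∞ N] [ChartedSpace F Y] [IsManifold 𝓘(ℝ, F) ∞ Y]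
    {j : Y → N} (hj : ContMDiff 𝓘(ℝ, F) 𝓘(ℝ, E) ∞ j) (hemb : IsEmbedding j) (y : Y)
    (hinj : Function.Injective (mfderiv 𝓘(ℝ, F) 𝓘(ℝ, E) j y))
    (hdim : Module.finrank ℝ F + Module.finrank ℝ K = Module.finrank ℝ E) :
    HasSliceChart E F K (range j) (j y) := by
  have : CompleteSpace F := FiniteDimensional.complete ℝ F
  have : CompleteSpace K := FiniteDimensional.complete ℝ K
  let A : F →L[ℝ] E := mfderiv 𝓘(ℝ, F) 𝓘(ℝ, E) j y
  obtain ⟨ι, hι⟩ := exists_complement_param (K := K) A hinj hdim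
  set φ := chartAt F y with hφ
  set ψ := chartAt E (j y) with hψ
  set s := φ.target ∩ φ.symm ⁻¹' (j ⁻¹' ψ.source) with hs
  have hso : IsOpen s := φ.isOpen_inter_preimage_symm (ψ.open_source.preimage hj.continuous)
  have hys : φ y ∈ s := ⟨mem_chart_target F y, by
    simp [hφ, hψ]⟩
  have hg : ContDiffOn ℝ ∞ (ψ ∘ j ∘ φ.symm) s := by
    rw [← contMDiffOn_iff_contDiffOn]
    exact (IsDiffeo.chartAt (j y)).1.comp (hj.comp_contMDiffOn
      ((IsDiffeo.chartAt y).2.mono fun u hu => hu.1)) fun u hu => hu.2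
  have hder : fderiv ℝ (ψ ∘ j ∘ φ.symm) (φ y) = A := by
    simp only [A, mfderiv, hj.mdifferentiableAt (by simp : (∞ : WithTop ℕ∞) ≠ 0)]
    simp [writtenInExtChartAt, fderivWithin_univ, hφ, hψ, mfld_simps]
  -- thicken the parametrization `j` along a complement of its tangent space
  set Θ : F × K → E := fun p => (ψ ∘ j ∘ φ.symm) p.1 + ι p.2 with hΘ
  have hΘs : ContDiffOn ℝ ∞ Θ (s ×ˢ univ) :=
    (hg.comp contDiff_fst.contDiffOn fun p hp => hp.1).add
      (ι.contDiff.comp contDiff_snd).contDiffOn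
  have hΘd : HasFDerivAt Θ (A.coprod ι) (φ y, 0) := by
    have h1 : HasFDerivAt (ψ ∘ j ∘ φ.symm) A (φ y) := by
      rw [← hder]
      exact ((hg.contDiffAt (hso.mem_nhds hys)).differentiableAt (by simp)).hasFDerivAt
    have h2 : HasFDerivAt (fun p : F × K => (ψ ∘ j ∘ φ.symm) p.1)
        (A.comp (ContinuousLinearMap.fst ℝ F K)) (φ y, 0) :=
      HasFDerivAt.comp (g := ψ ∘ j ∘ φ.symm) (f := Prod.fst) (φ y, (0 : K)) h1 hasFDerivAt_fst
    have h3 : HasFDerivAt (fun p : F × K => ι p.2)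
        (ι.comp (ContinuousLinearMap.snd ℝ F K)) (φ y, 0) :=
      (ι.comp (ContinuousLinearMap.snd ℝ F K)).hasFDerivAt
    exact (h2.add h3).congr_fderiv (by ext <;> simp)
  obtain ⟨Ξ, h1, h2, h3, h4⟩ := isDiffeo_of_contDiffOn (hso.prod isOpen_univ) hΘs
    (x := (φ y, 0)) ⟨hys, mem_univ _⟩
    (f' := (LinearEquiv.ofBijective (A.coprod ι).toLinearMap hι).toContinuousLinearEquiv) hΘd
  have hΞ : ∀ y' ∈ φ.source, (φ y', (0 : K)) ∈ Ξ.source → Ξ (φ y', 0) = ψ (j y') := by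
    intro y' hy' _
    rw [h3]
    simp [hΘ, φ.left_inv hy']
  -- points of `range j` close to `j y` are images of points close to `y`
  obtain ⟨O, hO, hOeq⟩ := hemb.isInducing.isOpen_iff.1
    (φ.continuousOn.isOpen_inter_preimage φ.open_source
      (Ξ.open_source.preimage (by fun_prop : Continuous fun u : F => (u, (0 : K)))))
  have hyO : y ∈ φ.source ∩ φ ⁻¹' ((fun u : F => (u, (0 : K))) ⁻¹' Ξ.source) :=
    ⟨mem_chart_source F y, h1⟩
  refine ⟨((ψ.trans Ξ.symm).restrOpen O hO), ?_, ?_, ?_⟩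
  · refine ⟨⟨mem_chart_source E _, ?_⟩, ?_⟩
    · change ψ (j y) ∈ Ξ.target
      rw [← hΞ y (mem_chart_source F y) h1]
      exact Ξ.map_source h1
    · rw [← hOeq] at hyO; exact hyO
  · exact ((IsDiffeo.chartAt (j y)).trans h4.symm).restr hO
  · rintro z ⟨⟨hz1, hz2⟩, hzO⟩
    change z ∈ ψ.source at hz1
    change ψ z ∈ Ξ.target at hz2
    change z ∈ range j ↔ (Ξ.symm (ψ z)).2 = 0
    constructor
    · rintro ⟨y', rfl⟩
      have hy' : y' ∈ j ⁻¹' O := hzO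
      rw [hOeq] at hy'
      rw [← hΞ y' hy'.1 hy'.2, Ξ.left_inv hy'.2]
    · intro h0
      have hu := Ξ.map_target hz2
      have h5 : Ξ (Ξ.symm (ψ z)) = ψ z := Ξ.right_inv hz2
      have h6 := (h2 hu).1
      rw [h3] at h5
      simp only [hΘ, h0, map_zero, add_zero] at h5
      exact ⟨_, ψ.injOn h6.2 hz1 h5⟩

/-- The chart on `Y` obtained by restricting a slice chart for the image of `j : Y → N`. -/
noncomputable def sliceRestrict {j : Y → N} (hemb : IsEmbedding j) (y₀ : Y)
    (Ψ : OpenPartialHomeomorph N (F × K)) (hΨ : ∀ y ∈ Ψ.source, (y ∈ range j ↔ (Ψ y).2 = 0)) :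
    OpenPartialHomeomorph Y F :=
  haveI : Nonempty Y := ⟨y₀⟩
  have hinv : ∀ u : F, (u, (0 : K)) ∈ Ψ.target →
      j (Function.invFun j (Ψ.symm (u, 0))) = Ψ.symm (u, 0) := fun u hu =>
    Function.invFun_eq ((hΨ _ (Ψ.map_target hu)).2 (by rw [Ψ.right_inv hu]))
  have hzero : ∀ y : Y, j y ∈ Ψ.source → ((Ψ (j y)).1, (0 : K)) = Ψ (j y) := fun y hy =>
    Prod.ext rfl ((hΨ _ hy).1 ⟨y, rfl⟩).symm
  { toFun := fun y => (Ψ (j y)).1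
    invFun := fun u => Function.invFun j (Ψ.symm (u, 0))
    source := j ⁻¹' Ψ.source
    target := (fun u => (u, (0 : K))) ⁻¹' Ψ.target
    map_source' := fun y hy => by
      rw [mem_preimage, hzero y hy]; exact Ψ.map_source hy
    map_target' := fun u hu => by
      rw [mem_preimage, hinv u hu]; exact Ψ.map_target hu
    left_inv' := fun y hy => by
      rw [hzero y hy, Ψ.left_inv hy, Function.leftInverse_invFun hemb.injective]
    right_inv' := fun u hu => by
      rw [hinv u hu, Ψ.right_inv hu]
    open_source := Ψ.open_source.preimage hemb.continuous
    open_target := Ψ.open_target.preimage (by fun_prop)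
    continuousOn_toFun := continuous_fst.comp_continuousOn
      (Ψ.continuousOn.comp hemb.continuous.continuousOn fun y hy => hy)
    continuousOn_invFun := by
      rw [hemb.continuousOn_iff]
      refine (Ψ.continuousOn_symm.comp
        (by fun_prop : Continuous fun u : F => (u, (0 : K))).continuousOn fun u hu => hu).congr ?_
      intro u hu
      exact hinv u hu }

theorem sliceRestrict_symm {j : Y → N} (hemb : IsEmbedding j) (y₀ : Y)
    (Ψ : OpenPartialHomeomorph N (F × K)) (hΨ : ∀ y ∈ Ψ.source, (y ∈ range j ↔ (Ψ y).2 = 0))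
    {u : F} (hu : (u, (0 : K)) ∈ Ψ.target) :
    j ((sliceRestrict hemb y₀ Ψ hΨ).symm u) = Ψ.symm (u, 0) :=
  haveI : Nonempty Y := ⟨y₀⟩
  Function.invFun_eq ((hΨ _ (Ψ.map_target hu)).2 (by rw [Ψ.right_inv hu]))

/-- If the image of a topological embedding `j : Y → N` has slice charts everywhere, then `Y` is a
manifold and `j` is a smooth embedding. -/
theorem exists_chartedSpace_of_hasSliceChart [IsManifold 𝓘(ℝ, E) ∞ N] {j : Y → N}
    (hemb : IsEmbedding j) (hs : ∀ y, HasSliceChart E F K (range j) (j y)) :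
    ∃ _ : ChartedSpace F Y, IsManifold 𝓘(ℝ, F) ∞ Y ∧
      IsSmoothEmbedding 𝓘(ℝ, F) 𝓘(ℝ, E) ∞ j := by
  choose Ψ hΨ1 hΨ2 hΨ3 using hs
  let cs : ChartedSpace F Y :=
    { atlas := range fun y => sliceRestrict hemb y (Ψ y) (hΨ3 y)
      chartAt := fun y => sliceRestrict hemb y (Ψ y) (hΨ3 y)
      mem_chart_source := fun y => hΨ1 y
      chart_mem_atlas := fun y => mem_range_self y }
  have hman : IsManifold 𝓘(ℝ, F) ∞ Y := by
    refine isManifold_of_contDiffOn _ _ _ ?_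
    rintro _ _ ⟨y, rfl⟩ ⟨y', rfl⟩
    simp only [modelWithCornersSelf_coe, modelWithCornersSelf_coe_symm, Function.id_comp,
      Function.comp_id, preimage_id, range_id, inter_univ]
    have h1 : ContMDiffOn 𝓘(ℝ, F) 𝓘(ℝ, E) ∞ (fun u : F => (Ψ y).symm (u, 0))
        ((fun u => (u, (0 : K))) ⁻¹' (Ψ y).target) :=
      (hΨ2 y).2.comp (by
        rw [contMDiffOn_iff_contDiffOn]; fun_prop) fun u hu => hu
    have h2 : ContMDiffOn 𝓘(ℝ, F) 𝓘(ℝ, F) ∞ (fun u : F => (Ψ y' ((Ψ y).symm (u, 0))).1)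
        (((fun u => (u, (0 : K))) ⁻¹' (Ψ y).target) ∩
          (fun u : F => (Ψ y).symm (u, 0)) ⁻¹' (Ψ y').source) :=
      (ContinuousLinearMap.fst ℝ F K).contMDiff.comp_contMDiffOn
        ((hΨ2 y').1.comp (h1.mono inter_subset_left) fun u hu => hu.2)
    rw [contMDiffOn_iff_contDiffOn] at h2
    refine (h2.mono ?_).congr ?_
    · rintro u ⟨hu1, hu2⟩
      refine ⟨hu1, ?_⟩
      have hu2' : j ((sliceRestrict hemb y (Ψ y) (hΨ3 y)).symm u) ∈ (Ψ y').source := hu2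
      rwa [sliceRestrict_symm hemb y (Ψ y) (hΨ3 y) hu1] at hu2'
    · rintro u ⟨hu1, hu2⟩
      change (Ψ y' (j ((sliceRestrict hemb y (Ψ y) (hΨ3 y)).symm u))).1 = _
      rw [sliceRestrict_symm hemb y (Ψ y) (hΨ3 y) hu1]
  refine ⟨cs, hman, ?_, hemb⟩
  refine IsImmersionOfComplement.isImmersion (F := K) fun y => ?_
  have hdim := (hΨ2 y).finrank_eq (hΨ1 y)
  let e : (F × K) ≃L[ℝ] E := ContinuousLinearEquiv.ofFinrankEq hdim.symm
  refine IsImmersionAtOfComplement.mk_of_charts e (chartAt F y)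
    ((Ψ y).trans e.toHomeomorph.toOpenPartialHomeomorph) (mem_chart_source F y) ?_
    (IsManifold.chart_mem_maximalAtlas y)
    ((hΨ2 y).trans (isDiffeo_of_continuousLinearEquiv e)).mem_maximalAtlas ?_ ?_
  · exact ⟨hΨ1 y, mem_univ _⟩
  · exact fun z hz => ⟨hz, mem_univ _⟩
  · intro u hu
    have hu' : (u, (0 : K)) ∈ (Ψ y).target := by
      have hu'' : u ∈ (chartAt F y).target := by simpa using hu
      exact hu''
    change e (Ψ y (j ((sliceRestrict hemb y (Ψ y) (hΨ3 y)).symm u))) = e (u, 0)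
    rw [sliceRestrict_symm hemb y (Ψ y) (hΨ3 y) hu', (Ψ y).right_inv hu']

variable {E' : Type*} [NormedAddCommGroup E'] [NormedSpace ℝ E']
  {X : Type*} [TopologicalSpace X] [ChartedSpace E' X]

theorem mfderiv_mem_range_of_hasSliceChart [IsManifold 𝓘(ℝ, E) ∞ N] [ChartedSpace F Y]
    [IsManifold 𝓘(ℝ, F) ∞ Y] {j : Y → N} (hj : ContMDiff 𝓘(ℝ, F) 𝓘(ℝ, E) ∞ j)
    {y : Y} (hs : HasSliceChart E F K (range j) (j y))
    (hinj : Function.Injective (mfderiv 𝓘(ℝ, F) 𝓘(ℝ, E) j y))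
    {f : X → N} {x : X} (hf : MDifferentiableAt 𝓘(ℝ, E') 𝓘(ℝ, E) f x) (hfx : f x = j y)
    (hr : ∀ᶠ x' in 𝓝 x, f x' ∈ range j) (v : TangentSpace 𝓘(ℝ, E') x) :
    ∃ w : TangentSpace 𝓘(ℝ, F) y,
      (mfderiv 𝓘(ℝ, F) 𝓘(ℝ, E) j y w : E) = mfderiv 𝓘(ℝ, E') 𝓘(ℝ, E) f x v := by
  obtain ⟨Ψ, h1, h2, h3⟩ := hs
  have hm := h2.mdifferentiableAt h1
  have hsnd : MDifferentiableAt 𝓘(ℝ, F × K) 𝓘(ℝ, K) (ContinuousLinearMap.snd ℝ F K) (Ψ (j y)) :=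
    ContinuousLinearMap.mdifferentiableAt _
  have hjy : MDifferentiableAt 𝓘(ℝ, F) 𝓘(ℝ, E) j y := hj.mdifferentiableAt (by simp)
  let D : E →L[ℝ] F × K := mfderiv 𝓘(ℝ, E) 𝓘(ℝ, F × K) Ψ (j y)
  let A : F →L[ℝ] E := mfderiv 𝓘(ℝ, F) 𝓘(ℝ, E) j y
  have hDinj : Function.Injective D := h2.mfderiv_injective h1
  -- `snd ∘ Ψ` vanishes along any map into `range j`, in particular along `f` and `j`
  have hf0 : (D (mfderiv 𝓘(ℝ, E') 𝓘(ℝ, E) f x v)).2 = 0 := by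
    have hz : (ContinuousLinearMap.snd ℝ F K) ∘ Ψ ∘ f =ᶠ[𝓝 x] fun _ => (0 : K) := by
      have : ∀ᶠ x' in 𝓝 x, f x' ∈ Ψ.source :=
        hf.continuousAt.eventually (Ψ.open_source.mem_nhds (hfx ▸ h1))
      filter_upwards [hr, this] with x' h4 h5 using (h3 _ h5).1 h4
    have hc := hz.mfderiv_eq (I := 𝓘(ℝ, E')) (I' := 𝓘(ℝ, K))
    rw [mfderiv_const] at hc
    have hc' := congrArg (fun T => T v) hc
    rw [mfderiv_comp_apply_of_eq x (y := Ψ (j y)) hsnd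
        (MDifferentiableAt.comp_of_eq (y := j y) x hm hf hfx)
        (by simp [hfx]),
      mfderiv_comp_apply_of_eq x (y := j y) hm hf hfx, ContinuousLinearMap.mfderiv_eq] at hc'
    exact hc'
  have hj0 : ∀ w : TangentSpace 𝓘(ℝ, F) y, (D (A w)).2 = 0 := by
    intro w
    have hz : (ContinuousLinearMap.snd ℝ F K) ∘ Ψ ∘ j =ᶠ[𝓝 y] fun _ => (0 : K) := by
      have : ∀ᶠ y' in 𝓝 y, j y' ∈ Ψ.source :=
        hjy.continuousAt.eventually (Ψ.open_source.mem_nhds h1)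
      filter_upwards [this] with y' h5 using (h3 _ h5).1 ⟨y', rfl⟩
    have hc := hz.mfderiv_eq (I := 𝓘(ℝ, F)) (I' := 𝓘(ℝ, K))
    rw [mfderiv_const] at hc
    have hc' := congrArg (fun T => T w) hc
    rw [mfderiv_comp_apply y hsnd (hm.comp y hjy), mfderiv_comp_apply y hm hjy,
      ContinuousLinearMap.mfderiv_eq] at hc'
    exact hc'
  -- `w ↦ fst (D (A w))` is injective, hence onto for dimension reasons
  let T : F →ₗ[ℝ] F := LinearMap.fst ℝ F K ∘ₗ D.toLinearMap ∘ₗ A.toLinearMap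
  have hTinj : Function.Injective T := by
    intro w w' hww
    exact hinj (hDinj (Prod.ext hww ((hj0 w).trans (hj0 w').symm)))
  obtain ⟨w, hw⟩ := (LinearMap.injective_iff_surjective.1 hTinj)
    (D (mfderiv 𝓘(ℝ, E') 𝓘(ℝ, E) f x v)).1
  exact ⟨w, hDinj (Prod.ext hw ((hj0 w).trans hf0.symm))⟩

/-- A map with values in the image of an embedding is differentiated into the tangent spaces of
that image. -/
theorem mfderiv_mem_range_of_eventually_mem_range [IsManifold 𝓘(ℝ, E) ∞ N] [ChartedSpace F Y]
    [IsManifold 𝓘(ℝ, F) ∞ Y] {j : Y → N} (hj : ContMDiff 𝓘(ℝ, F) 𝓘(ℝ, E) ∞ j)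
    (hemb : IsEmbedding j) {y : Y} (hinj : Function.Injective (mfderiv 𝓘(ℝ, F) 𝓘(ℝ, E) j y))
    {f : X → N} {x : X} (hf : MDifferentiableAt 𝓘(ℝ, E') 𝓘(ℝ, E) f x) (hfx : f x = j y)
    (hr : ∀ᶠ x' in 𝓝 x, f x' ∈ range j) (v : TangentSpace 𝓘(ℝ, E') x) :
    ∃ w : TangentSpace 𝓘(ℝ, F) y,
      (mfderiv 𝓘(ℝ, F) 𝓘(ℝ, E) j y w : E) = mfderiv 𝓘(ℝ, E') 𝓘(ℝ, E) f x v := by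
  have hle : Module.finrank ℝ F ≤ Module.finrank ℝ E :=
    LinearMap.finrank_le_finrank_of_injective
      (f := ContinuousLinearMap.toLinearMap (M := F) (M₂ := E) (mfderiv 𝓘(ℝ, F) 𝓘(ℝ, E) j y)) hinj
  exact mfderiv_mem_range_of_hasSliceChart hj (hasSliceChart_range
    (K := EuclideanSpace ℝ (Fin (Module.finrank ℝ E - Module.finrank ℝ F))) hj hemb y hinj
    (by simp; omega)) hinj hf hfx hr v

end Slices

/-! ### Differential 1-forms and their exterior derivative -/

section ExteriorDerivative

variable {V W : Type*} [NormedAddCommGroup V] [NormedSpace ℝ V] [NormedAddCommGroup W]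
  [NormedSpace ℝ W]

/-- The exterior derivative of a 1-form on a normed space. -/
noncomputable def extD (β : V → V →L[ℝ] ℝ) (p : V) : V →L[ℝ] V →L[ℝ] ℝ :=
  fderiv ℝ β p - (fderiv ℝ β p).flip

theorem extD_apply (β : V → V →L[ℝ] ℝ) (p u v : V) :
    extD β p u v = fderiv ℝ β p u v - fderiv ℝ β p v u := rfl

/-- The second derivative of `F` contributes nothing, being symmetric. -/
theorem extD_pullback {F : V → W} {a : W → W →L[ℝ] ℝ} {p : V} (hF : ContDiffAt ℝ ∞ F p)
    (ha : DifferentiableAt ℝ a (F p)) (u v : V) :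
    extD (fun q => (a (F q)).comp (fderiv ℝ F q)) p u v =
      extD a (F p) (fderiv ℝ F p u) (fderiv ℝ F p v) := by
  have hF1 : DifferentiableAt ℝ F p := hF.differentiableAt (by simp)
  have hF2 : DifferentiableAt ℝ (fderiv ℝ F) p :=
    (hF.fderiv_right (m := ∞) (by simp)).differentiableAt (by simp)
  have hsymm : IsSymmSndFDerivAt ℝ F p := hF.isSymmSndFDerivAt (by
    simp; exact WithTop.coe_le_coe.2 (le_top : (2 : ℕ∞) ≤ ⊤))
  have h1 : HasFDerivAt (fun q => a (F q)) ((fderiv ℝ a (F p)).comp (fderiv ℝ F p)) p :=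
    ha.hasFDerivAt.comp p hF1.hasFDerivAt
  have h2 := h1.clm_comp hF2.hasFDerivAt
  rw [extD_apply, h2.fderiv]
  have h3 := hsymm u v
  simp [extD_apply, h3]

end ExteriorDerivative

section Forms

variable {E : Type*} [NormedAddCommGroup E] [NormedSpace ℝ E]
  {E' : Type*} [NormedAddCommGroup E'] [NormedSpace ℝ E']
  {E'' : Type*} [NormedAddCommGroup E''] [NormedSpace ℝ E'']
  {N : Type*} [TopologicalSpace N] [ChartedSpace E N]
  {P : Type*} [TopologicalSpace P] [ChartedSpace E' P]
  {Q : Type*} [TopologicalSpace Q] [ChartedSpace E'' Q]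

variable (E N) in
/-- A 1-form on a manifold, without any regularity. -/
abbrev OneForm : Type _ := (x : N) → (TangentSpace 𝓘(ℝ, E) x →L[ℝ] ℝ)

/-- A 1-form on a normed space, as a map into the dual space. -/
def OneForm.toMap (β : OneForm E E) : E → E →L[ℝ] ℝ := fun q => β q

/-- Smoothness of a 1-form on a set, as a function on the tangent bundle. -/
def SmoothFormOn [IsManifold 𝓘(ℝ, E) ∞ N] (α : OneForm E N) (U : Set N) : Prop :=
  ContMDiffOn 𝓘(ℝ, E).tangent 𝓘(ℝ, ℝ) ∞ (fun p : TangentBundle 𝓘(ℝ, E) N => α p.1 p.2)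
    {p | p.1 ∈ U}

/-- The pullback of a 1-form. -/
noncomputable def pullForm (f : N → P) (α : OneForm E' P) : OneForm E N :=
  fun x => (α (f x)).comp (mfderiv 𝓘(ℝ, E) 𝓘(ℝ, E') f x)

theorem OneForm.congr_point (α : OneForm E N) {x y : N} (h : x = y) :
    (α x : E →L[ℝ] ℝ) = α y := by subst h; rfl

theorem pullForm_congr {f g : N → P} {x : N} (h : f =ᶠ[𝓝 x] g) (α : OneForm E' P) :
    (pullForm f α x : E →L[ℝ] ℝ) = pullForm (E := E) g α x := by
  have h1 : (mfderiv 𝓘(ℝ, E) 𝓘(ℝ, E') f x : E →L[ℝ] E') = mfderiv 𝓘(ℝ, E) 𝓘(ℝ, E') g x :=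
    h.mfderiv_eq
  have h2 := α.congr_point h.eq_of_nhds
  change ContinuousLinearMap.comp (α (f x) : E' →L[ℝ] ℝ)
      (mfderiv 𝓘(ℝ, E) 𝓘(ℝ, E') f x : E →L[ℝ] E') =
    ContinuousLinearMap.comp (α (g x) : E' →L[ℝ] ℝ) (mfderiv 𝓘(ℝ, E) 𝓘(ℝ, E') g x : E →L[ℝ] E')
  rw [h1, h2]
  rfl

theorem pullForm_comp {g : P → Q} {f : N → P} {x : N}
    (hg : MDifferentiableAt 𝓘(ℝ, E') 𝓘(ℝ, E'') g (f x))
    (hf : MDifferentiableAt 𝓘(ℝ, E) 𝓘(ℝ, E') f x) (α : OneForm E'' Q) :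
    pullForm (E := E) (g ∘ f) α x = pullForm f (pullForm (E := E') g α) x := by
  simp only [pullForm]
  rw [mfderiv_comp x hg hf]
  rfl

theorem SmoothFormOn.pullForm [IsManifold 𝓘(ℝ, E) ∞ N] [IsManifold 𝓘(ℝ, E') ∞ P]
    {α : OneForm E' P} {U : Set P} (hα : SmoothFormOn α U) {f : N → P} {O : Set N} (hO : IsOpen O)
    (hf : ContMDiffOn 𝓘(ℝ, E) 𝓘(ℝ, E') ∞ f O) (hm : MapsTo f O U) :
    SmoothFormOn (E := E) (pullForm f α) O := by
  have h1 := hf.contMDiffOn_tangentMapWithin (m := ∞) (by simp) hO.uniqueMDiffOn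
  refine (ContMDiffOn.comp hα h1 fun p hp => hm hp).congr ?_
  rintro ⟨x, v⟩ hx
  change _ = α (f x) (mfderivWithin 𝓘(ℝ, E) 𝓘(ℝ, E') f O x v)
  rw [mfderivWithin_of_isOpen hO hx]
  rfl

theorem SmoothFormOn.contDiffOn [FiniteDimensional ℝ E] {β : OneForm E E} {O : Set E}
    (hβ : SmoothFormOn β O) : ContDiffOn ℝ ∞ β.toMap O := by
  rw [contDiffOn_clm_apply]
  intro v
  rw [← contMDiffOn_iff_contDiffOn]
  have h1 : ContMDiffOn 𝓘(ℝ, E) 𝓘(ℝ, E).tangent ∞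
      (fun q : E => (⟨q, v⟩ : TangentBundle 𝓘(ℝ, E) E)) O :=
    contMDiffOn_vectorSpace_iff_contDiffOn (V := fun _ => v) |>.2 contDiffOn_const
  exact ContMDiffOn.comp hβ h1 fun q hq => hq

theorem mfderiv_chartAt_self [IsManifold 𝓘(ℝ, E) ∞ N] (x : N) (v : TangentSpace 𝓘(ℝ, E) x) :
    (mfderiv 𝓘(ℝ, E) 𝓘(ℝ, E) (chartAt E x) x v : E) = v := by
  have := mfderiv_extChartAt_self (I := 𝓘(ℝ, E)) (x := x)
  simp only [mfld_simps] at this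
  rw [this]; rfl

theorem mfderiv_chartAt_symm_self [IsManifold 𝓘(ℝ, E) ∞ N] (x : N) (v : E) :
    (mfderiv 𝓘(ℝ, E) 𝓘(ℝ, E) (chartAt E x).symm (chartAt E x x) v : E) = v := by
  have := (IsDiffeo.chartAt x).mfderiv_symm_apply_mfderiv (mem_chart_source E x) v
  have h2 := mfderiv_chartAt_self x (v : TangentSpace 𝓘(ℝ, E) x)
  rw [h2] at this
  exact this

/-- The exterior derivative at `x` of a 1-form, computed in the preferred chart at `x`; it is this
chart that identifies the tangent space at `x` with the model space. -/
noncomputable def dForm (α : OneForm E N) (x : N) : E →L[ℝ] E →L[ℝ] ℝ :=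
  extD (pullForm (E := E) (chartAt E x).symm α).toMap (chartAt E x x)

theorem dForm_apply_swap (α : OneForm E N) (x : N) (u v : E) : dForm α x u v = - dForm α x v u := by
  simp only [dForm, extD_apply, neg_sub]

theorem pullForm_chartAt_symm_self [IsManifold 𝓘(ℝ, E) ∞ N] (α : OneForm E N) (x : N) (v : E) :
    pullForm (E := E) (chartAt E x).symm α (chartAt E x x) v = α x v := by
  change α ((chartAt E x).symm (chartAt E x x))
    (mfderiv 𝓘(ℝ, E) 𝓘(ℝ, E) (chartAt E x).symm (chartAt E x x) v) = _
  have h := α.congr_point ((chartAt E x).left_inv (mem_chart_source E x))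
  have h2 := congrArg (fun T : E →L[ℝ] ℝ => T v) h
  refine Eq.trans ?_ h2
  exact congrArg (α ((chartAt E x).symm (chartAt E x x)) : E →L[ℝ] ℝ)
    (mfderiv_chartAt_symm_self x v)

theorem contDiffOn_pullForm_chartAt_symm [FiniteDimensional ℝ E] [IsManifold 𝓘(ℝ, E) ∞ N]
    {α : OneForm E N} {U : Set N} (hU : IsOpen U) (hα : SmoothFormOn α U) (x : N) :
    ContDiffOn ℝ ∞ (pullForm (E := E) (chartAt E x).symm α).toMap
      ((chartAt E x).target ∩ (chartAt E x).symm ⁻¹' U) :=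
  SmoothFormOn.contDiffOn (hα.pullForm ((chartAt E x).isOpen_inter_preimage_symm hU)
    ((IsDiffeo.chartAt x).2.mono inter_subset_left) fun _ hq => hq.2)

theorem differentiableAt_pullForm_chartAt_symm [FiniteDimensional ℝ E] [IsManifold 𝓘(ℝ, E) ∞ N]
    {α : OneForm E N} {U : Set N} (hU : IsOpen U) (hα : SmoothFormOn α U) {x : N} (hx : x ∈ U) :
    DifferentiableAt ℝ (pullForm (E := E) (chartAt E x).symm α).toMap
      (chartAt E x x) :=
  ((contDiffOn_pullForm_chartAt_symm hU hα x).contDiffAt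
    (((chartAt E x).isOpen_inter_preimage_symm hU).mem_nhds ⟨mem_chart_target E x, by
      simpa [(chartAt E x).left_inv (mem_chart_source E x)] using hx⟩)).differentiableAt (by simp)

theorem dForm_eq_extD (β : OneForm E E) (p : E) :
    dForm β p = extD β.toMap p := by
  have h1 : (pullForm (E := E) (chartAt E p).symm β).toMap = β.toMap := by
    funext q
    have h2 : ((chartAt E p).symm : E → E) =ᶠ[𝓝 q] id := by
      rw [chartAt_self_eq]; exact Filter.EventuallyEq.rfl
    refine (pullForm_congr h2 β).trans ?_
    change ContinuousLinearMap.comp (β q) (mfderiv 𝓘(ℝ, E) 𝓘(ℝ, E) id q) = β q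
    rw [mfderiv_id]
    rfl
  rw [dForm, h1, chartAt_self_eq]
  rfl

/-- The exterior derivative commutes with pullbacks. -/
theorem dForm_pullForm [FiniteDimensional ℝ E] [FiniteDimensional ℝ E'] [IsManifold 𝓘(ℝ, E) ∞ N]
    [IsManifold 𝓘(ℝ, E') ∞ P] {α : OneForm E' P} {U : Set P} (hU : IsOpen U)
    (hα : SmoothFormOn α U) {f : N → P} {O : Set N} (hO : IsOpen O)
    (hf : ContMDiffOn 𝓘(ℝ, E) 𝓘(ℝ, E') ∞ f O) {x : N} (hx : x ∈ O) (hfx : f x ∈ U)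
    (u v : TangentSpace 𝓘(ℝ, E) x) :
    dForm (E := E) (pullForm f α) x u v =
      dForm α (f x) (mfderiv 𝓘(ℝ, E) 𝓘(ℝ, E') f x u) (mfderiv 𝓘(ℝ, E) 𝓘(ℝ, E') f x v) := by
  set φ := chartAt E x with hφ
  set ψ := chartAt E' (f x) with hψ
  set F : E → E' := ψ ∘ f ∘ φ.symm with hF
  set s := φ.target ∩ φ.symm ⁻¹' (O ∩ f ⁻¹' ψ.source) with hs
  have hso : IsOpen s := φ.isOpen_inter_preimage_symm
    (hf.continuousOn.isOpen_inter_preimage hO ψ.open_source)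
  have hxs : φ x ∈ s := ⟨mem_chart_target E x, by
    simpa [hφ, hψ, φ.left_inv (mem_chart_source E x)] using hx⟩
  have hFm : ContMDiffOn 𝓘(ℝ, E) 𝓘(ℝ, E') ∞ F s := by
    refine (IsDiffeo.chartAt (f x)).1.comp (hf.comp ((IsDiffeo.chartAt x).2.mono ?_) ?_) ?_
    · exact fun y hy => hy.1
    · exact fun y hy => hy.2.1
    · exact fun y hy => hy.2.2
  have hFs : ContDiffOn ℝ ∞ F s := contMDiffOn_iff_contDiffOn.1 hFm
  have hmd : MDifferentiableAt 𝓘(ℝ, E) 𝓘(ℝ, E') f x :=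
    (hf.contMDiffAt (hO.mem_nhds hx)).mdifferentiableAt (by simp)
  have hder : fderiv ℝ F (φ x) = mfderiv 𝓘(ℝ, E) 𝓘(ℝ, E') f x := by
    simp only [mfderiv, hmd]
    simp [writtenInExtChartAt, fderivWithin_univ, hφ, hψ, hF, mfld_simps]
  have hFx : F (φ x) = ψ (f x) := by
    simp [hF, hφ]
  have hev : (pullForm (E := E) φ.symm (pullForm (E := E) f α)).toMap =ᶠ[𝓝 (φ x)]
      fun q => ((pullForm (E := E') ψ.symm α).toMap (F q)).comp (fderiv ℝ F q) := by
    filter_upwards [hso.mem_nhds hxs] with q hq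
    have e1 : pullForm (E := E) φ.symm (pullForm f α) q = pullForm (E := E) (f ∘ φ.symm) α q :=
      (pullForm_comp ((hf.contMDiffAt (hO.mem_nhds hq.2.1)).mdifferentiableAt (by simp))
        ((IsDiffeo.chartAt x).mdifferentiableAt_symm hq.1) α).symm
    have e2 : (pullForm (E := E) (f ∘ φ.symm) α q : E →L[ℝ] ℝ) =
        pullForm (E := E) (ψ.symm ∘ F) α q := by
      refine pullForm_congr ?_ α
      filter_upwards [hso.mem_nhds hq] with q' hq'
      exact (ψ.left_inv hq'.2.2).symm
    have e3 : pullForm (E := E) (ψ.symm ∘ F) α q = pullForm F (pullForm (E := E') ψ.symm α) q :=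
      pullForm_comp (f := F) (x := q) (g := ψ.symm)
        ((IsDiffeo.chartAt (f x)).mdifferentiableAt_symm (ψ.map_source hq.2.2))
        ((hFm.contMDiffAt (hso.mem_nhds hq)).mdifferentiableAt (by simp)) α
    refine e1.trans (e2.trans (e3.trans ?_))
    change ContinuousLinearMap.comp _ (mfderiv 𝓘(ℝ, E) 𝓘(ℝ, E') F q) = _
    rw [mfderiv_eq_fderiv]
    rfl
  have hext : ∀ {b c : E → E →L[ℝ] ℝ}, b =ᶠ[𝓝 (φ x)] c → extD b (φ x) = extD c (φ x) := by
    intro b c h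
    simp only [extD, h.fderiv_eq]
  have hdiff := differentiableAt_pullForm_chartAt_symm hU hα hfx
  have key := extD_pullback (hFs.contDiffAt (hso.mem_nhds hxs))
    (a := (pullForm (E := E') ψ.symm α).toMap) (by rw [hFx]; exact hdiff) u v
  rw [← hext hev, hder, hFx] at key
  exact key

end Forms

/-! ### Brackets of sections of a field of hyperplanes -/

section Bracket

open VectorField

/-- The formula `a [X, Y] = - da (X, Y)` for vector fields annihilated by `a`; it follows by
differentiating the equations `a X = 0` and `a Y = 0`. -/
theorem apply_lieBracket_eq {V : Type*} [NormedAddCommGroup V] [NormedSpace ℝ V]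
    {a : V → V →L[ℝ] ℝ} {X Y : V → V} {p : V}
    (ha : DifferentiableAt ℝ a p) (hX : DifferentiableAt ℝ X p) (hY : DifferentiableAt ℝ Y p)
    (h0 : ∀ᶠ q in 𝓝 p, a q (X q) = 0) (h1 : ∀ᶠ q in 𝓝 p, a q (Y q) = 0) :
    a p (lieBracket ℝ X Y p) = - extD a p (X p) (Y p) := by
  have key : ∀ {Z : V → V}, DifferentiableAt ℝ Z p → (∀ᶠ q in 𝓝 p, a q (Z q) = 0) → ∀ w,
      a p (fderiv ℝ Z p w) = - fderiv ℝ a p w (Z p) := by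
    intro Z hZ h w
    have e1 := (ha.hasFDerivAt.clm_apply hZ.hasFDerivAt).fderiv
    have e2 : fderiv ℝ (fun q => a q (Z q)) p = 0 := by
      rw [Filter.EventuallyEq.fderiv_eq (f := fun _ => (0 : ℝ)) h]
      simp
    rw [e2] at e1
    have e3 := congrArg (fun T : V →L[ℝ] ℝ => T w) e1
    simp at e3
    linarith
  rw [lieBracket, map_sub, key hX h0, key hY h1, extD_apply]
  ring

variable {E : Type*} [NormedAddCommGroup E] [NormedSpace ℝ E] [FiniteDimensional ℝ E]
  {N : Type*} [TopologicalSpace N] [ChartedSpace E N] [IsManifold 𝓘(ℝ, E) ∞ N]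

omit [FiniteDimensional ℝ E] [IsManifold 𝓘(ℝ, E) ∞ N] in
theorem congr_vectorField (Z : (y : N) → TangentSpace 𝓘(ℝ, E) y) {x y : N} (h : x = y) :
    (Z x : E) = Z y := by subst h; rfl

/-- On vector fields annihilated by a 1-form `α`, one has `α [X, Y] = - dα (X, Y)`. -/
theorem apply_mlieBracket_eq {α : OneForm E N} {U : Set N} (hU : IsOpen U)
    (hα : SmoothFormOn α U) {x : N} (hx : x ∈ U) {X Y : (y : N) → TangentSpace 𝓘(ℝ, E) y}
    (hX : ContMDiffAt 𝓘(ℝ, E) 𝓘(ℝ, E).tangent ∞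
      (fun y => (⟨y, X y⟩ : TangentBundle 𝓘(ℝ, E) N)) x)
    (hY : ContMDiffAt 𝓘(ℝ, E) 𝓘(ℝ, E).tangent ∞
      (fun y => (⟨y, Y y⟩ : TangentBundle 𝓘(ℝ, E) N)) x)
    (hX0 : ∀ y ∈ U, α y (X y) = 0) (hY0 : ∀ y ∈ U, α y (Y y) = 0) :
    α x (mlieBracket 𝓘(ℝ, E) X Y x) = - dForm α x (X x) (Y x) := by
  have : IsManifold 𝓘(ℝ, E) (∞ + 1) N := ‹IsManifold 𝓘(ℝ, E) ∞ N›
  have : CompleteSpace E := FiniteDimensional.complete ℝ E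
  have key : ∀ {Z : (y : N) → TangentSpace 𝓘(ℝ, E) y}, ContMDiffAt 𝓘(ℝ, E) 𝓘(ℝ, E).tangent ∞
      (fun y => (⟨y, Z y⟩ : TangentBundle 𝓘(ℝ, E) N)) x → (∀ y ∈ U, α y (Z y) = 0) →
      ∃ Z' : E → E, Z' = mpullback 𝓘(ℝ, E) 𝓘(ℝ, E) (chartAt E x).symm Z ∧
        DifferentiableAt ℝ Z' (chartAt E x x) ∧ Z' (chartAt E x x) = Z x ∧
        ∀ᶠ q in 𝓝 (chartAt E x x), (pullForm (E := E) (chartAt E x).symm α).toMap q (Z' q) = 0 := by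
    intro Z hZ hZ0
    have hinv : ∀ q ∈ (chartAt E x).target,
        (mfderiv 𝓘(ℝ, E) 𝓘(ℝ, E) (chartAt E x).symm q).IsInvertible := by
      intro q hq
      have := isInvertible_mfderivWithin_extChartAt_symm (I := 𝓘(ℝ, E)) (x := x) (y := q)
        (by simpa using hq)
      simp only [mfderivWithin_univ, mfld_simps] at this
      exact this
    refine ⟨_, rfl, ?_, ?_, ?_⟩
    · have h1 := ContMDiffWithinAt.mpullback_vectorField_preimage (m := ∞) (n := ∞) (t := univ)
        (f := (chartAt E x).symm) (x₀ := chartAt E x x) (V := Z) (I := 𝓘(ℝ, E)) (I' := 𝓘(ℝ, E))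
        (by rw [(chartAt E x).left_inv (mem_chart_source E x)]; exact hZ.contMDiffWithinAt)
        ((IsDiffeo.chartAt x).contMDiffAt_symm (mem_chart_target E x))
        (hinv _ (mem_chart_target E x)) (by simp)
      have h2 := (contMDiffAt_vectorSpace_iff_contDiffAt).1 (contMDiffWithinAt_univ.1 h1)
      exact h2.differentiableAt (by simp)
    · have h1 := mfderiv_chartAt_symm_self (E := E) x (Z x)
      have h2 : (Z ((chartAt E x).symm (chartAt E x x)) : E) = Z x :=
        congr_vectorField Z ((chartAt E x).left_inv (mem_chart_source E x))
      change (mfderiv 𝓘(ℝ, E) 𝓘(ℝ, E) (chartAt E x).symm (chartAt E x x)).inverse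
        (Z ((chartAt E x).symm (chartAt E x x))) = _
      obtain ⟨e, he⟩ := hinv _ (mem_chart_target E x)
      rw [← he] at h1 ⊢
      rw [ContinuousLinearMap.inverse_equiv]
      exact e.symm_apply_eq.2 (h2.trans h1.symm)
    · filter_upwards [((chartAt E x).isOpen_inter_preimage_symm hU).mem_nhds
        (x := chartAt E x x) ⟨mem_chart_target E x, by
          simpa [(chartAt E x).left_inv (mem_chart_source E x)] using hx⟩] with q hq
      change α ((chartAt E x).symm q) (mfderiv 𝓘(ℝ, E) 𝓘(ℝ, E) (chartAt E x).symm q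
        ((mfderiv 𝓘(ℝ, E) 𝓘(ℝ, E) (chartAt E x).symm q).inverse (Z ((chartAt E x).symm q)))) = 0
      rw [(hinv q hq.1).self_apply_inverse]
      exact hZ0 _ hq.2
  obtain ⟨X', hX', hX1, hX2, hX3⟩ := key hX hX0
  obtain ⟨Y', hY', hY1, hY2, hY3⟩ := key hY hY0
  have h1 := apply_lieBracket_eq (differentiableAt_pullForm_chartAt_symm hU hα hx) hX1 hY1 hX3 hY3
  rw [hX2, hY2] at h1
  refine Eq.trans ?_ h1
  have h2 : (mlieBracket 𝓘(ℝ, E) X Y x : E) = lieBracket ℝ X' Y' (chartAt E x x) := by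
    rw [← mlieBracketWithin_univ, mlieBracketWithin_apply, mfderiv_extChartAt_self]
    simp only [mfld_simps, mpullbackWithin_univ, hX', hY']
    have h3 : ∀ w : E, ContinuousLinearMap.inverse (ContinuousLinearMap.id ℝ E) w = w := by simp
    exact (h3 _).trans (congrFun lieBracketWithin_univ _)
  refine Eq.trans ?_ (pullForm_chartAt_symm_self α x _).symm
  exact congrArg (α x : E →L[ℝ] ℝ) h2

end Bracket

/-! ### Characteristic directions -/

section CharacteristicDirections

variable {n : ℕ} {N : Type*} [TopologicalSpace N] [ChartedSpace (EuclideanSpace ℝ (Fin n)) N]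
  [IsManifold (𝓡 n) ∞ N]

/-- Every vector in a hyperplane `ker α` extends to a smooth local section of `ker α`. -/
theorem exists_isLocalSection {C : SubspaceField n N} {α : OneForm (EuclideanSpace ℝ (Fin n)) N}
    {U : Set N} (hU : IsOpen U) (hα : SmoothFormOn α U)
    (hC : ∀ y ∈ U, α y ≠ 0 ∧ ∀ v, v ∈ C y ↔ α y v = 0) {x : N} (hx : x ∈ U)
    {u' : TangentSpace (𝓡 n) x} (hu' : u' ∈ C x) :
    ∃ X : (y : N) → TangentSpace (𝓡 n) y, IsLocalSection C X x ∧ X x = u' := by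
  let E := EuclideanSpace ℝ (Fin n)
  obtain ⟨u, hu, huu⟩ : ∃ u : E, u ∈ C x ∧ u = u' := ⟨u', hu', rfl⟩
  set φ := chartAt E x
  set a : E → E →L[ℝ] ℝ := (pullForm (E := E) φ.symm α).toMap with ha
  have hφx : φ.symm (φ x) = x := φ.left_inv (mem_chart_source E x)
  obtain ⟨e, he⟩ : ∃ e : E, α x e ≠ 0 := by
    by_contra! h
    exact (hC x hx).1 (ContinuousLinearMap.ext h)
  have hae : a (φ x) e ≠ 0 := by
    have := pullForm_chartAt_symm_self α x e
    change a (φ x) e = α x e at this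
    rwa [this]
  have hau : a (φ x) u = 0 := by
    have := pullForm_chartAt_symm_self α x u
    change a (φ x) u = α x u at this
    rw [this]
    exact ((hC x hx).2 u).1 hu
  set O := φ.target ∩ φ.symm ⁻¹' U
  have hO : IsOpen O := φ.isOpen_inter_preimage_symm hU
  have hxO : φ x ∈ O := ⟨mem_chart_target E x, by simpa [hφx] using hx⟩
  have hacd : ContDiffOn ℝ ∞ a O := contDiffOn_pullForm_chartAt_symm hU hα x
  set O' := O ∩ {q | a q e ≠ 0}
  have hae' : ContDiffOn ℝ ∞ (fun q => a q e) O := hacd.clm_apply contDiffOn_const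
  have hO' : IsOpen O' := hae'.continuousOn.isOpen_inter_preimage hO isOpen_ne
  -- the constant field `u`, projected to the kernel of `a` along a vector `e` outside of it
  let Z : E → E := fun q => u - (a q u / a q e) • e
  have hZ : ∀ q, Z q = u - (a q u / a q e) • e := fun _ => rfl
  have hZs : ContDiffOn ℝ ∞ Z O' := by
    have h1 : ContDiffOn ℝ ∞ (fun q => a q u) O' :=
      (hacd.mono inter_subset_left).clm_apply contDiffOn_const
    have h2 : ContDiffOn ℝ ∞ (fun q => a q u / a q e) O' :=
      h1.div (hae'.mono inter_subset_left) fun q hq => hq.2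
    exact contDiffOn_const.sub (h2.smul contDiffOn_const)
  have haZ : ∀ q ∈ O', a q (Z q) = 0 := by
    intro q hq
    have : a q e ≠ 0 := hq.2
    rw [hZ, map_sub, map_smul, smul_eq_mul, div_mul_cancel₀ _ this, sub_self]
  have hZx : Z (φ x) = u := by simp [hZ, hau]
  let X' : N → E := fun y => mfderiv (𝓡 n) (𝓡 n) φ.symm (φ y) (Z (φ y))
  refine ⟨fun y => X' y, ⟨φ.source ∩ φ ⁻¹' O', φ.isOpen_inter_preimage hO',
    ⟨mem_chart_source E x, hxO, hae⟩, ?_, ?_⟩, ?_⟩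
  · have h1 : ContMDiffOn (𝓡 n) (𝓡 n).tangent ∞
        (fun q : E => (⟨q, Z q⟩ : TangentBundle (𝓡 n) E)) O' :=
      contMDiffOn_vectorSpace_iff_contDiffOn (V := Z) |>.2 hZs
    have h2 : ContMDiffOn (𝓡 n) (𝓡 n) ∞ φ.symm φ.target := (IsDiffeo.chartAt x).2
    have h3 := h2.contMDiffOn_tangentMapWithin (m := ∞) (by simp) φ.open_target.uniqueMDiffOn
    have h4 := (h3.comp h1 fun q hq => hq.1.1).comp
      ((IsDiffeo.chartAt x).1.mono inter_subset_left) fun y (hy : y ∈ φ.source ∩ φ ⁻¹' O') => hy.2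
    refine h4.congr ?_
    intro y hy
    have h5 : φ.symm (φ y) = y := φ.left_inv hy.1
    have h6 : ∀ z : N, z = y → (⟨y, X' y⟩ : TangentBundle (𝓡 n) N) = ⟨z, X' y⟩ := by
      rintro z rfl; rfl
    refine (h6 _ h5).trans ?_
    simp only [Function.comp, tangentMapWithin]
    rw [mfderivWithin_of_isOpen φ.open_target hy.2.1.1]
  · intro y hy
    have h5 : φ.symm (φ y) = y := φ.left_inv hy.1
    have hyU : y ∈ U := h5 ▸ hy.2.1.2
    refine ((hC y hyU).2 _).2 ?_
    have h7 := congrArg (fun T : E →L[ℝ] ℝ => T (X' y)) (α.congr_point h5)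
    exact h7.symm.trans (haZ _ hy.2)
  · change mfderiv (𝓡 n) (𝓡 n) φ.symm (φ x) (Z (φ x)) = u'
    rw [hZx, ← huu]
    exact mfderiv_chartAt_symm_self x u

/-- The form `τ` of a field of hyperplanes `ker α` is, up to a sign and the identification of the
normal line with `ℝ` given by `α`, the restriction of `dα` to the field. -/
theorem characteristicDirections_eq {C : SubspaceField n N}
    {α : OneForm (EuclideanSpace ℝ (Fin n)) N} {U : Set N} (hU : IsOpen U)
    (hα : SmoothFormOn α U) (hC : ∀ y ∈ U, α y ≠ 0 ∧ ∀ v, v ∈ C y ↔ α y v = 0) {x : N}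
    (hx : x ∈ U) :
    characteristicDirections C x = {u | u ∈ C x ∧ ∀ v ∈ C x, dForm α x u v = 0} := by
  have key : ∀ X Y : (y : N) → TangentSpace (𝓡 n) y, IsLocalSection C X x → IsLocalSection C Y x →
      α x (VectorField.mlieBracket (𝓡 n) X Y x) = - dForm α x (X x) (Y x) := by
    rintro X Y ⟨O, hO, hxO, hX, hX0⟩ ⟨O', hO', hxO', hY, hY0⟩
    have hV : IsOpen (U ∩ (O ∩ O')) := hU.inter (hO.inter hO')
    refine apply_mlieBracket_eq hV (hα.mono fun p hp => hp.1) ⟨hx, hxO, hxO'⟩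
      (hX.contMDiffAt (hO.mem_nhds hxO)) (hY.contMDiffAt (hO'.mem_nhds hxO')) ?_ ?_
    · exact fun y hy => ((hC y hy.1).2 _).1 (hX0 y hy.2.1)
    · exact fun y hy => ((hC y hy.1).2 _).1 (hY0 y hy.2.2)
  ext u
  refine and_congr_right fun hu => forall₂_congr fun v hv =>
    ⟨fun h => ?_, fun h X Y hX hY hXu hYv => ?_⟩
  · obtain ⟨X, hX, hXu⟩ := exists_isLocalSection hU hα hC hx hu
    obtain ⟨Y, hY, hYv⟩ := exists_isLocalSection hU hα hC hx hv
    have h1 := ((hC x hx).2 _).1 (h X Y hX hY hXu hYv)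
    rw [key X Y hX hY, hXu, hYv] at h1
    exact neg_eq_zero.1 h1
  · rw [(hC x hx).2, key X Y hX hY, hXu, hYv]
    exact neg_eq_zero.2 h

end CharacteristicDirections

/-- The Euclidean model space. -/
abbrev Euc (n : ℕ) : Type := EuclideanSpace ℝ (Fin n)

/-! ### The momentum map of a 1-form -/

section Momentum

variable {n k : ℕ} {M : Type*} [TopologicalSpace M] [ChartedSpace (Euc n) M] [IsManifold (𝓡 n) ∞ M]
  {G : Type*} [TopologicalSpace G] [ChartedSpace (Euc k) G] [Group G] [LieGroup (𝓡 k) ∞ G]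
  [MulAction G M] [ContMDiffSMul (𝓡 k) (𝓡 n) ∞ G M]

theorem contMDiff_smul_const (x : M) : ContMDiff (𝓡 k) (𝓡 n) ∞ (fun g : G => g • x) :=
  contMDiff_id.smul contMDiff_const

variable (G) in
/-- The momentum map of a 1-form: the form evaluated on the infinitesimal action. -/
noncomputable def momentum (α : OneForm (Euc n) M) (y : M) : Euc k →L[ℝ] ℝ :=
  ContinuousLinearMap.comp (α y : Euc n →L[ℝ] ℝ)
    (infinitesimalAction (n := n) (k := k) G y : Euc k →L[ℝ] Euc n)

variable (G) in
/-- The differential of the momentum map of a 1-form. -/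
noncomputable def dMomentum (α : OneForm (Euc n) M) (x : M) : Euc n →L[ℝ] Euc k →L[ℝ] ℝ :=
  mfderiv (𝓡 n) 𝓘(ℝ, Euc k →L[ℝ] ℝ) (momentum (k := k) G α) x

variable (G) in
/-- The action of `G` on `M` in the preferred charts of `G` at `1` and of `M` at `x`. -/
noncomputable def actionInCharts (x : M) (p : Euc k × Euc n) : M :=
  (chartAt (Euc k) (1 : G)).symm p.1 • (chartAt (Euc n) x).symm p.2

theorem contMDiffOn_actionInCharts (x : M) :
    ContMDiffOn 𝓘(ℝ, Euc k × Euc n) (𝓡 n) ∞ (actionInCharts (n := n) (k := k) G x)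
      ((chartAt (Euc k) (1 : G)).target ×ˢ (chartAt (Euc n) x).target) := by
  have h1 : ContMDiffOn 𝓘(ℝ, Euc k × Euc n) (𝓡 k) ∞
      (fun p : Euc k × Euc n => (chartAt (Euc k) (1 : G)).symm p.1)
      ((chartAt (Euc k) (1 : G)).target ×ˢ (chartAt (Euc n) x).target) :=
    (IsDiffeo.chartAt (1 : G)).2.comp contDiff_fst.contMDiff.contMDiffOn fun p hp => hp.1
  have h2 : ContMDiffOn 𝓘(ℝ, Euc k × Euc n) (𝓡 n) ∞
      (fun p : Euc k × Euc n => (chartAt (Euc n) x).symm p.2)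
      ((chartAt (Euc k) (1 : G)).target ×ˢ (chartAt (Euc n) x).target) :=
    (IsDiffeo.chartAt x).2.comp contDiff_snd.contMDiff.contMDiffOn fun p hp => hp.2
  exact h1.smul h2

theorem chartAt_one_symm : (chartAt (Euc k) (1 : G)).symm (chartAt (Euc k) (1 : G) 1) = 1 :=
  (chartAt (Euc k) (1 : G)).left_inv (mem_chart_source _ _)

theorem mfderiv_actionInCharts_fst (x : M) {z : Euc n} (hz : z ∈ (chartAt (Euc n) x).target)
    (ξ : Euc k) :
    (mfderiv 𝓘(ℝ, Euc k × Euc n) (𝓡 n) (actionInCharts (n := n) (k := k) G x)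
      (chartAt (Euc k) (1 : G) 1, z) ((ξ, 0) : Euc k × Euc n) : Euc n) =
      infinitesimalAction (n := n) (k := k) G ((chartAt (Euc n) x).symm z) ξ := by
  set a₀ := chartAt (Euc k) (1 : G) 1 with ha₀
  have h1 : MDifferentiableAt 𝓘(ℝ, Euc k × Euc n) (𝓡 n)
      (actionInCharts (n := n) (k := k) G x) (a₀, z) :=
    ((contMDiffOn_actionInCharts x).contMDiffAt
      (((chartAt (Euc k) (1 : G)).open_target.prod (chartAt (Euc n) x).open_target).mem_nhds
        ⟨mem_chart_target _ _, hz⟩)).mdifferentiableAt (by simp)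
  have h2 : HasFDerivAt (fun a : Euc k => (a, z)) (ContinuousLinearMap.inl ℝ (Euc k) (Euc n)) a₀ :=
    (hasFDerivAt_id a₀).prodMk (hasFDerivAt_const z a₀)
  have e1 := mfderiv_comp_apply_of_eq (I := 𝓡 k) a₀ (y := (a₀, z)) h1
    h2.differentiableAt.mdifferentiableAt rfl ξ
  rw [mfderiv_eq_fderiv, h2.fderiv] at e1
  have h3 := (contMDiff_smul_const (n := n) (G := G) (k := k)
    ((chartAt (Euc n) x).symm z)).mdifferentiable (by simp) (1 : G)
  have e2 := mfderiv_comp_apply_of_eq (I := 𝓡 k) a₀ (y := (1 : G)) h3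
    ((IsDiffeo.chartAt (1 : G)).mdifferentiableAt_symm (mem_chart_target _ _)) chartAt_one_symm ξ
  refine e1.symm.trans (e2.trans ?_)
  exact congrArg (infinitesimalAction (n := n) (k := k) G ((chartAt (Euc n) x).symm z) :
    Euc k →L[ℝ] Euc n) (mfderiv_chartAt_symm_self (1 : G) ξ)

theorem mfderiv_actionInCharts_snd (x : M) {a : Euc k}
    (ha : a ∈ (chartAt (Euc k) (1 : G)).target) (w : Euc n) :
    (mfderiv 𝓘(ℝ, Euc k × Euc n) (𝓡 n) (actionInCharts (n := n) (k := k) G x)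
      (a, chartAt (Euc n) x x) ((0, w) : Euc k × Euc n) : Euc n) =
      mfderiv (𝓡 n) (𝓡 n) (fun y : M => (chartAt (Euc k) (1 : G)).symm a • y) x w := by
  set z := chartAt (Euc n) x x with hz
  have h1 : MDifferentiableAt 𝓘(ℝ, Euc k × Euc n) (𝓡 n)
      (actionInCharts (n := n) (k := k) G x) (a, z) :=
    ((contMDiffOn_actionInCharts x).contMDiffAt
      (((chartAt (Euc k) (1 : G)).open_target.prod (chartAt (Euc n) x).open_target).mem_nhds
        ⟨ha, mem_chart_target _ _⟩)).mdifferentiableAt (by simp)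
  have h2 : HasFDerivAt (fun z : Euc n => (a, z)) (ContinuousLinearMap.inr ℝ (Euc k) (Euc n)) z :=
    (hasFDerivAt_const a z).prodMk (hasFDerivAt_id z)
  have e1 := mfderiv_comp_apply_of_eq (I := 𝓡 n) z (y := (a, z)) h1
    h2.differentiableAt.mdifferentiableAt rfl w
  rw [mfderiv_eq_fderiv, h2.fderiv] at e1
  have h3 := ((ContMDiffSMul.contMDiff_const_smul (I := 𝓡 k) (I' := 𝓡 n) (n := ∞)
    (M := M) ((chartAt (Euc k) (1 : G)).symm a)).mdifferentiable (by simp)) x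
  have e2 := mfderiv_comp_apply_of_eq (I := 𝓡 n) z (y := x) h3
    ((IsDiffeo.chartAt x).mdifferentiableAt_symm (mem_chart_target _ _))
    ((chartAt (Euc n) x).left_inv (mem_chart_source _ _)) w
  refine e1.symm.trans (e2.trans ?_)
  exact congrArg (mfderiv (𝓡 n) (𝓡 n) (fun y : M => (chartAt (Euc k) (1 : G)).symm a • y) x :
    Euc n →L[ℝ] Euc n) (mfderiv_chartAt_symm_self x w)

theorem isOpen_preimage_actionInCharts (x : M) {U : Set M} (hU : IsOpen U) :
    IsOpen (((chartAt (Euc k) (1 : G)).target ×ˢ (chartAt (Euc n) x).target) ∩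
      actionInCharts (n := n) (k := k) G x ⁻¹' U) :=
  (contMDiffOn_actionInCharts x).continuousOn.isOpen_inter_preimage
    ((chartAt (Euc k) (1 : G)).open_target.prod (chartAt (Euc n) x).open_target) hU

theorem actionInCharts_one (x : M) (z : Euc n) :
    actionInCharts (n := n) (k := k) G x (chartAt (Euc k) (1 : G) 1, z) =
      (chartAt (Euc n) x).symm z := by
  simp only [actionInCharts]
  rw [chartAt_one_symm, one_smul]

theorem pullForm_actionInCharts_fst (α : OneForm (Euc n) M) (x : M) {z : Euc n}
    (hz : z ∈ (chartAt (Euc n) x).target) (ξ : Euc k) :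
    (pullForm (E := Euc k × Euc n) (actionInCharts (n := n) (k := k) G x) α).toMap
      (chartAt (Euc k) (1 : G) 1, z) (ξ, 0) =
      momentum (k := k) G α ((chartAt (Euc n) x).symm z) ξ := by
  have h1 := α.congr_point (actionInCharts_one (G := G) (k := k) x z)
  have h2 := mfderiv_actionInCharts_fst (G := G) x hz ξ
  have h3 := congrArg (α ((chartAt (Euc n) x).symm z) : Euc n →L[ℝ] ℝ) h2
  rw [← h1] at h3
  refine h3.trans ?_
  rw [h1]
  rfl

theorem contDiffOn_pullForm_actionInCharts {α : OneForm (Euc n) M} {U : Set M} (hU : IsOpen U)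
    (hα : SmoothFormOn α U) (x : M) :
    ContDiffOn ℝ ∞ (pullForm (E := Euc k × Euc n) (actionInCharts (n := n) (k := k) G x) α).toMap
      (((chartAt (Euc k) (1 : G)).target ×ˢ (chartAt (Euc n) x).target) ∩
      actionInCharts (n := n) (k := k) G x ⁻¹' U) :=
  SmoothFormOn.contDiffOn (hα.pullForm (isOpen_preimage_actionInCharts x hU)
    ((contMDiffOn_actionInCharts x).mono inter_subset_left) fun _ hp => hp.2)

theorem contMDiffOn_momentum {α : OneForm (Euc n) M} {U : Set M} (hU : IsOpen U)
    (hα : SmoothFormOn α U) :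
    ContMDiffOn (𝓡 n) 𝓘(ℝ, Euc k →L[ℝ] ℝ) ∞ (momentum (k := k) G α) U := by
  intro x hx
  refine ContMDiffAt.contMDiffWithinAt ?_
  set φ := chartAt (Euc n) x with hφ
  set a₀ := chartAt (Euc k) (1 : G) 1 with ha₀
  set β := (pullForm (E := Euc k × Euc n) (actionInCharts (n := n) (k := k) G x) α).toMap with hβ
  have h1 : ContDiffAt ℝ ∞ β (a₀, φ x) :=
    (contDiffOn_pullForm_actionInCharts hU hα x).contDiffAt
      ((isOpen_preimage_actionInCharts x hU).mem_nhds ⟨⟨mem_chart_target _ _, mem_chart_target _ _⟩,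
        by
          change actionInCharts (n := n) (k := k) G x (a₀, φ x) ∈ U
          rw [actionInCharts_one]
          simpa [hφ] using hx⟩)
  have h2 : ContDiffAt ℝ ∞ (fun z => (β (a₀, z)).comp (ContinuousLinearMap.inl ℝ (Euc k) (Euc n)))
      (φ x) :=
    (h1.comp (φ x) (f := fun z => (a₀, z)) (contDiffAt_const.prodMk contDiffAt_id)).clm_comp
      contDiffAt_const
  have h3 : ContMDiffAt (𝓡 n) 𝓘(ℝ, Euc k →L[ℝ] ℝ) ∞
      ((fun z => (β (a₀, z)).comp (ContinuousLinearMap.inl ℝ (Euc k) (Euc n))) ∘ φ) x :=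
    ContMDiffAt.comp x h2.contMDiffAt ((IsDiffeo.chartAt x).contMDiffAt (mem_chart_source _ _))
  refine h3.congr_of_eventuallyEq ?_
  filter_upwards [φ.open_source.mem_nhds (mem_chart_source _ x)] with y hy
  ext ξ
  have h4 := pullForm_actionInCharts_fst (G := G) α x (φ.map_source hy) ξ
  rw [φ.left_inv hy] at h4
  exact h4.symm

/-- On an invariant field `C = ker α`, contracting `dα` with the infinitesimal action gives minus
the differential of the momentum map.

The exterior derivative commutes with the pullback along the action `(g, y) ↦ g • y`. The pulled
back form vanishes on `(0, w)` at all points `(g, x)`, because `g` maps `C x` to `C (g • x)`, so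
that only the derivative in the direction of `w` remains; on the Lie algebra the pulled back form
is the momentum map. -/
theorem dForm_infinitesimalAction {α : OneForm (Euc n) M} {C : SubspaceField n M}
    (hG : Preserves G C) {U : Set M} (hU : IsOpen U)
    (hα : SmoothFormOn α U) (hC : ∀ y ∈ U, ∀ v, v ∈ C y ↔ α y v = 0) {x : M} (hx : x ∈ U)
    (ξ : Euc k) {w : Euc n} (hw : w ∈ C x) :
    dForm α x (infinitesimalAction (n := n) (k := k) G x ξ : Euc n) w =
      - dMomentum (k := k) G α x w ξ := by
  set φ := chartAt (Euc n) x with hφ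
  set a₀ := chartAt (Euc k) (1 : G) 1 with ha₀
  set A := actionInCharts (n := n) (k := k) G x with hA
  set β := (pullForm (E := Euc k × Euc n) A α).toMap with hβ
  have hφx : φ.symm (φ x) = x := φ.left_inv (mem_chart_source _ _)
  have hAx : A (a₀, φ x) = x := (actionInCharts_one x _).trans hφx
  have hAU : A (a₀, φ x) ∈ U := by rw [hAx]; exact hx
  set O := ((chartAt (Euc k) (1 : G)).target ×ˢ φ.target) ∩ A ⁻¹' U with hO
  have hOo : IsOpen O := isOpen_preimage_actionInCharts x hU
  have hpO : (a₀, φ x) ∈ O := ⟨⟨mem_chart_target _ _, mem_chart_target _ _⟩, by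
    exact hAU⟩
  have hβd : DifferentiableAt ℝ β (a₀, φ x) :=
    ((contDiffOn_pullForm_actionInCharts hU hα x).contDiffAt (hOo.mem_nhds hpO)).differentiableAt
      (by simp)
  have h1 := dForm_pullForm hU hα hOo ((contMDiffOn_actionInCharts (G := G) (k := k) x).mono
    inter_subset_left) hpO hAU ((ξ, 0) : Euc k × Euc n) ((0, w) : Euc k × Euc n)
  have h2 := mfderiv_actionInCharts_fst (G := G) x (z := φ x) (mem_chart_target _ _) ξ
  have h3 := mfderiv_actionInCharts_snd (G := G) x (a := a₀) (mem_chart_target _ _) w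
  rw [dForm_eq_extD, extD_apply] at h1
  have hA0 : (mfderiv 𝓘(ℝ, Euc k × Euc n) (𝓡 n) A (a₀, φ x) ((0, w) : Euc k × Euc n) : Euc n) =
      w := by
    refine h3.trans ?_
    have : (fun y : M => (chartAt (Euc k) (1 : G)).symm a₀ • y) = id := by
      funext y
      rw [ha₀, chartAt_one_symm, one_smul, id]
    rw [this, mfderiv_id]
    rfl
  have hA1 : (mfderiv 𝓘(ℝ, Euc k × Euc n) (𝓡 n) A (a₀, φ x) ((ξ, 0) : Euc k × Euc n) : Euc n) =
      infinitesimalAction (n := n) (k := k) G x ξ := by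
    refine h2.trans ?_
    have : ∀ y z : M, y = z → (infinitesimalAction (n := n) (k := k) G y ξ : Euc n) =
      infinitesimalAction (n := n) (k := k) G z ξ := by rintro y z rfl; rfl
    exact this _ _ hφx
  have hR : ∀ y z : M, y = z → ∀ u v : Euc n, dForm α y u v = dForm α z u v := by
    rintro y z rfl u v; rfl
  have hR' : dForm α (A (a₀, φ x))
      (mfderiv 𝓘(ℝ, Euc k × Euc n) (𝓡 n) A (a₀, φ x) ((ξ, 0) : Euc k × Euc n) : Euc n)
      (mfderiv 𝓘(ℝ, Euc k × Euc n) (𝓡 n) A (a₀, φ x) ((0, w) : Euc k × Euc n) : Euc n) =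
      dForm α x (infinitesimalAction (n := n) (k := k) G x ξ : Euc n) w := by
    rw [hA0, hA1]
    exact hR _ _ hAx _ _
  -- the form vanishes on `(0, w)` along the group directions, as the field is invariant
  have hT1 : fderiv ℝ β (a₀, φ x) (ξ, 0) (0, w) = 0 := by
    have hi : HasFDerivAt (fun a : Euc k => (a, φ x)) (ContinuousLinearMap.inl ℝ (Euc k) (Euc n))
        a₀ := (hasFDerivAt_id a₀).prodMk (hasFDerivAt_const _ a₀)
    have e1 : HasFDerivAt (fun a : Euc k => β (a, φ x) (0, w)) _ a₀ :=
      (HasFDerivAt.comp a₀ (f := fun a : Euc k => (a, φ x)) hβd.hasFDerivAt hi).clm_apply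
        (hasFDerivAt_const ((0, w) : Euc k × Euc n) a₀)
    have e2 : HasFDerivAt (fun a : Euc k => β (a, φ x) (0, w)) (0 : Euc k →L[ℝ] ℝ) a₀ := by
      refine (hasFDerivAt_const (0 : ℝ) a₀).congr_of_eventuallyEq ?_
      filter_upwards [(hOo.preimage (Continuous.prodMk_left (φ x))).mem_nhds hpO] with a ha
      have h4 := mfderiv_actionInCharts_snd (G := G) x ha.1.1 w
      have h5 : A (a, φ x) = (chartAt (Euc k) (1 : G)).symm a • x := by
        rw [hA]; simp only [actionInCharts]; rw [hφx]
      have h6 : (chartAt (Euc k) (1 : G)).symm a • x ∈ U := h5 ▸ ha.2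
      have h7 := (hC _ h6 _).1 (hG _ x w hw)
      have h8 := congrArg (α ((chartAt (Euc k) (1 : G)).symm a • x) : Euc n →L[ℝ] ℝ) h4
      rw [← α.congr_point h5] at h8
      refine h8.trans ?_
      rw [α.congr_point h5]
      exact h7
    have e3 := congrArg (fun T : Euc k →L[ℝ] ℝ => T ξ) (e1.unique e2)
    simpa using e3
  have hT2 : fderiv ℝ β (a₀, φ x) (0, w) (ξ, 0) = dMomentum (k := k) G α x w ξ := by
    have hi : HasFDerivAt (fun z : Euc n => (a₀, z)) (ContinuousLinearMap.inr ℝ (Euc k) (Euc n))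
        (φ x) := (hasFDerivAt_const a₀ _).prodMk (hasFDerivAt_id _)
    have e1 : HasFDerivAt (fun z : Euc n => β (a₀, z) (ξ, 0)) _ (φ x) :=
      (HasFDerivAt.comp (φ x) (f := fun z : Euc n => (a₀, z)) hβd.hasFDerivAt hi).clm_apply
        (hasFDerivAt_const ((ξ, 0) : Euc k × Euc n) (φ x))
    have h4 : MDifferentiableAt (𝓡 n) 𝓘(ℝ, Euc k →L[ℝ] ℝ) (momentum (k := k) G α) x :=
      ((contMDiffOn_momentum hU hα).contMDiffAt (hU.mem_nhds hx)).mdifferentiableAt (by simp)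
    have h4' : MDifferentiableAt (𝓡 n) 𝓘(ℝ, Euc k →L[ℝ] ℝ) (momentum (k := k) G α)
      (φ.symm (φ x)) := by rwa [hφx]
    have h5 := (IsDiffeo.chartAt x).mdifferentiableAt_symm (mem_chart_target (Euc n) x)
    have e2 : HasFDerivAt (momentum (k := k) G α ∘ φ.symm)
        (fderiv ℝ (momentum (k := k) G α ∘ φ.symm) (φ x)) (φ x) :=
      (h4'.comp (φ x) h5).differentiableAt.hasFDerivAt
    have e3 : HasFDerivAt (fun z => (momentum (k := k) G α ∘ φ.symm) z ξ) _ (φ x) :=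
      e2.clm_apply (hasFDerivAt_const ξ (φ x))
    have e4 := e3.congr_of_eventuallyEq (f₁ := fun z : Euc n => β (a₀, z) (ξ, 0)) (by
      filter_upwards [φ.open_target.mem_nhds (mem_chart_target _ x)] with z hz
      exact pullForm_actionInCharts_fst (G := G) α x hz ξ)
    have e5 := congrArg (fun T : Euc n →L[ℝ] ℝ => T w) (e1.unique e4)
    have e5' : fderiv ℝ β (a₀, φ x) (0, w) (ξ, 0) =
        fderiv ℝ (momentum (k := k) G α ∘ φ.symm) (φ x) w ξ := by simpa using e5
    have e6 := mfderiv_comp_apply_of_eq (φ x) h4 h5 hφx w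
    rw [mfderiv_eq_fderiv] at e6
    have e7 : dMomentum (k := k) G α x (mfderiv (𝓡 n) (𝓡 n) φ.symm (φ x) w) =
      dMomentum (k := k) G α x w := congrArg _ (mfderiv_chartAt_symm_self x w)
    rw [e5']
    exact congrArg (fun T : Euc k →L[ℝ] ℝ => T ξ) (e6.trans e7)
  have h1' : fderiv ℝ β (a₀, φ x) (ξ, 0) (0, w) - fderiv ℝ β (a₀, φ x) (0, w) (ξ, 0) =
      dForm α x (infinitesimalAction (n := n) (k := k) G x ξ : Euc n) w := h1.trans hR'
  rw [← h1', hT1, hT2, zero_sub]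

end Momentum

/-! ### Linear algebra of the reduction -/

section Linear

variable {E F : Type*} [NormedAddCommGroup E] [NormedSpace ℝ E] [NormedAddCommGroup F]
  [NormedSpace ℝ F] [FiniteDimensional ℝ E] [FiniteDimensional ℝ F]

/-- The linear model of the reduction at a point: a form `Ω` (standing for `dα`) which is
non-degenerate on the hyperplane `ker a`, and an injective map `s` into `ker a` (the infinitesimal
action) whose contraction with `Ω` is minus the map `D` (the differential of the momentum). -/
structure LinearReduction (a : E →L[ℝ] ℝ) (Ω : E →L[ℝ] E →L[ℝ] ℝ) (s : F →L[ℝ] E)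
    (D : E →L[ℝ] F →L[ℝ] ℝ) : Prop where
  ne_zero : a ≠ 0
  nondegenerate : ∀ u, a u = 0 → (∀ v, a v = 0 → Ω u v = 0) → u = 0
  injective : Function.Injective s
  isotropic : ∀ ξ, a (s ξ) = 0
  contract : ∀ ξ w, a w = 0 → Ω (s ξ) w = - D w ξ
  invariant : ∀ ξ, D (s ξ) = 0

variable {a : E →L[ℝ] ℝ} {Ω : E →L[ℝ] E →L[ℝ] ℝ} {s : F →L[ℝ] E} {D : E →L[ℝ] F →L[ℝ] ℝ}

/-- Already the restriction of `D` to `ker a` is onto: it is dual to the map `ξ ↦ Ω (s ξ)`, which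
is injective because `Ω` is non-degenerate on `ker a`. -/
theorem LinearReduction.exists_eq (h : LinearReduction a Ω s D) (c : F →L[ℝ] ℝ) :
    ∃ w, a w = 0 ∧ D w = c := by
  let L : F →ₗ[ℝ] Module.Dual ℝ (LinearMap.ker a.toLinearMap) :=
    { toFun := fun ξ =>
        { toFun := fun w => D w ξ
          map_add' := fun v w => by simp
          map_smul' := fun r w => by simp }
      map_add' := fun v w => by ext; simp
      map_smul' := fun r w => by ext; simp }
  have hL : Function.Injective L := by
    refine (injective_iff_map_eq_zero L).2 fun ξ hξ => ?_
    refine (injective_iff_map_eq_zero s).1 h.injective ξ (h.nondegenerate _ (h.isotropic ξ) ?_)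
    intro v hv
    rw [h.contract ξ v hv, neg_eq_zero]
    exact LinearMap.congr_fun hξ ⟨v, hv⟩
  obtain ⟨w, hw⟩ := (LinearMap.flip_surjective_iff₁ (B := L)).2 hL c.toLinearMap
  exact ⟨w, w.2, ContinuousLinearMap.ext fun ξ => LinearMap.congr_fun hw ξ⟩

theorem LinearReduction.surjective (h : LinearReduction a Ω s D) : Function.Surjective D :=
  fun c => (h.exists_eq c).imp fun _ hw => hw.2

theorem LinearReduction.exists_ker_not (h : LinearReduction a Ω s D) : ∃ v, D v = 0 ∧ a v ≠ 0 := by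
  obtain ⟨e, he⟩ : ∃ e, a e ≠ 0 := by
    by_contra! h1
    exact h.ne_zero (ContinuousLinearMap.ext h1)
  obtain ⟨w, hw, hw'⟩ := h.exists_eq (D e)
  exact ⟨e - w, by simp [hw'], by simpa [hw] using he⟩

/-- The double orthogonal of the range of `s` in `ker a` is the range of `s`: a functional that
vanishes on the common kernel of the functionals `Ω (s ξ)` is one of them. -/
theorem LinearReduction.exists_infinitesimal (h : LinearReduction a Ω s D) {u : E} (hu : a u = 0)
    (hu' : ∀ v, a v = 0 → D v = 0 → Ω u v = 0) : ∃ ξ, s ξ = u := by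
  let W := LinearMap.ker a.toLinearMap
  let b := Module.finBasis ℝ F
  let L : Fin (Module.finrank ℝ F) → W →ₗ[ℝ] ℝ := fun i =>
    { toFun := fun w => D w (b i)
      map_add' := fun v w => by simp
      map_smul' := fun r w => by simp }
  let K : W →ₗ[ℝ] ℝ := (Ω u).toLinearMap.comp W.subtype
  have hK : K ∈ Submodule.span ℝ (Set.range L) := by
    refine mem_span_of_iInf_ker_le_ker (fun w hw => ?_)
    rw [Submodule.mem_iInf] at hw
    refine hu' w w.2 ?_
    have : (D w).toLinearMap = 0 := b.ext fun i => hw i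
    exact ContinuousLinearMap.ext fun ξ => LinearMap.congr_fun this ξ
  obtain ⟨c, hc⟩ := (Submodule.mem_span_range_iff_exists_fun ℝ).1 hK
  refine ⟨-∑ i, c i • b i, ?_⟩
  rw [← sub_eq_zero]
  refine h.nondegenerate _ (by rw [map_sub, h.isotropic, hu, sub_zero]) fun v hv => ?_
  have h1 := LinearMap.congr_fun hc ⟨v, hv⟩
  have h2 : Ω u v = ∑ i, c i * D v (b i) := by
    refine h1.symm.trans ?_
    simp [L]
  rw [map_sub, sub_apply, h.contract _ v hv, h2]
  simp

theorem LinearReduction.characteristic_iff (h : LinearReduction a Ω s D) {u : E} :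
    (D u = 0 ∧ a u = 0 ∧ ∀ v, D v = 0 → a v = 0 → Ω u v = 0) ↔ ∃ ξ, s ξ = u := by
  constructor
  · rintro ⟨-, h1, h2⟩
    exact h.exists_infinitesimal h1 fun v hv hv' => h2 v hv' hv
  · rintro ⟨ξ, rfl⟩
    refine ⟨h.invariant ξ, h.isotropic ξ, fun v hv hv' => ?_⟩
    rw [h.contract ξ v hv', hv]
    simp

theorem LinearReduction.finrank_le (h : LinearReduction a Ω s D) :
    2 * Module.finrank ℝ F + 1 ≤ Module.finrank ℝ E := by
  have h1 : Function.Surjective (D.prod a) := by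
    rintro ⟨c, r⟩
    obtain ⟨v, hv, hv'⟩ := h.exists_ker_not
    obtain ⟨w, hw, hw'⟩ := h.exists_eq c
    refine ⟨w + (r / a v) • v, ?_⟩
    simp [hv, hw, hw', hv']
  have h2 := LinearMap.finrank_range_add_finrank_ker (D.prod a).toLinearMap
  rw [LinearMap.range_eq_top.2 h1, finrank_top, Module.finrank_prod] at h2
  have h3 : Module.finrank ℝ (F →L[ℝ] ℝ) = Module.finrank ℝ F := by
    rw [← (LinearMap.toContinuousLinearMap (E := F) (F' := ℝ) (𝕜 := ℝ)).finrank_eq]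
    exact Subspace.dual_finrank_eq
  have h4 : Module.finrank ℝ F ≤ Module.finrank ℝ (LinearMap.ker (D.prod a).toLinearMap) := by
    refine LinearMap.finrank_le_finrank_of_injective
      (f := s.toLinearMap.codRestrict (LinearMap.ker (D.prod a).toLinearMap) fun ξ => ?_) ?_
    · simp [h.invariant ξ, h.isotropic ξ]
    · intro ξ η hξ
      exact h.injective (congrArg Subtype.val hξ)
  rw [h3, Module.finrank_self] at h2
  omega

end Linear

/-! ### Infinitesimal and local structure of an action -/

theorem eventually_eq_of_hasDerivAt_zero {V : Type*} [NormedAddCommGroup V] [NormedSpace ℝ V]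
    {f : ℝ → V} {t₀ : ℝ} (h : ∀ᶠ t in 𝓝 t₀, HasDerivAt f 0 t) : ∀ᶠ t in 𝓝 t₀, f t = f t₀ := by
  obtain ⟨r, hr, hr'⟩ := Metric.eventually_nhds_iff_ball.1 h
  filter_upwards [Metric.ball_mem_nhds t₀ hr] with t ht
  exact Metric.isOpen_ball.is_const_of_deriv_eq_zero (convex_ball t₀ r).isPreconnected
    (fun s hs => (hr' s hs).differentiableAt.differentiableWithinAt)
    (fun s hs => (hr' s hs).deriv) ht (Metric.mem_ball_self hr)

section Action

variable {n k : ℕ} {M : Type*} [TopologicalSpace M] [ChartedSpace (Euc n) M] [IsManifold (𝓡 n) ∞ M]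
  {G : Type*} [TopologicalSpace G] [ChartedSpace (Euc k) G] [Group G] [LieGroup (𝓡 k) ∞ G]
  [MulAction G M] [ContMDiffSMul (𝓡 k) (𝓡 n) ∞ G M]

/-- The differential of an orbit map takes its values in the range of the infinitesimal action. -/
theorem mfderiv_smul_const_mem_range (x : M) (g : G) (η : Euc k) :
    ∃ ξ : Euc k, (infinitesimalAction (n := n) (k := k) G (g • x) ξ : Euc n) =
      mfderiv (𝓡 k) (𝓡 n) (fun g : G => g • x) g η := by
  have h1 : ContMDiff (𝓡 k) (𝓡 k) ∞ (fun h : G => h * g⁻¹) := contMDiff_id.mul contMDiff_const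
  have h2 : (fun h : G => h • x) = (fun h : G => h • (g • x)) ∘ (fun h : G => h * g⁻¹) := by
    funext h
    simp [smul_smul]
  have h3 := mfderiv_comp_apply_of_eq (I := 𝓡 k) g (y := (1 : G))
    ((contMDiff_smul_const (n := n) (k := k) (g • x)).mdifferentiable (by simp) (1 : G))
    (h1.mdifferentiable (by simp) g) (mul_inv_cancel g) η
  rw [← h2] at h3
  exact ⟨_, h3.symm⟩

/-- A curve of group elements, applied to a point, moves in the direction of the infinitesimal
action. -/
theorem mfderiv_smul_curve_mem_range {V : Type*} [NormedAddCommGroup V] [NormedSpace ℝ V]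
    {h : V → G} {t : V} (hh : MDifferentiableAt 𝓘(ℝ, V) (𝓡 k) h t) (x : M) (v : V) :
    ∃ ξ : Euc k, (infinitesimalAction (n := n) (k := k) G (h t • x) ξ : Euc n) =
      mfderiv 𝓘(ℝ, V) (𝓡 n) (fun s => h s • x) t v := by
  have h3 := mfderiv_comp_apply_of_eq t (y := h t)
    ((contMDiff_smul_const (n := n) (k := k) x).mdifferentiable (by simp) (h t)) hh rfl v
  obtain ⟨ξ, hξ⟩ := mfderiv_smul_const_mem_range (n := n) x (h t)
    (mfderiv 𝓘(ℝ, V) (𝓡 k) h t v : Euc k)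
  exact ⟨ξ, hξ.trans h3.symm⟩

/-- If `inf_x ξ = 0` then the orbit map of `x` is constant along the one-parameter subgroup of
`ξ`, so the latter is contained in the stabilizer, which is discrete: hence `ξ = 0`. -/
theorem infinitesimalAction_injective {x : M} (hx : DiscreteTopology (MulAction.stabilizer G x)) :
    Function.Injective (infinitesimalAction (n := n) (k := k) G x) := by
  refine (injective_iff_map_eq_zero _).2 fun ξ hξ => ?_
  have : LieGroup (𝓡 k) (minSmoothness ℝ 3) G := LieGroup.of_le (n := ∞) (by
    simp; exact WithTop.coe_le_coe.2 (le_top : (3 : ℕ∞) ≤ ⊤))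
  have hv := (contMDiff_mulInvariantVectorField (I := 𝓡 k) (G := G) ξ).contMDiffAt (x := 1)
  obtain ⟨γ, hγ0, hγ⟩ := exists_isMIntegralCurveAt_of_contMDiffAt_boundaryless (t₀ := 0)
    (hv.of_le (n := minSmoothness ℝ 2) (m := 1) (by simp))
  -- the orbit map is stationary along the left invariant field of `ξ`, its differential at `g`
  -- being obtained from that at `1` by translation
  have hinv : ∀ g : G, ∀ u : Euc k, u = mulInvariantVectorField ξ g →
      (mfderiv (𝓡 k) (𝓡 n) (fun g : G => g • x) g u : Euc n) = 0 := by
    rintro g u rfl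
    have e1 : (fun h : G => h • x) ∘ (g * ·) = (fun y : M => g • y) ∘ (fun h : G => h • x) := by
      funext h; simp [mul_smul]
    have hl : ContMDiff (𝓡 k) (𝓡 k) ∞ (g * · : G → G) := contMDiff_mul_left
    have e2 := mfderiv_comp_apply_of_eq (I := 𝓡 k) (1 : G) (y := g)
      ((contMDiff_smul_const (n := n) (k := k) x).mdifferentiable (by simp) g)
      (hl.mdifferentiable (by simp) 1) (mul_one g) ξ
    have e3 := mfderiv_comp_apply_of_eq (I := 𝓡 k) (1 : G) (y := x)
      ((ContMDiffSMul.contMDiff_const_smul (I := 𝓡 k) (I' := 𝓡 n) (n := ∞) (M := M)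
        g).mdifferentiable (by simp) x)
      ((contMDiff_smul_const (n := n) (k := k) x).mdifferentiable (by simp) (1 : G))
      (one_smul G x) ξ
    rw [e1] at e2
    have e4 : (mfderiv (𝓡 k) (𝓡 n) (fun g : G => g • x) 1 ξ : Euc n) = 0 := hξ
    refine e2.symm.trans (e3.trans ?_)
    rw [e4]
    exact map_zero _
  set φ := chartAt (Euc n) x with hφ
  have hγc : ContinuousAt γ 0 := hγ.self_of_nhds.continuousAt
  have horb := contMDiff_smul_const (n := n) (k := k) (G := G) x
  have hsrc : ∀ᶠ t in 𝓝 (0 : ℝ), γ t • x ∈ φ.source := by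
    have h1 : ContinuousAt (fun t => γ t • x) 0 :=
      ContinuousAt.comp (g := fun g : G => g • x) horb.continuous.continuousAt hγc
    refine h1.eventually_mem (φ.open_source.mem_nhds ?_)
    simp [hγ0, hφ]
  have hderiv : ∀ᶠ t in 𝓝 (0 : ℝ), HasDerivAt (fun t => φ (γ t • x)) 0 t := by
    filter_upwards [hγ, hsrc] with t ht hts
    have h1 := ((horb.mdifferentiable (by simp) (γ t)).hasMFDerivAt).comp t ht
    have h2 := (((IsDiffeo.chartAt x).mdifferentiableAt hts).hasMFDerivAt).comp t h1
    obtain ⟨T, hT, hT'⟩ : ∃ T : ℝ →L[ℝ] Euc n, HasFDerivAt (fun t => φ (γ t • x)) T t ∧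
        T 1 = (mfderiv (𝓡 n) (𝓡 n) φ (γ t • x) (mfderiv (𝓡 k) (𝓡 n) (fun g : G => g • x) (γ t)
          ((1 : ℝ) • mulInvariantVectorField ξ (γ t))) : Euc n) :=
      ⟨_, hasMFDerivAt_iff_hasFDerivAt.1 h2, rfl⟩
    have h4 := hinv (γ t) ((1 : ℝ) • mulInvariantVectorField ξ (γ t) : Euc k) (one_smul _ _)
    have h6 := congrArg (mfderiv (𝓡 n) (𝓡 n) φ (γ t • x) : Euc n →L[ℝ] Euc n) h4
    have h7 : T 1 = 0 := hT'.trans (h6.trans (map_zero _))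
    rw [← h7]
    exact hT.hasDerivAt
  have hstab : ∀ᶠ t in 𝓝 (0 : ℝ), γ t • x = x := by
    filter_upwards [eventually_eq_of_hasDerivAt_zero hderiv, hsrc] with t ht hts
    have h1 := φ.injOn hts hsrc.self_of_nhds ht
    simpa [hγ0] using h1
  -- close to `1` the stabilizer consists of `1` only
  obtain ⟨V, hV, hV1⟩ := isOpen_induced_iff.1
    (isOpen_discrete ({1} : Set (MulAction.stabilizer G x)))
  have h1V : (1 : G) ∈ V := by
    have : (1 : MulAction.stabilizer G x) ∈ Subtype.val ⁻¹' V := by rw [hV1]; rfl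
    exact this
  have hone : ∀ᶠ t in 𝓝 (0 : ℝ), γ t = 1 := by
    filter_upwards [hstab, hγc.eventually_mem (hV.mem_nhds (by rw [hγ0]; exact h1V))] with t ht htV
    have : (⟨γ t, ht⟩ : MulAction.stabilizer G x) ∈ Subtype.val ⁻¹' V := htV
    rw [hV1] at this
    exact congrArg Subtype.val this
  have hc : HasMFDerivAt 𝓘(ℝ, ℝ) (𝓡 k) γ 0 (0 : ℝ →L[ℝ] Euc k) :=
    (hasMFDerivAt_const (1 : G) (0 : ℝ)).congr_of_eventuallyEq hone
  have h0 := congrArg (fun T : ℝ →L[ℝ] Euc k => T 1) (hasMFDerivAt_unique hγ.self_of_nhds hc)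
  have h1 : ∀ g : G, g = 1 → (mulInvariantVectorField (I := 𝓡 k) ξ g : Euc k) = ξ := by
    rintro g rfl
    have : ((1 : G) * ·) = (id : G → G) := by funext h; simp
    change (mfderiv (𝓡 k) (𝓡 k) ((1 : G) * ·) (1 : G) ξ : Euc k) = ξ
    rw [this, mfderiv_id]
    rfl
  refine (h1 _ hγ0).symm.trans (Eq.trans ?_ h0)
  exact (one_smul ℝ (mulInvariantVectorField (I := 𝓡 k) ξ (γ 0) : Euc k)).symm

/-! ### Flow boxes -/

variable (G) in
/-- A flow box around `x`: a diffeomorphism `(a, s) ↦ c a • ψ s`, where `c` is the inverse of the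
preferred chart of `G` at `1` and `ψ` parametrizes a transversal of the orbit of `x = ψ 0`. -/
structure IsFlowBox (x : M) {K : Type*} [NormedAddCommGroup K] [NormedSpace ℝ K]
    (ψ : K → M) (Ψ : OpenPartialHomeomorph (Euc k × K) M) : Prop where
  isDiffeo : IsDiffeo (Euc k × K) (Euc n) Ψ
  mem_source : (chartAt (Euc k) (1 : G) 1, (0 : K)) ∈ Ψ.source
  fst_mem : ∀ p ∈ Ψ.source, p.1 ∈ (chartAt (Euc k) (1 : G)).target
  apply_eq : ∀ p ∈ Ψ.source, Ψ p = (chartAt (Euc k) (1 : G)).symm p.1 • ψ p.2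
  apply_zero : ψ 0 = x

/-- The map `(a, s) ↦ c a • ψ s` has a bijective differential at the base point if the slice `ψ`
parametrizes a complement of the tangent space of the orbit, so the inverse function theorem
applies. -/
theorem exists_isFlowBox {K : Type*} [NormedAddCommGroup K] [NormedSpace ℝ K]
    [FiniteDimensional ℝ K] (hdim : k + Module.finrank ℝ K = n) (x : M)
    (hinj : Function.Injective (infinitesimalAction (n := n) (k := k) G x)) :
    ∃ (ψ : K → M) (Ψ : OpenPartialHomeomorph (Euc k × K) M),
      IsFlowBox (n := n) (k := k) G x ψ Ψ := by
  set a₀ := chartAt (Euc k) (1 : G) 1 with ha₀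
  set φ := chartAt (Euc n) x with hφ
  let A : Euc k →L[ℝ] Euc n := infinitesimalAction (n := n) (k := k) G x
  obtain ⟨ι, hι⟩ := exists_complement_param (K := K) A hinj (by simpa using hdim)
  let j : Euc k × K → Euc k × Euc n := fun p => (p.1, φ x + ι p.2)
  have hj : ContDiff ℝ ∞ j := by fun_prop
  set U := j ⁻¹' ((chartAt (Euc k) (1 : G)).target ×ˢ φ.target) with hU
  have hUo : IsOpen U :=
    ((chartAt (Euc k) (1 : G)).open_target.prod φ.open_target).preimage hj.continuous
  have hj0 : j (a₀, 0) = (a₀, φ x) := by simp [j]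
  have h0U : (a₀, (0 : K)) ∈ U := by
    rw [hU, mem_preimage, hj0]
    exact ⟨mem_chart_target _ _, mem_chart_target _ _⟩
  have hA := contMDiffOn_actionInCharts (n := n) (G := G) (k := k) x
  have hΦ : ContMDiffOn 𝓘(ℝ, Euc k × K) (𝓡 n) ∞ (actionInCharts (n := n) (k := k) G x ∘ j) U :=
    hA.comp hj.contMDiff.contMDiffOn fun p hp => hp
  have hjd : HasFDerivAt j (((ContinuousLinearMap.fst ℝ (Euc k) K)).prod
      (ι.comp (ContinuousLinearMap.snd ℝ (Euc k) K))) (a₀, 0) := by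
    have h1 := (ContinuousLinearMap.fst ℝ (Euc k) K).hasFDerivAt (x := (a₀, 0))
    have h2 := (ι.comp (ContinuousLinearMap.snd ℝ (Euc k) K)).hasFDerivAt (x := (a₀, 0))
    exact h1.prodMk (h2.const_add (φ x))
  have hder : ∀ p : Euc k × K, (mfderiv 𝓘(ℝ, Euc k × K) (𝓡 n)
      (actionInCharts (n := n) (k := k) G x ∘ j) (a₀, 0) p : Euc n) = A.coprod ι p := by
    rintro ⟨ξ, v⟩
    have e1 := mfderiv_comp_apply_of_eq (I := 𝓘(ℝ, Euc k × K)) (a₀, (0 : K)) (y := (a₀, φ x))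
      ((hA.contMDiffAt (((chartAt (Euc k) (1 : G)).open_target.prod φ.open_target).mem_nhds
        ⟨mem_chart_target _ _, mem_chart_target _ _⟩)).mdifferentiableAt (by simp))
      hjd.differentiableAt.mdifferentiableAt hj0 (ξ, v)
    rw [mfderiv_eq_fderiv, hjd.fderiv] at e1
    have e2 := mfderiv_actionInCharts_fst (G := G) x (z := φ x) (mem_chart_target _ _) ξ
    have e3 := mfderiv_actionInCharts_snd (G := G) x (a := a₀) (mem_chart_target _ _) (ι v)
    let T : Euc k × Euc n →L[ℝ] Euc n := mfderiv 𝓘(ℝ, Euc k × Euc n) (𝓡 n)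
      (actionInCharts (n := n) (k := k) G x) (a₀, φ x)
    have e4 : T (ξ, ι v) = T (ξ, 0) + T (0, ι v) := by
      rw [← map_add]; simp
    have e5 : T (ξ, 0) = A ξ := by
      refine e2.trans ?_
      have : ∀ y z : M, y = z → (infinitesimalAction (n := n) (k := k) G y ξ : Euc n) =
        infinitesimalAction (n := n) (k := k) G z ξ := by rintro y z rfl; rfl
      exact this _ _ (φ.left_inv (mem_chart_source _ _))
    have e6 : T (0, ι v) = ι v := by
      refine e3.trans ?_
      have : (fun y : M => (chartAt (Euc k) (1 : G)).symm a₀ • y) = id := by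
        funext y
        rw [ha₀, chartAt_one_symm, one_smul, id]
      rw [this, mfderiv_id]
      rfl
    refine e1.trans (e4.trans ?_)
    rw [e5, e6]
    rfl
  have hbij : Function.Bijective (mfderiv 𝓘(ℝ, Euc k × K) (𝓡 n)
      (actionInCharts (n := n) (k := k) G x ∘ j) (a₀, 0) : Euc k × K →L[ℝ] Euc n) := by
    have : ((mfderiv 𝓘(ℝ, Euc k × K) (𝓡 n) (actionInCharts (n := n) (k := k) G x ∘ j) (a₀, 0) :
      Euc k × K →L[ℝ] Euc n) : Euc k × K → Euc n) = A.coprod ι := funext hder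
    rw [this]
    exact hι
  obtain ⟨Ψ, h1, h2, h3, h4⟩ := exists_isDiffeo hUo h0U hΦ hbij
  refine ⟨fun s => φ.symm (φ x + ι s), Ψ, h4, h1, fun p hp => (h2 hp).1, fun p hp => h3 hp, ?_⟩
  simp [hφ]

section FlowBox

variable {K : Type*} [NormedAddCommGroup K] [NormedSpace ℝ K] {x : M} {ψ : K → M}
  {Ψ : OpenPartialHomeomorph (Euc k × K) M}

theorem IsFlowBox.exists_infinitesimalAction_eq (h : IsFlowBox (n := n) (k := k) G x ψ Ψ)
    {p : Euc k × K} (hp : p ∈ Ψ.source) (η : Euc k) :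
    ∃ ξ : Euc k, (infinitesimalAction (n := n) (k := k) G (Ψ p) ξ : Euc n) =
      mfderiv 𝓘(ℝ, Euc k × K) (𝓡 n) Ψ p ((η, 0) : Euc k × K) := by
  have hc := (IsDiffeo.chartAt (E := Euc k) (1 : G)).mdifferentiableAt_symm (h.fst_mem p hp)
  obtain ⟨ξ, hξ⟩ := mfderiv_smul_curve_mem_range (n := n) hc (ψ p.2) η
  have h2 : HasFDerivAt (fun a : Euc k => (a, p.2)) (ContinuousLinearMap.inl ℝ (Euc k) K) p.1 :=
    (hasFDerivAt_id _).prodMk (hasFDerivAt_const _ _)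
  have e1 := mfderiv_comp_apply_of_eq (I := 𝓡 k) p.1 (y := p) (h.isDiffeo.mdifferentiableAt hp)
    h2.differentiableAt.mdifferentiableAt rfl η
  rw [mfderiv_eq_fderiv, h2.fderiv] at e1
  have e2 : Ψ ∘ (fun a : Euc k => (a, p.2)) =ᶠ[𝓝 p.1]
      fun a => (chartAt (Euc k) (1 : G)).symm a • ψ p.2 := by
    filter_upwards [(Ψ.open_source.preimage (Continuous.prodMk_left p.2)).mem_nhds hp] with a ha
    exact h.apply_eq _ ha
  have e3 : (mfderiv (𝓡 k) (𝓡 n) (Ψ ∘ (fun a : Euc k => (a, p.2))) p.1 η : Euc n) =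
      mfderiv (𝓡 k) (𝓡 n) (fun a => (chartAt (Euc k) (1 : G)).symm a • ψ p.2) p.1 η := by
    have := e2.mfderiv_eq (I := 𝓡 k) (I' := 𝓡 n)
    exact congrArg (fun T : Euc k →L[ℝ] Euc n => T η) this
  refine ⟨ξ, ?_⟩
  have e4 : ∀ y z : M, y = z → (infinitesimalAction (n := n) (k := k) G y ξ : Euc n) =
    infinitesimalAction (n := n) (k := k) G z ξ := by rintro y z rfl; rfl
  exact (e4 _ _ (h.apply_eq p hp)).trans (hξ.trans (e3.symm.trans e1))

/-- In a flow box the directions of the orbits are the directions of the first factor. -/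
theorem IsFlowBox.snd_mfderiv_symm_eq_zero_iff (h : IsFlowBox (n := n) (k := k) G x ψ Ψ)
    {y : M} (hy : y ∈ Ψ.target) (v : Euc n) :
    (mfderiv (𝓡 n) 𝓘(ℝ, Euc k × K) Ψ.symm y v : Euc k × K).2 = 0 ↔
      ∃ ξ : Euc k, (infinitesimalAction (n := n) (k := k) G y ξ : Euc n) = v := by
  set p := Ψ.symm y with hp
  have hps : p ∈ Ψ.source := Ψ.map_target hy
  have hpy : Ψ p = y := Ψ.right_inv hy
  let T : Euc k × K →L[ℝ] Euc n := mfderiv 𝓘(ℝ, Euc k × K) (𝓡 n) Ψ p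
  let S : Euc n →L[ℝ] Euc k × K := mfderiv (𝓡 n) 𝓘(ℝ, Euc k × K) Ψ.symm y
  have hTS : ∀ v, T (S v) = v := fun v => h.isDiffeo.mfderiv_apply_mfderiv_symm hy v
  have hST : ∀ w, S (T w) = w := by
    intro w
    have := h.isDiffeo.mfderiv_symm_apply_mfderiv hps w
    rw [hpy] at this
    exact this
  let A : Euc k →L[ℝ] Euc n := infinitesimalAction (n := n) (k := k) G y
  let T' : Euc k →L[ℝ] Euc n := T.comp (ContinuousLinearMap.inl ℝ (Euc k) K)
  have hle : LinearMap.range T'.toLinearMap ≤ LinearMap.range A.toLinearMap := by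
    rintro _ ⟨η, rfl⟩
    obtain ⟨ξ, hξ⟩ := h.exists_infinitesimalAction_eq hps η
    have e4 : ∀ y z : M, y = z → (infinitesimalAction (n := n) (k := k) G y ξ : Euc n) =
      infinitesimalAction (n := n) (k := k) G z ξ := by rintro y z rfl; rfl
    exact ⟨ξ, (e4 _ _ hpy).symm.trans hξ⟩
  have hinj : Function.Injective T' := by
    intro a b hab
    have := congrArg S hab
    simp only [T', ContinuousLinearMap.comp_apply, hST] at this
    exact congrArg Prod.fst this
  have heq : LinearMap.range T'.toLinearMap = LinearMap.range A.toLinearMap := by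
    refine Submodule.eq_of_le_of_finrank_le hle ?_
    rw [LinearMap.finrank_range_of_inj (f := T'.toLinearMap) hinj]
    exact LinearMap.finrank_range_le _
  constructor
  · intro hv
    have h1 : T' (S v).1 = v := by
      refine Eq.trans ?_ (hTS v)
      exact congrArg T (Prod.ext rfl hv.symm)
    have h2 : v ∈ LinearMap.range A.toLinearMap := heq ▸ ⟨_, h1⟩
    exact h2
  · rintro ⟨ξ, rfl⟩
    have h2 : A ξ ∈ LinearMap.range T'.toLinearMap := heq ▸ ⟨ξ, rfl⟩
    obtain ⟨η, hη⟩ := h2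
    have h3 : S (A ξ) = (η, 0) := by
      rw [← hη]; exact hST _
    exact congrArg Prod.snd h3

end FlowBox

end Action

/-! ### Leaves and orbits of the identity component -/

section Leaf

variable {n k : ℕ} {M : Type*} [TopologicalSpace M] [ChartedSpace (Euc n) M] [IsManifold (𝓡 n) ∞ M]
  {G : Type*} [TopologicalSpace G] [ChartedSpace (Euc k) G] [Group G] [LieGroup (𝓡 k) ∞ G]
  [MulAction G M] [ContMDiffSMul (𝓡 k) (𝓡 n) ∞ G M]

theorem isOpen_connectedComponent_of_chartedSpace (k : ℕ) {X : Type*} [TopologicalSpace X]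
    [ChartedSpace (Euc k) X] (x : X) : IsOpen (connectedComponent x) := by
  have : LocallyConnectedSpace X := ChartedSpace.locallyConnectedSpace (Euc k) X
  exact isOpen_connectedComponent

theorem le_of_infinitesimalAction_injective {x : M}
    (hinj : Function.Injective (infinitesimalAction (n := n) (k := k) G x)) : k ≤ n := by
  let A : Euc k →L[ℝ] Euc n := infinitesimalAction (n := n) (k := k) G x
  simpa using LinearMap.finrank_le_finrank_of_injective (f := A.toLinearMap) hinj

/-- A curve in a flow box whose velocity is tangent to the orbits stays in a plaque. -/
theorem IsFlowBox.eventually_snd_eq {K : Type*} [NormedAddCommGroup K] [NormedSpace ℝ K] {x : M}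
    {ψ : K → M} {Ψ : OpenPartialHomeomorph (Euc k × K) M}
    (h : IsFlowBox (n := n) (k := k) G x ψ Ψ) {γ : ℝ → M} {t₀ : ℝ} (hγc : ContinuousAt γ t₀)
    (hγ : ∀ᶠ t in 𝓝 t₀, MDifferentiableAt 𝓘(ℝ, ℝ) (𝓡 n) γ t) (ht₀ : γ t₀ ∈ Ψ.target)
    (hinf : ∀ᶠ t in 𝓝 t₀, ∃ ξ : Euc k, (infinitesimalAction (n := n) (k := k) G (γ t) ξ : Euc n) =
      mfderiv 𝓘(ℝ, ℝ) (𝓡 n) γ t (1 : ℝ)) :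
    ∀ᶠ t in 𝓝 t₀, (Ψ.symm (γ t)).2 = (Ψ.symm (γ t₀)).2 := by
  refine eventually_eq_of_hasDerivAt_zero ?_
  filter_upwards [hγ, hγc.eventually_mem (Ψ.open_target.mem_nhds ht₀), hinf] with t ht hts htx
  have h1 := (h.isDiffeo.mdifferentiableAt_symm hts).comp t ht
  have h2 : HasFDerivAt (fun t => Ψ.symm (γ t)) (fderiv ℝ (fun t => Ψ.symm (γ t)) t) t :=
    h1.differentiableAt.hasFDerivAt
  have h3 := mfderiv_comp_apply (I := 𝓘(ℝ, ℝ)) t (h.isDiffeo.mdifferentiableAt_symm hts) ht (1 : ℝ)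
  rw [mfderiv_eq_fderiv] at h3
  have h4 := (h.snd_mfderiv_symm_eq_zero_iff hts (mfderiv 𝓘(ℝ, ℝ) (𝓡 n) γ t (1 : ℝ))).2 htx
  have h5 := (hasFDerivAt_snd (𝕜 := ℝ) (p := Ψ.symm (γ t))).comp t h2
  have h6 := h5.hasDerivAt
  have h7 : (fderiv ℝ (fun t => Ψ.symm (γ t)) t 1).2 = 0 :=
    (congrArg Prod.snd h3).trans h4
  have h8 : ((ContinuousLinearMap.snd ℝ (Euc k) K).comp
      (fderiv ℝ (fun t => Ψ.symm (γ t)) t)) 1 = 0 := h7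
  rw [h8] at h6
  exact h6

/-- A curve tangent to the orbits stays in one orbit of the identity component, because in a flow
box it moves by group elements close to the identity. -/
theorem exists_smul_eq_of_tangent_curve
    (hinj : ∀ x : M, Function.Injective (infinitesimalAction (n := n) (k := k) G x)) {γ : ℝ → M}
    (hγ : ContMDiff 𝓘(ℝ, ℝ) (𝓡 n) ∞ γ)
    (hinf : ∀ t, ∃ ξ : Euc k, (infinitesimalAction (n := n) (k := k) G (γ t) ξ : Euc n) =
      mfderiv 𝓘(ℝ, ℝ) (𝓡 n) γ t (1 : ℝ)) (t₀ t₁ : ℝ) :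
    ∃ g ∈ connectedComponent (1 : G), g • γ t₀ = γ t₁ := by
  have : IsTopologicalGroup G := topologicalGroup_of_lieGroup (𝓡 k) ∞
  let H : Subgroup G := Subgroup.connectedComponentOfOne G
  have hlc : IsLocallyConstant
      (fun t => (Quotient.mk'' (γ t) : MulAction.orbitRel.Quotient H M)) := by
    rw [IsLocallyConstant.iff_eventually_eq]
    intro t
    have hdim : k + Module.finrank ℝ (Euc (n - k)) = n := by
      have := le_of_infinitesimalAction_injective (hinj (γ t))
      simp
      omega
    obtain ⟨ψ, Ψ, hΨ⟩ := exists_isFlowBox (G := G) (K := Euc (n - k)) hdim (γ t) (hinj (γ t))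
    have h0 : Ψ (chartAt (Euc k) (1 : G) 1, 0) = γ t := by
      rw [hΨ.apply_eq _ hΨ.mem_source]
      simp only
      rw [chartAt_one_symm, one_smul, hΨ.apply_zero]
    have ht : γ t ∈ Ψ.target := h0 ▸ Ψ.map_source hΨ.mem_source
    have h0' : Ψ.symm (γ t) = (chartAt (Euc k) (1 : G) 1, 0) := by
      rw [← h0, Ψ.left_inv hΨ.mem_source]
    have hc := hγ.continuous.continuousAt (x := t)
    have hsymm : ContinuousAt (fun s => (Ψ.symm (γ s)).1) t :=
      continuousAt_fst.comp (ContinuousAt.comp (g := Ψ.symm) (Ψ.continuousAt_symm ht) hc)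
    have hgc : ContinuousAt (fun s => (chartAt (Euc k) (1 : G)).symm (Ψ.symm (γ s)).1) t := by
      refine ContinuousAt.comp (g := (chartAt (Euc k) (1 : G)).symm)
        ((chartAt (Euc k) (1 : G)).continuousAt_symm ?_) hsymm
      rw [h0']
      exact mem_chart_target _ _
    have hmem := hgc.eventually_mem
      ((isOpen_connectedComponent_of_chartedSpace k (1 : G)).mem_nhds (by
      rw [h0']
      simp only
      rw [chartAt_one_symm]
      exact mem_connectedComponent))
    filter_upwards [hΨ.eventually_snd_eq hc
      (Filter.Eventually.of_forall fun s => hγ.mdifferentiable (by simp) s) ht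
      (Filter.Eventually.of_forall hinf), hmem, hc.eventually_mem (Ψ.open_target.mem_nhds ht)]
      with s hs1 hs2 hs3
    refine Quotient.sound' ⟨⟨_, hs2⟩, ?_⟩
    change (chartAt (Euc k) (1 : G)).symm (Ψ.symm (γ s)).1 • γ t = γ s
    have h2 := hΨ.apply_eq _ (Ψ.map_target hs3)
    rw [Ψ.right_inv hs3, hs1, h0'] at h2
    simp only at h2
    rw [hΨ.apply_zero] at h2
    exact h2.symm
  have h1 := hlc.apply_eq_of_preconnectedSpace t₁ t₀
  obtain ⟨g, hg⟩ := Quotient.exact h1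
  exact ⟨g, g.2, hg⟩

/-- For `g` close to the identity, a path from `1` to `g` gives a curve from `y` to `g • y` tangent
to the orbits. The parameter is cut off, so that the curve is defined for all times. -/
theorem exists_curve_of_chart (a : Euc k)
    (ha : segment ℝ (chartAt (Euc k) (1 : G) 1) a ⊆ (chartAt (Euc k) (1 : G)).target) (y : M) :
    ∃ γ : ℝ → M, ContMDiff 𝓘(ℝ, ℝ) (𝓡 n) ∞ γ ∧ γ 0 = y ∧
      γ 1 = (chartAt (Euc k) (1 : G)).symm a • y ∧
      ∀ t, ∃ ξ : Euc k, (infinitesimalAction (n := n) (k := k) G (γ t) ξ : Euc n) =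
        mfderiv 𝓘(ℝ, ℝ) (𝓡 n) γ t (1 : ℝ) := by
  set a₀ := chartAt (Euc k) (1 : G) 1 with ha₀
  let ℓ : ℝ → Euc k := fun t => a₀ + Real.smoothTransition t • (a - a₀)
  have hℓ : ContDiff ℝ ∞ ℓ :=
    contDiff_const.add ((Real.smoothTransition.contDiff (n := ⊤)).smul contDiff_const)
  have hℓm : ∀ t, ℓ t ∈ (chartAt (Euc k) (1 : G)).target := fun t => ha <| by
    rw [segment_eq_image']
    exact ⟨_, ⟨Real.smoothTransition.nonneg t, Real.smoothTransition.le_one t⟩, rfl⟩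
  have hh : ContMDiff 𝓘(ℝ, ℝ) (𝓡 k) ∞ (fun t => (chartAt (Euc k) (1 : G)).symm (ℓ t)) := fun t =>
    ((IsDiffeo.chartAt (1 : G)).contMDiffAt_symm (hℓm t)).comp t hℓ.contMDiff.contMDiffAt
  refine ⟨fun t => (chartAt (Euc k) (1 : G)).symm (ℓ t) • y,
    (contMDiff_smul_const (n := n) (k := k) y).comp hh, ?_, ?_, fun t => ?_⟩
  · simp only [ℓ, Real.smoothTransition.zero, zero_smul, add_zero]
    rw [ha₀, chartAt_one_symm, one_smul]
  · simp [ℓ, Real.smoothTransition.one]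
  · exact mfderiv_smul_curve_mem_range (hh.mdifferentiable (by simp) t) y (1 : ℝ)

/-- If the characteristic directions are the directions of the orbits, then the characteristics
are the orbits of the identity component. -/
theorem characteristicLeaf_eq {C : SubspaceField n M}
    (hchar : ∀ x, characteristicDirections C x =
      Set.range (infinitesimalAction (n := n) (k := k) G x))
    (hinj : ∀ x : M, Function.Injective (infinitesimalAction (n := n) (k := k) G x)) (x : M) :
    characteristicLeaf C x = {y | ∃ g ∈ connectedComponent (1 : G), g • x = y} := by
  have : IsTopologicalGroup G := topologicalGroup_of_lieGroup (𝓡 k) ∞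
  let H : Subgroup G := Subgroup.connectedComponentOfOne G
  set R : M → M → Prop := fun a b => ∃ γ : ℝ → M,
      ContMDiff 𝓘(ℝ, ℝ) (𝓡 n) ∞ γ ∧ γ 0 = a ∧ γ 1 = b ∧
      ∀ t : ℝ, mfderiv 𝓘(ℝ, ℝ) (𝓡 n) γ t (1 : ℝ) ∈ characteristicDirections C (γ t) with hR
  ext y
  constructor
  · intro hy
    change Relation.ReflTransGen R x y at hy
    induction hy with
    | refl => exact ⟨1, mem_connectedComponent, one_smul G x⟩
    | tail _ hbc ih =>
      obtain ⟨g, hg, rfl⟩ := ih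
      obtain ⟨γ, hγ, h0, h1, hγ'⟩ := hbc
      obtain ⟨g', hg', hgg⟩ := exists_smul_eq_of_tangent_curve (G := G) hinj hγ
        (fun t => by have := hγ' t; rw [hchar] at this; exact this) 0 1
      refine ⟨g' * g, H.mul_mem hg' hg, ?_⟩
      rw [mul_smul, ← h0, hgg, h1]
  · rintro ⟨g, hg, rfl⟩
    -- the group elements that can be followed by curves in both directions form an open subgroup
    let S : Subgroup G :=
      { carrier := {g | ∀ y : M, Relation.ReflTransGen R y (g • y) ∧
          Relation.ReflTransGen R y (g⁻¹ • y)}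
        one_mem' := fun y => by simpa using Relation.ReflTransGen.refl
        mul_mem' := fun {a b} ha hb y => by
          simp only [mul_smul, mul_inv_rev]
          exact ⟨(hb y).1.trans (ha _).1, (ha y).2.trans (hb _).2⟩
        inv_mem' := fun {a} ha y => by
          rw [inv_inv]
          exact ⟨(ha y).2, (ha y).1⟩ }
    obtain ⟨r, hr, hrt⟩ := Metric.isOpen_iff.1 (chartAt (Euc k) (1 : G)).open_target
      (chartAt (Euc k) (1 : G) 1) (mem_chart_target _ _)
    have hbig : ∀ᶠ g in 𝓝 (1 : G), ∀ y : M, R y (g • y) := by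
      have hc := (chartAt (Euc k) (1 : G)).continuousAt (mem_chart_source _ (1 : G))
      filter_upwards [hc.eventually_mem (Metric.ball_mem_nhds _ hr),
        (chartAt (Euc k) (1 : G)).open_source.mem_nhds (mem_chart_source _ (1 : G))] with g hg hgs y
      obtain ⟨γ, h1, h2, h3, h4⟩ := exists_curve_of_chart (n := n) (G := G)
        (chartAt (Euc k) (1 : G) g)
        (((convex_ball _ r).segment_subset (Metric.mem_ball_self hr) hg).trans hrt) y
      rw [(chartAt (Euc k) (1 : G)).left_inv hgs] at h3
      refine ⟨γ, h1, h2, h3, fun t => ?_⟩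
      rw [hchar]
      exact h4 t
    have hinv : ∀ᶠ g in 𝓝 (1 : G), ∀ y : M, R y (g⁻¹ • y) := by
      have h1 : Filter.Tendsto (fun g : G => g⁻¹) (𝓝 1) (𝓝 1) := by
        simpa using (continuous_inv.tendsto (1 : G))
      exact h1.eventually hbig
    have hS : (S : Set G) ∈ 𝓝 (1 : G) := by
      filter_upwards [hbig, hinv] with g h1 h2 y
      exact ⟨.single (h1 y), .single (h2 y)⟩
    have hSo := S.isOpen_of_mem_nhds hS
    have hcl : IsClopen (S : Set G) := ⟨S.isClosed_of_isOpen hSo, hSo⟩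
    exact (hcl.connectedComponent_subset S.one_mem hg x).1

end Leaf

/-! ### Submersions -/

section Submersion

variable {E : Type*} [NormedAddCommGroup E] [NormedSpace ℝ E]
  {E' : Type*} [NormedAddCommGroup E'] [NormedSpace ℝ E']
  {N : Type*} [TopologicalSpace N] [ChartedSpace E N] [IsManifold 𝓘(ℝ, E) ∞ N]
  {Q : Type*} [TopologicalSpace Q] [ChartedSpace E' Q] [IsManifold 𝓘(ℝ, E') ∞ Q]
  {f : N → Q} {x : N}

/-- A submersion has smooth local sections through each point. -/
theorem exists_section_of_isSubmersionAt (hf : IsSubmersionAt 𝓘(ℝ, E) 𝓘(ℝ, E') ∞ f x) :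
    ∃ (V : Set Q) (σ : Q → N), IsOpen V ∧ f x ∈ V ∧ ContMDiffOn 𝓘(ℝ, E') 𝓘(ℝ, E) ∞ σ V ∧
      σ (f x) = x ∧ ∀ q ∈ V, f (σ q) = q := by
  set φ := hf.domChart
  set ψ := hf.codChart
  have hφ : IsDiffeo E E φ := IsDiffeo.of_mem_maximalAtlas hf.domChart_mem_maximalAtlas
  have hψ : IsDiffeo E' E' ψ := IsDiffeo.of_mem_maximalAtlas hf.codChart_mem_maximalAtlas
  have hx : x ∈ φ.source := hf.mem_domChart_source
  have hfx : f x ∈ ψ.source := hf.mem_codChart_source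
  have hw : ∀ z ∈ φ.target, ψ (f (φ.symm z)) = (hf.equiv z).1 := fun z hz =>
    hf.writtenInCharts (by simpa [φ] using hz)
  let j : E' → E := fun u => hf.equiv.symm (u, (hf.equiv (φ x)).2)
  have hj : ContDiff ℝ ∞ j := hf.equiv.symm.contDiff.comp (contDiff_id.prodMk contDiff_const)
  have hjx : j (ψ (f x)) = φ x := by
    have := hw (φ x) (φ.map_source hx)
    rw [φ.left_inv hx] at this
    change hf.equiv.symm (ψ (f x), (hf.equiv (φ x)).2) = φ x
    rw [this]
    exact hf.equiv.symm_apply_apply _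
  have hjo : IsOpen (j ⁻¹' φ.target) := φ.open_target.preimage hj.continuous
  refine ⟨ψ.source ∩ ψ ⁻¹' (j ⁻¹' φ.target), fun q => φ.symm (j (ψ q)),
    ψ.isOpen_inter_preimage hjo, ⟨hfx, ?_⟩, ?_, ?_, ?_⟩
  · rw [mem_preimage, mem_preimage, hjx]
    exact φ.map_source hx
  · exact hφ.2.comp (hj.contMDiff.comp_contMDiffOn (hψ.1.mono inter_subset_left)) fun q hq => hq.2
  · simp only [hjx]
    exact φ.left_inv hx
  · rintro q ⟨hq1, hq2⟩
    refine ψ.injOn (hf.source_subset_preimage_source (φ.map_target hq2)) hq1 ?_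
    rw [hw _ hq2]
    simp [j]

theorem mfderiv_surjective_of_isSubmersionAt (hf : IsSubmersionAt 𝓘(ℝ, E) 𝓘(ℝ, E') ∞ f x) :
    Function.Surjective (mfderiv 𝓘(ℝ, E) 𝓘(ℝ, E') f x) := by
  obtain ⟨V, σ, hV, hxV, hσ, hσx, hfσ⟩ := exists_section_of_isSubmersionAt hf
  intro v
  have h1 := mfderiv_comp_apply_of_eq (f x) (y := x) (hf.contMDiffAt.mdifferentiableAt (by simp))
    ((hσ.contMDiffAt (hV.mem_nhds hxV)).mdifferentiableAt (by simp)) hσx v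
  have h2 : f ∘ σ =ᶠ[𝓝 (f x)] id := by
    filter_upwards [hV.mem_nhds hxV] with q hq using hfσ q hq
  rw [h2.mfderiv_eq, mfderiv_id] at h1
  exact ⟨_, h1.symm⟩

/-- A vector in the kernel of the differential of a submersion is the velocity of a curve in the
fibre. -/
theorem exists_curve_in_fiber (hf : IsSubmersionAt 𝓘(ℝ, E) 𝓘(ℝ, E') ∞ f x)
    {v : E} (hv : (mfderiv 𝓘(ℝ, E) 𝓘(ℝ, E') f x v : E') = 0) :
    ∃ η : ℝ → N, MDifferentiableAt 𝓘(ℝ, ℝ) 𝓘(ℝ, E) η 0 ∧ η 0 = x ∧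
      (mfderiv 𝓘(ℝ, ℝ) 𝓘(ℝ, E) η 0 (1 : ℝ) : E) = v ∧ ∀ᶠ t in 𝓝 0, f (η t) = f x := by
  set φ := hf.domChart
  set ψ := hf.codChart
  have hφ : IsDiffeo E E φ := IsDiffeo.of_mem_maximalAtlas hf.domChart_mem_maximalAtlas
  have hψ : IsDiffeo E' E' ψ := IsDiffeo.of_mem_maximalAtlas hf.codChart_mem_maximalAtlas
  have hx : x ∈ φ.source := hf.mem_domChart_source
  have hfx : f x ∈ ψ.source := hf.mem_codChart_source
  have hw : ∀ z ∈ φ.target, ψ (f (φ.symm z)) = (hf.equiv z).1 := fun z hz =>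
    hf.writtenInCharts (by simpa [φ] using hz)
  obtain ⟨w, hw'⟩ : ∃ w : E, w = mfderiv 𝓘(ℝ, E) 𝓘(ℝ, E) φ x v := ⟨_, rfl⟩
  have hew : (hf.equiv w).1 = 0 := by
    have h1 := mfderiv_comp_apply (I := 𝓘(ℝ, E)) x (hψ.mdifferentiableAt hfx)
      (hf.contMDiffAt.mdifferentiableAt (by simp)) v
    have h2 : ψ ∘ f =ᶠ[𝓝 x] (fun z => (hf.equiv z).1) ∘ φ := by
      filter_upwards [φ.open_source.mem_nhds hx] with y hy
      have := hw (φ y) (φ.map_source hy)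
      rwa [φ.left_inv hy] at this
    have hd : HasFDerivAt (fun z => (hf.equiv z).1)
        ((ContinuousLinearMap.fst ℝ E' hf.complement).comp (hf.equiv : E →L[ℝ] _)) (φ x) :=
      (ContinuousLinearMap.fst ℝ E' hf.complement).hasFDerivAt.comp _
        hf.equiv.hasFDerivAt
    have h3 := mfderiv_comp_apply (I := 𝓘(ℝ, E)) x (g := fun z => (hf.equiv z).1)
      hd.differentiableAt.mdifferentiableAt (hφ.mdifferentiableAt hx) v
    rw [mfderiv_eq_fderiv, hd.fderiv] at h3
    rw [h2.mfderiv_eq] at h1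
    have h4 := congrArg (mfderiv 𝓘(ℝ, E') 𝓘(ℝ, E') ψ (f x) : E' →L[ℝ] E') hv
    have h5 := h3.symm.trans (h1.trans (h4.trans (map_zero _)))
    rw [hw']
    exact h5
  have hℓ : HasFDerivAt (fun t : ℝ => φ x + t • w) ((1 : ℝ →L[ℝ] ℝ).smulRight w) 0 :=
    ((hasFDerivAt_id (0 : ℝ)).smul_const w).const_add (φ x)
  have hℓ0 : φ x + (0 : ℝ) • w = φ x := by simp
  have hsymm := hφ.mdifferentiableAt_symm (φ.map_source hx)
  have hsymm' : MDifferentiableAt 𝓘(ℝ, E) 𝓘(ℝ, E) φ.symm (φ x + (0 : ℝ) • w) := by rwa [hℓ0]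
  refine ⟨fun t => φ.symm (φ x + t • w), hsymm'.comp (0 : ℝ)
    hℓ.differentiableAt.mdifferentiableAt, ?_, ?_, ?_⟩
  · simp [φ.left_inv hx]
  · have h1 := mfderiv_comp_apply_of_eq (0 : ℝ) (y := φ x) hsymm
      hℓ.differentiableAt.mdifferentiableAt hℓ0 (1 : ℝ)
    rw [mfderiv_eq_fderiv, hℓ.fderiv] at h1
    have h2 : (((1 : ℝ →L[ℝ] ℝ).smulRight w) 1 : E) = mfderiv 𝓘(ℝ, E) 𝓘(ℝ, E) φ x v := by
      rw [← hw']
      simp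
    have h3 := congrArg (mfderiv 𝓘(ℝ, E) 𝓘(ℝ, E) φ.symm (φ x) : E →L[ℝ] E) h2
    exact h1.trans (h3.trans (hφ.mfderiv_symm_apply_mfderiv hx v))
  · filter_upwards [hℓ.continuousAt.eventually_mem
      (φ.open_target.mem_nhds (by rw [hℓ0]; exact φ.map_source hx))] with t ht
    refine ψ.injOn (hf.source_subset_preimage_source (φ.map_target ht)) hfx ?_
    have := hw (φ x) (φ.map_source hx)
    rw [φ.left_inv hx] at this
    rw [hw _ ht, this]
    simp [hew]

end Submersion

/-! ### Proper actions -/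

section Proper

open Filter

/-- For a proper action, the points of the orbit of `x` close to `x` come from group elements
close to `1`. -/
theorem eventually_mem_image_of_mem_orbit {G X : Type*} [Group G] [TopologicalSpace G]
    [IsTopologicalGroup G] [TopologicalSpace X] [MulAction G X] [ProperSMul G X] (x : X) {W : Set G}
    (hW : W ∈ 𝓝 (1 : G)) : ∀ᶠ y in 𝓝 x, y ∈ MulAction.orbit G x → ∃ g ∈ W, g • x = y := by
  by_contra hcon
  rw [not_eventually] at hcon
  obtain ⟨𝒰, h𝒰⟩ := exists_ultrafilter_iff.2 (frequently_iff_neBot.1 hcon)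
  have h1 : (𝒰 : Filter X) ≤ 𝓝 x := h𝒰.trans inf_le_left
  have h2 : ∀ᶠ y in (𝒰 : Filter X), ¬(y ∈ MulAction.orbit G x → ∃ g ∈ W, g • x = y) :=
    h𝒰.trans inf_le_right (mem_principal_self _)
  classical
  -- group elements moving `x` along the ultrafilter converge to a stabilizing element `g`, and
  -- dividing by `g` gives elements close to `1`
  let τ : X → G := fun y => if h : y ∈ MulAction.orbit G x then h.choose else 1
  have hτ : ∀ y ∈ MulAction.orbit G x, τ y • x = y := by
    intro y hy
    simp only [τ, dif_pos hy]
    exact hy.choose_spec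
  have h3 := ((properSMul_iff_continuousSMul_ultrafilter_tendsto (G := G) (X := X)).1
    inferInstance).2 (𝒰.map fun y => (τ y, x)) x x (by
      rw [Ultrafilter.coe_map, tendsto_map'_iff]
      refine Tendsto.prodMk_nhds ?_ tendsto_const_nhds
      refine Tendsto.congr' ?_ (h1 : Tendsto id (𝒰 : Filter X) (𝓝 x))
      filter_upwards [h2] with y hy
      push Not at hy
      exact (hτ y hy.1).symm)
  obtain ⟨g, hg, hg'⟩ := h3
  rw [Ultrafilter.coe_map, tendsto_map'_iff] at hg'
  have h4 : Tendsto (fun y => τ y * g⁻¹) (𝒰 : Filter X) (𝓝 1) := by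
    have : Tendsto (fun y => τ y * g⁻¹) (𝒰 : Filter X) (𝓝 (g * g⁻¹)) :=
      Tendsto.mul_const _ hg'
    rwa [mul_inv_cancel] at this
  obtain ⟨y, hy1, hy2⟩ := (h2.and (h4.eventually_mem hW)).exists
  push Not at hy1
  refine hy1.2 _ hy2 ?_
  rw [mul_smul, inv_smul_eq_iff.2 hg.symm, hτ y hy1.1]

end Proper

section ProperSubmersion

variable {n k d : ℕ} {M : Type*} [TopologicalSpace M] [ChartedSpace (Euc n) M]
  [IsManifold (𝓡 n) ∞ M]
  {G : Type*} [TopologicalSpace G] [ChartedSpace (Euc k) G] [Group G] [LieGroup (𝓡 k) ∞ G]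
  [MulAction G M] [ContMDiffSMul (𝓡 k) (𝓡 n) ∞ G M]
  {Q : Type*} [TopologicalSpace Q] [ChartedSpace (Euc d) Q] [IsManifold (𝓡 d) ∞ Q]

/-- The kernel of the differential of an orbit projection that is a submersion consists of the
directions of the orbits, if the action is proper. -/
theorem mfderiv_eq_zero_iff_of_isSubmersion [ProperSMul G M] {p : M → Q}
    (hp : IsSubmersion (𝓡 n) (𝓡 d) ∞ p) (hfib : ∀ x y, p x = p y ↔ x ∈ MulAction.orbit G y) {x : M}
    (hinj : Function.Injective (infinitesimalAction (n := n) (k := k) G x)) (v : Euc n) :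
    (mfderiv (𝓡 n) (𝓡 d) p x v : Euc d) = 0 ↔
      ∃ ξ : Euc k, (infinitesimalAction (n := n) (k := k) G x ξ : Euc n) = v := by
  have : IsTopologicalGroup G := topologicalGroup_of_lieGroup (𝓡 k) ∞
  constructor
  · intro hv
    obtain ⟨η, hη, hη0, hηv, hηp⟩ := exists_curve_in_fiber (hp.isSubmersionAt x) hv
    have hdim : k + Module.finrank ℝ (Euc (n - k)) = n := by
      have := le_of_infinitesimalAction_injective hinj
      simp
      omega
    obtain ⟨ψ, Ψ, hΨ⟩ := exists_isFlowBox (G := G) (K := Euc (n - k)) hdim x hinj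
    set a₀ := chartAt (Euc k) (1 : G) 1 with ha₀
    have h0 : Ψ (a₀, 0) = x := by
      rw [hΨ.apply_eq _ hΨ.mem_source]
      change (chartAt (Euc k) (1 : G)).symm (chartAt (Euc k) (1 : G) 1) • ψ 0 = x
      rw [chartAt_one_symm, one_smul, hΨ.apply_zero]
    have hx : x ∈ Ψ.target := h0 ▸ Ψ.map_source hΨ.mem_source
    have hη0x : η 0 ∈ Ψ.target := by rwa [hη0]
    have hW : {g : G | g ∈ (chartAt (Euc k) (1 : G)).source ∧
        (chartAt (Euc k) (1 : G) g, (0 : Euc (n - k))) ∈ Ψ.source} ∈ 𝓝 (1 : G) := by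
      have hc := (chartAt (Euc k) (1 : G)).continuousAt (mem_chart_source _ (1 : G))
      have hc' : ContinuousAt (fun g : G => (chartAt (Euc k) (1 : G) g, (0 : Euc (n - k)))) 1 :=
        hc.prodMk continuousAt_const
      filter_upwards [(chartAt (Euc k) (1 : G)).open_source.mem_nhds (mem_chart_source _ (1 : G)),
        hc'.eventually_mem (Ψ.open_source.mem_nhds hΨ.mem_source)] with g hg1 hg2 using ⟨hg1, hg2⟩
    -- a curve in a fibre through `x` stays in the plaque of `x`
    have hev : ∀ᶠ t in 𝓝 (0 : ℝ), (Ψ.symm (η t)).2 = 0 := by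
      have h1 := hη.continuousAt.tendsto.eventually
        (by rw [hη0]; exact eventually_mem_image_of_mem_orbit x hW)
      filter_upwards [h1, hηp] with t ht htp
      obtain ⟨g, ⟨hg1, hg2⟩, hgt⟩ := ht ((hfib _ _).1 htp)
      have h2 := hΨ.apply_eq _ hg2
      simp only at h2
      rw [(chartAt (Euc k) (1 : G)).left_inv hg1, hΨ.apply_zero, hgt] at h2
      rw [← h2, Ψ.left_inv hg2]
    rw [← hΨ.snd_mfderiv_symm_eq_zero_iff hx]
    have hd := hΨ.isDiffeo.mdifferentiableAt_symm hx
    have h3 := mfderiv_comp_apply_of_eq (0 : ℝ) (y := x) hd hη hη0 (1 : ℝ)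
    have hd' := hΨ.isDiffeo.mdifferentiableAt_symm hη0x
    have h4 : HasFDerivAt (Ψ.symm ∘ η) (fderiv ℝ (Ψ.symm ∘ η) 0) 0 :=
      (hd'.comp (0 : ℝ) hη).differentiableAt.hasFDerivAt
    have h5 := (hasFDerivAt_snd (𝕜 := ℝ) (p := Ψ.symm (η 0))).comp (0 : ℝ) h4
    have h6 : HasFDerivAt (Prod.snd ∘ (Ψ.symm ∘ η)) (0 : ℝ →L[ℝ] Euc (n - k)) 0 :=
      (hasFDerivAt_const (0 : Euc (n - k)) (0 : ℝ)).congr_of_eventuallyEq hev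
    have h7 := congrArg (fun T : ℝ →L[ℝ] Euc (n - k) => T 1) (h5.unique h6)
    rw [mfderiv_eq_fderiv] at h3
    have h8 : (fderiv ℝ (Ψ.symm ∘ η) 0 1).2 = 0 := h7
    have h9 := congrArg (mfderiv (𝓡 n) 𝓘(ℝ, Euc k × Euc (n - k)) Ψ.symm x :
      Euc n →L[ℝ] Euc k × Euc (n - k)) hηv
    rw [← h9]
    exact (congrArg Prod.snd h3).symm.trans h8
  · rintro ⟨ξ, rfl⟩
    have h1 := mfderiv_comp_apply_of_eq (I := 𝓡 k) (1 : G) (y := x)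
      (hp.contMDiff.mdifferentiable (by simp) x)
      ((contMDiff_smul_const (n := n) (k := k) x).mdifferentiable (by simp) (1 : G))
      (one_smul G x) ξ
    have h2 : p ∘ (fun g : G => g • x) = fun _ => p x := by
      funext g
      exact (hfib _ _).2 ⟨g, rfl⟩
    rw [h2, mfderiv_const] at h1
    exact h1.symm

end ProperSubmersion

/-! ### The quotient by a free and proper action -/

section Quotient

open Filter

variable {n k : ℕ} {M : Type*} [TopologicalSpace M] [ChartedSpace (Euc n) M]
  [IsManifold (𝓡 n) ∞ M]
  {G : Type*} [TopologicalSpace G] [ChartedSpace (Euc k) G] [Group G] [LieGroup (𝓡 k) ∞ G]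
  [MulAction G M] [ContMDiffSMul (𝓡 k) (𝓡 n) ∞ G M]
  {K : Type*} [NormedAddCommGroup K] [NormedSpace ℝ K] [FiniteDimensional ℝ K]

theorem IsFlowBox.apply_one {x : M} {ψ : K → M} {Ψ : OpenPartialHomeomorph (Euc k × K) M}
    (h : IsFlowBox (n := n) (k := k) G x ψ Ψ) {s : K}
    (hs : (chartAt (Euc k) (1 : G) 1, s) ∈ Ψ.source) :
    Ψ (chartAt (Euc k) (1 : G) 1, s) = ψ s := by
  rw [h.apply_eq _ hs]
  change (chartAt (Euc k) (1 : G)).symm (chartAt (Euc k) (1 : G) 1) • ψ s = ψ s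
  rw [chartAt_one_symm, one_smul]

theorem IsFlowBox.apply_base {x : M} {ψ : K → M} {Ψ : OpenPartialHomeomorph (Euc k × K) M}
    (h : IsFlowBox (n := n) (k := k) G x ψ Ψ) : Ψ (chartAt (Euc k) (1 : G) 1, 0) = x := by
  rw [h.apply_one h.mem_source, h.apply_zero]

/-- For a free and proper action, the transversal of a flow box meets each orbit at most once near
its centre. -/
theorem IsFlowBox.eventually_eq_of_smul_eq [ProperSMul G M] {x : M} {ψ : K → M}
    {Ψ : OpenPartialHomeomorph (Euc k × K) M} (h : IsFlowBox (n := n) (k := k) G x ψ Ψ)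
    (hfree : ∀ g : G, g • x = x → g = 1) :
    ∀ᶠ p : K × K in 𝓝 (0, 0), ∀ g : G, g • ψ p.1 = ψ p.2 → p.1 = p.2 := by
  set a₀ := chartAt (Euc k) (1 : G) 1 with ha₀
  have hev : ∀ᶠ s in 𝓝 (0 : K), (a₀, s) ∈ Ψ.source :=
    (Ψ.open_source.preimage (Continuous.prodMk_right a₀)).mem_nhds h.mem_source
  have hψc : Tendsto ψ (𝓝 0) (𝓝 x) := by
    have h1 : ContinuousAt (fun s => Ψ (a₀, s)) 0 :=
      ContinuousAt.comp (g := Ψ) (Ψ.continuousAt h.mem_source)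
        (Continuous.prodMk_right a₀).continuousAt
    have h2 : Tendsto (fun s => Ψ (a₀, s)) (𝓝 0) (𝓝 x) := by
      have := h1.tendsto
      rwa [h.apply_base] at this
    refine h2.congr' ?_
    filter_upwards [hev] with s hs using h.apply_one hs
  by_contra hcon
  rw [not_eventually] at hcon
  obtain ⟨𝒰, h𝒰⟩ := exists_ultrafilter_iff.2 (frequently_iff_neBot.1 hcon)
  have h1 : (𝒰 : Filter (K × K)) ≤ 𝓝 (0, 0) := h𝒰.trans inf_le_left
  have h2 : ∀ᶠ p : K × K in (𝒰 : Filter (K × K)), ¬∀ g : G, g • ψ p.1 = ψ p.2 → p.1 = p.2 :=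
    h𝒰.trans inf_le_right (mem_principal_self _)
  have h2' : ∀ p : K × K, ∃ g : G, (¬∀ g : G, g • ψ p.1 = ψ p.2 → p.1 = p.2) →
      g • ψ p.1 = ψ p.2 ∧ p.1 ≠ p.2 := by
    intro p
    by_cases hp : ∀ g : G, g • ψ p.1 = ψ p.2 → p.1 = p.2
    · exact ⟨1, fun h => absurd hp h⟩
    · push Not at hp
      obtain ⟨g, hg⟩ := hp
      exact ⟨g, fun _ => hg⟩
  -- if there are counterexamples arbitrarily close to `0`, the group elements in them converge to
  -- an element of the stabilizer of `x`, hence to `1`; then both points lie in one flow box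
  choose τ hτ using h2'
  have hfst : Tendsto (fun p : K × K => p.1) (𝒰 : Filter (K × K)) (𝓝 0) :=
    (continuous_fst.tendsto ((0, 0) : K × K)).mono_left h1
  have hsnd : Tendsto (fun p : K × K => p.2) (𝒰 : Filter (K × K)) (𝓝 0) :=
    (continuous_snd.tendsto ((0, 0) : K × K)).mono_left h1
  have h3 := ((properSMul_iff_continuousSMul_ultrafilter_tendsto (G := G) (X := M)).1
    inferInstance).2 (𝒰.map fun p => (τ p, ψ p.1)) x x (by
      rw [Ultrafilter.coe_map, tendsto_map'_iff]
      refine Tendsto.prodMk_nhds ?_ (hψc.comp hfst)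
      refine Tendsto.congr' ?_ (hψc.comp hsnd)
      filter_upwards [h2] with p hp
      exact (hτ p hp).1.symm)
  obtain ⟨g, hg, hg'⟩ := h3
  rw [Ultrafilter.coe_map, tendsto_map'_iff, hfree g hg] at hg'
  have hg1 : Tendsto τ (𝒰 : Filter (K × K)) (𝓝 1) := hg'
  have hsrc : ∀ᶠ p : K × K in (𝒰 : Filter (K × K)),
      (chartAt (Euc k) (1 : G) (τ p), p.1) ∈ Ψ.source := by
    have hc : Tendsto (fun p => chartAt (Euc k) (1 : G) (τ p)) (𝒰 : Filter (K × K)) (𝓝 a₀) :=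
      ((chartAt (Euc k) (1 : G)).continuousAt (mem_chart_source _ (1 : G))).tendsto.comp hg1
    exact (hc.prodMk_nhds hfst).eventually_mem (Ψ.open_source.mem_nhds h.mem_source)
  obtain ⟨p, hp1, hp2, hp3, hp4⟩ := (h2.and (hsrc.and ((hg1.eventually_mem
    ((chartAt (Euc k) (1 : G)).open_source.mem_nhds (mem_chart_source _ (1 : G)))).and
    (hsnd.eventually hev)))).exists
  have h5 : Ψ (chartAt (Euc k) (1 : G) (τ p), p.1) = Ψ (a₀, p.2) := by
    rw [h.apply_one hp4, ← (hτ p hp1).1, h.apply_eq _ hp2]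
    simp only
    rw [(chartAt (Euc k) (1 : G)).left_inv hp3]
  exact (hτ p hp1).2 (congrArg Prod.snd (Ψ.injOn hp2 hp4 h5))

variable (G) in
/-- A flow box `Ψ` adapted to a chart `e` of the orbit space: in these coordinates the orbit
projection is the projection to the second factor. -/
structure IsQuotientChart (x : M) (ψ : K → M) (Ψ : OpenPartialHomeomorph (Euc k × K) M)
    (e : OpenPartialHomeomorph (MulAction.orbitRel.Quotient G M) K) : Prop where
  isFlowBox : IsFlowBox (n := n) (k := k) G x ψ Ψ
  mem_source : (Quotient.mk _ x : MulAction.orbitRel.Quotient G M) ∈ e.source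
  snd_mem : ∀ p ∈ Ψ.source, p.2 ∈ e.target
  mem_of_mem_target : ∀ s ∈ e.target, (chartAt (Euc k) (1 : G) 1, s) ∈ Ψ.source
  symm_apply : ∀ s ∈ e.target, e.symm s = Quotient.mk _ (ψ s)

theorem quotient_smul (g : G) (y : M) : (Quotient.mk _ (g • y) : MulAction.orbitRel.Quotient G M) =
    Quotient.mk _ y := Quotient.sound ⟨g, rfl⟩

theorem IsQuotientChart.mk_apply {x : M} {ψ : K → M} {Ψ : OpenPartialHomeomorph (Euc k × K) M}
    {e : OpenPartialHomeomorph (MulAction.orbitRel.Quotient G M) K}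
    (h : IsQuotientChart (n := n) (k := k) G x ψ Ψ e) {p : Euc k × K} (hp : p ∈ Ψ.source) :
    (Quotient.mk _ (Ψ p) : MulAction.orbitRel.Quotient G M) = e.symm p.2 := by
  rw [h.symm_apply _ (h.snd_mem p hp), h.isFlowBox.apply_eq p hp, quotient_smul]

theorem IsQuotientChart.apply_mk {x : M} {ψ : K → M} {Ψ : OpenPartialHomeomorph (Euc k × K) M}
    {e : OpenPartialHomeomorph (MulAction.orbitRel.Quotient G M) K}
    (h : IsQuotientChart (n := n) (k := k) G x ψ Ψ e) {p : Euc k × K} (hp : p ∈ Ψ.source) :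
    e (Quotient.mk _ (Ψ p)) = p.2 := by
  rw [h.mk_apply hp, e.right_inv (h.snd_mem p hp)]

/-- The transversal of a small flow box is mapped homeomorphically to an open set of orbits; the
inverse of this map is the chart. -/
theorem exists_isQuotientChart [ProperSMul G M] (hdim : k + Module.finrank ℝ K = n) (x : M)
    (hinj : Function.Injective (infinitesimalAction (n := n) (k := k) G x))
    (hfree : ∀ g : G, g • x = x → g = 1) :
    ∃ (ψ : K → M) (Ψ : OpenPartialHomeomorph (Euc k × K) M)
      (e : OpenPartialHomeomorph (MulAction.orbitRel.Quotient G M) K),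
      IsQuotientChart (n := n) (k := k) G x ψ Ψ e := by
  obtain ⟨ψ, Ψ, h⟩ := exists_isFlowBox (G := G) (K := K) hdim x hinj
  set a₀ := chartAt (Euc k) (1 : G) 1 with ha₀
  have hev : ∀ᶠ s in 𝓝 (0 : K), (a₀, s) ∈ Ψ.source :=
    (Ψ.open_source.preimage (Continuous.prodMk_right a₀)).mem_nhds h.mem_source
  have h1 := h.eventually_eq_of_smul_eq hfree
  obtain ⟨t, ht, htp⟩ := eventually_prod_self_iff'.1 (by rwa [nhds_prod_eq] at h1)
  obtain ⟨B, hB, hBo, h0B⟩ := eventually_nhds_iff.1 (hev.and ht)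
  have hpi : ∀ s ∈ t, ∀ s' ∈ t, ∀ g : G, g • ψ s = ψ s' → s = s' :=
    fun s hs s' hs' => htp s hs s' hs'
  let f : K → MulAction.orbitRel.Quotient G M := fun s => Quotient.mk _ (ψ s)
  have hinjB : InjOn f B := by
    intro s hs s' hs' hss
    obtain ⟨g, hg⟩ := Quotient.exact hss
    exact (hpi _ (hB s' hs').2 _ (hB s hs).2 g hg).symm
  have hfc : ContinuousOn f B := by
    have h2 : ContinuousOn (fun s => Ψ (a₀, s)) B :=
      Ψ.continuousOn.comp (Continuous.prodMk_right a₀).continuousOn fun s hs => (hB s hs).1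
    have h3 : ContinuousOn ψ B := h2.congr fun s hs => (h.apply_one (hB s hs).1).symm
    exact continuous_quot_mk.comp_continuousOn h3
  have hfo : IsOpenMap (B.domRestrict f) := by
    intro U hU
    have hV : IsOpen (Subtype.val '' U : Set K) := hBo.isOpenMap_subtype_val U hU
    have hVB : (Subtype.val '' U : Set K) ⊆ B := by rintro _ ⟨s, -, rfl⟩; exact s.2
    have h4 : B.domRestrict f '' U = (Quotient.mk _ : M → MulAction.orbitRel.Quotient G M) ''
        (Ψ '' (Ψ.source ∩ Prod.snd ⁻¹' (Subtype.val '' U : Set K))) := by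
      ext q
      constructor
      · rintro ⟨s, hs, rfl⟩
        exact ⟨_, ⟨(a₀, s.1), ⟨(hB _ s.2).1, ⟨s, hs, rfl⟩⟩, h.apply_one (hB _ s.2).1⟩, rfl⟩
      · rintro ⟨_, ⟨p, ⟨hp1, s, hs, hsp⟩, rfl⟩, rfl⟩
        refine ⟨s, hs, ?_⟩
        rw [h.apply_eq p hp1, quotient_smul, ← hsp]
        rfl
    rw [h4]
    exact isOpenMap_quotient_mk'_mul _ (Ψ.isOpen_image_of_subset_source
      (Ψ.open_source.inter (hV.preimage continuous_snd)) inter_subset_left)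
  let e := OpenPartialHomeomorph.ofContinuousOpenRestrict (hinjB.toPartialEquiv f B) hfc hfo hBo
  have hBs : IsOpen (univ ×ˢ B : Set (Euc k × K)) := isOpen_univ.prod hBo
  refine ⟨ψ, Ψ.restrOpen _ hBs, e.symm, ⟨?_, ?_, ?_, ?_, h.apply_zero⟩,
    ?_, ?_, ?_, ?_⟩
  · exact h.isDiffeo.restr hBs
  · exact ⟨h.mem_source, mem_univ _, h0B⟩
  · exact fun p hp => h.fst_mem p hp.1
  · exact fun p hp => h.apply_eq p hp.1
  · exact ⟨0, h0B, congrArg _ h.apply_zero⟩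
  · exact fun p hp => hp.2.2
  · exact fun s hs => ⟨(hB s hs).1, mem_univ _, hs⟩
  · exact fun s hs => rfl

/-- The orbit space of a free and proper action is a manifold, and the projection to it is a
submersion. -/
theorem exists_chartedSpace_quotient {d : ℕ} [ProperSMul G M] (hdim : Nonempty M → k + d = n)
    (hinj : ∀ x : M, Function.Injective (infinitesimalAction (n := n) (k := k) G x))
    (hfree : ∀ (g : G) (x : M), g • x = x → g = 1) :
    ∃ _ : ChartedSpace (Euc d) (MulAction.orbitRel.Quotient G M),
      IsManifold (𝓡 d) ∞ (MulAction.orbitRel.Quotient G M) ∧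
      IsSubmersion (𝓡 n) (𝓡 d) ∞ (Quotient.mk _ : M → MulAction.orbitRel.Quotient G M) := by
  have hdim' : ∀ _ : M, k + Module.finrank ℝ (Euc d) = n := fun x => by simpa using hdim ⟨x⟩
  choose ψ Ψ e he using fun x : M =>
    exists_isQuotientChart (G := G) (K := Euc d) (hdim' x) x (hinj x) fun g => hfree g x
  let cs : ChartedSpace (Euc d) (MulAction.orbitRel.Quotient G M) :=
    { atlas := range e
      chartAt := fun q => e q.out
      mem_chart_source := fun q => by
        have := (he q.out).mem_source
        rwa [Quotient.out_eq] at this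
      chart_mem_atlas := fun q => mem_range_self _ }
  have hman : IsManifold (𝓡 d) ∞ (MulAction.orbitRel.Quotient G M) := by
    refine isManifold_of_contDiffOn _ _ _ ?_
    rintro _ _ ⟨x, rfl⟩ ⟨y, rfl⟩
    simp only [modelWithCornersSelf_coe, modelWithCornersSelf_coe_symm, Function.id_comp,
      Function.comp_id, preimage_id, range_id, inter_univ]
    rintro s₀ ⟨hs1, hs2⟩
    refine ContDiffAt.contDiffWithinAt ?_
    have hx := he x
    have hy := he y
    set a₀ := chartAt (Euc k) (1 : G) 1 with ha₀
    have hs1' : s₀ ∈ (e x).target := hs1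
    have hs2' : (e x).symm s₀ ∈ (e y).source := hs2
    have hs3 := (e y).map_source hs2'
    -- an element of the group carries one transversal to the other
    obtain ⟨g, hg⟩ : ∃ g : G, g • ψ x s₀ = ψ y (e y ((e x).symm s₀)) := by
      have h1 := hy.symm_apply _ hs3
      exact Quotient.exact (h1.symm.trans (((e y).left_inv hs2').trans (hx.symm_apply _ hs1')))
    let F : Euc d → M := fun s => g • Ψ x (a₀, s)
    have hF0 : F s₀ = Ψ y (a₀, e y ((e x).symm s₀)) := by
      rw [hy.isFlowBox.apply_one (hy.mem_of_mem_target _ hs3), ← hg,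
        ← hx.isFlowBox.apply_one (hx.mem_of_mem_target _ hs1')]
    have hF0t : F s₀ ∈ (Ψ y).target := by
      rw [hF0]; exact (Ψ y).map_source (hy.mem_of_mem_target _ hs3)
    have hF : ContMDiffAt (𝓡 d) (𝓡 n) ∞ F s₀ := by
      have h1 : ContMDiffAt (𝓡 d) 𝓘(ℝ, Euc k × Euc d) ∞ (fun s : Euc d => (a₀, s)) s₀ :=
        (contDiff_const.prodMk contDiff_id).contMDiff.contMDiffAt
      have h2 := hx.isFlowBox.isDiffeo.contMDiffAt (hx.mem_of_mem_target _ hs1')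
      exact (ContMDiffSMul.contMDiff_const_smul (I := 𝓡 k) (I' := 𝓡 n) (n := ∞) (M := M)
        g).contMDiffAt.comp s₀ (h2.comp s₀ h1)
    have hH : ContMDiffAt (𝓡 d) 𝓘(ℝ, Euc k × Euc d) ∞ (fun s => (Ψ y).symm (F s)) s₀ :=
      (hy.isFlowBox.isDiffeo.contMDiffAt_symm hF0t).comp s₀ hF
    refine (contDiff_snd.contDiffAt.comp s₀ hH.contDiffAt).congr_of_eventuallyEq ?_
    filter_upwards [hF.continuousAt.eventually_mem ((Ψ y).open_target.mem_nhds hF0t),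
      (e x).open_target.mem_nhds hs1'] with s hs hsx
    have h1 := hy.apply_mk ((Ψ y).map_target hs)
    rw [(Ψ y).right_inv hs, quotient_smul,
      hx.mk_apply (hx.mem_of_mem_target _ hsx)] at h1
    exact h1
  refine ⟨cs, hman, IsSubmersionOfComplement.isSubmersion (F := Euc k) fun x => ?_⟩
  let L : (Euc k × Euc d) ≃L[ℝ] Euc n := ContinuousLinearEquiv.ofFinrankEq (by simpa using hdim ⟨x⟩)
  have hb := (he x).isFlowBox
  refine IsSubmersionAtOfComplement.mk_of_charts
    (L.symm.trans (ContinuousLinearEquiv.prodComm ℝ (Euc k) (Euc d)))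
    ((Ψ x).symm.trans L.toHomeomorph.toOpenPartialHomeomorph) (e x) ?_ (he x).mem_source
    (hb.isDiffeo.symm.trans (isDiffeo_of_continuousLinearEquiv L)).mem_maximalAtlas
    (IsManifold.subset_maximalAtlas (mem_range_self x)) ?_ ?_
  · refine ⟨?_, mem_univ _⟩
    have := (Ψ x).map_source hb.mem_source
    rwa [hb.apply_base] at this
  · rintro y ⟨hy, -⟩
    have h1 := (Ψ x).map_target hy
    have h2 := (he x).mk_apply h1
    rw [(Ψ x).right_inv hy] at h2
    rw [mem_preimage, h2]
    exact (e x).map_target ((he x).snd_mem _ h1)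
  · intro z hz
    have hz' : L.symm z ∈ (Ψ x).source := by simpa using hz
    exact (he x).apply_mk hz'

end Quotient

/-! ### The reduction locus -/

section Locus

variable {m k : ℕ} {M : Type*} [TopologicalSpace M] [ChartedSpace (Euc m) M]
  [IsManifold (𝓡 m) ∞ M]
  {G : Type*} [TopologicalSpace G] [ChartedSpace (Euc k) G] [Group G] [LieGroup (𝓡 k) ∞ G]
  [MulAction G M] [ContMDiffSMul (𝓡 k) (𝓡 m) ∞ G M]
  {C : SubspaceField m M} {hG : Preserves G C}

/-- The field `C` is, on the open set `U`, the kernel of the smooth 1-form `α`, which has no zeros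
there. -/
structure IsDefiningForm {n : ℕ} {N : Type*} [TopologicalSpace N] [ChartedSpace (Euc n) N]
    [IsManifold (𝓡 n) ∞ N] (C : SubspaceField n N) (U : Set N) (α : OneForm (Euc n) N) : Prop where
  isOpen : IsOpen U
  smoothOn : SmoothFormOn α U
  spec : ∀ y ∈ U, α y ≠ 0 ∧ ∀ v, v ∈ C y ↔ α y v = 0

theorem IsHyperplaneField.exists_isDefiningForm (hC : IsHyperplaneField C) (x : M) :
    ∃ U α, IsDefiningForm C U α ∧ x ∈ U := by
  obtain ⟨U, hU, hx, α, hα, h⟩ := hC x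
  exact ⟨U, α, ⟨hU, hα, h⟩, hx⟩

variable {U : Set M} {α : OneForm (Euc m) M}

theorem momentum_eq_zero_iff (hα : IsDefiningForm C U α) {y : M} (hy : y ∈ U) :
    y ∈ reductionLocus k G C hG ↔ momentum (k := k) G α y = 0 := by
  constructor
  · exact fun h => ContinuousLinearMap.ext fun ξ => ((hα.spec y hy).2 _).1 (h ξ)
  · exact fun h ξ => ((hα.spec y hy).2 _).2 (congrArg (fun T : Euc k →L[ℝ] ℝ => T ξ) h)

theorem dMomentum_infinitesimalAction (hα : IsDefiningForm C U α) {x : M} (hx : x ∈ U)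
    (hxg : x ∈ reductionLocus k G C hG) (ξ : Euc k) :
    dMomentum (k := k) G α x (infinitesimalAction (n := m) (k := k) G x ξ : Euc m) = 0 := by
  have horb := contMDiff_smul_const (n := m) (k := k) (G := G) x
  have h1 : MDifferentiableAt (𝓡 m) 𝓘(ℝ, Euc k →L[ℝ] ℝ) (momentum (k := k) G α) x :=
    ((contMDiffOn_momentum hα.isOpen hα.smoothOn).contMDiffAt
      (hα.isOpen.mem_nhds hx)).mdifferentiableAt (by simp)
  have h2 := mfderiv_comp_apply_of_eq (I := 𝓡 k) (1 : G) (y := x) h1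
    (horb.mdifferentiable (by simp) (1 : G)) (one_smul G x) ξ
  have h3 : (momentum (k := k) G α ∘ fun g : G => g • x) =ᶠ[𝓝 1] fun _ => 0 := by
    filter_upwards [horb.continuous.continuousAt.eventually_mem
      (hα.isOpen.mem_nhds (by rwa [one_smul]))] with g hg
    exact (momentum_eq_zero_iff (hG := hG) hα hg).1 ((reductionLocus k G C hG).smul_mem g hxg)
  rw [h3.mfderiv_eq, mfderiv_const] at h2
  exact h2.symm

/-- At a point of the reduction locus, the differentials of `α` and of its momentum map satisfy the
hypotheses of the linear model. -/
theorem linearReduction_of_mem (hC : IsContact C) (hfree : IsLocallyFree G M)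
    (hα : IsDefiningForm C U α) {x : M} (hx : x ∈ U)
    (hxg : x ∈ reductionLocus k G C hG) :
    LinearReduction (α x : Euc m →L[ℝ] ℝ) (dForm α x)
      (infinitesimalAction (n := m) (k := k) G x : Euc k →L[ℝ] Euc m)
      (dMomentum (k := k) G α x) where
  ne_zero := (hα.spec x hx).1
  nondegenerate u hu h := by
    refine hC.2 x u ?_
    rw [characteristicDirections_eq hα.isOpen hα.smoothOn hα.spec hx]
    exact ⟨((hα.spec x hx).2 u).2 hu, fun v hv => h v (((hα.spec x hx).2 v).1 hv)⟩
  injective := infinitesimalAction_injective (hfree x)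
  isotropic ξ := ((hα.spec x hx).2 _).1 (hxg ξ)
  contract ξ w hw := dForm_infinitesimalAction hG hα.isOpen hα.smoothOn
    (fun y hy => (hα.spec y hy).2) hx ξ (((hα.spec x hx).2 w).2 hw)
  invariant := dMomentum_infinitesimalAction (hG := hG) hα hx hxg

theorem two_mul_add_one_le_of_mem (hC : IsContact C) (hfree : IsLocallyFree G M) {x : M}
    (hxg : x ∈ reductionLocus k G C hG) : 2 * k + 1 ≤ m := by
  obtain ⟨U, α, hα, hx⟩ := hC.1.exists_isDefiningForm x
  simpa using (linearReduction_of_mem hC hfree hα hx hxg).finrank_le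

theorem finrank_dual_euc (k : ℕ) : Module.finrank ℝ (Euc k →L[ℝ] ℝ) = k := by
  rw [← (LinearMap.toContinuousLinearMap (E := Euc k) (F' := ℝ) (𝕜 := ℝ)).finrank_eq]
  exact Subspace.dual_finrank_eq.trans (by simp)

theorem hasSliceChart_reductionLocus (hC : IsContact C) (hfree : IsLocallyFree G M) {x : M}
    (hxg : x ∈ reductionLocus k G C hG) :
    HasSliceChart (Euc m) (Euc (m - k)) (Euc k →L[ℝ] ℝ) (reductionLocus k G C hG : Set M) x := by
  obtain ⟨U, α, hα, hx⟩ := hC.1.exists_isDefiningForm x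
  refine hasSliceChart_of_zeroSet hα.isOpen hx (contMDiffOn_momentum hα.isOpen hα.smoothOn)
    (linearReduction_of_mem hC hfree hα hx hxg).surjective
    (fun y hy => momentum_eq_zero_iff (hG := hG) hα hy) ?_
  have := two_mul_add_one_le_of_mem hC hfree hxg
  rw [finrank_dual_euc]
  simp
  omega

theorem exists_chartedSpace_reductionLocus (hC : IsContact C) (hfree : IsLocallyFree G M) :
    ∃ _ : ChartedSpace (Euc (m - k)) (reductionLocus k G C hG),
      IsManifold (𝓡 (m - k)) ∞ (reductionLocus k G C hG) ∧
      IsSmoothEmbedding (𝓡 (m - k)) (𝓡 m) ∞ (reductionIncl k G C hG) := by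
  refine exists_chartedSpace_of_hasSliceChart (K := Euc k →L[ℝ] ℝ) IsEmbedding.subtypeVal
    fun x => ?_
  rw [Subtype.range_coe]
  exact hasSliceChart_reductionLocus hC hfree x.2

variable [ChartedSpace (Euc (m - k)) (reductionLocus k G C hG)]
  [IsManifold (𝓡 (m - k)) ∞ (reductionLocus k G C hG)]

theorem contMDiffSMul_reductionLocus
    (hemb : IsSmoothEmbedding (𝓡 (m - k)) (𝓡 m) ∞ (reductionIncl k G C hG)) :
    ContMDiffSMul (𝓡 k) (𝓡 (m - k)) ∞ G (reductionLocus k G C hG) := by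
  constructor
  have hi := hemb.contMDiff
  have h1 : ContMDiff ((𝓡 k).prod (𝓡 (m - k))) (𝓡 m) ∞
      (fun p : G × reductionLocus k G C hG => p.1 • reductionIncl k G C hG p.2) :=
    contMDiff_fst.smul (hi.comp contMDiff_snd)
  rw [ContMDiff.iff_comp_isImmersion hemb.isImmersion]
  exact ⟨hemb.isEmbedding.continuous_iff.2 h1.continuous, h1⟩

theorem mfderiv_incl_infinitesimalAction
    (hemb : IsSmoothEmbedding (𝓡 (m - k)) (𝓡 m) ∞ (reductionIncl k G C hG))
    (x : reductionLocus k G C hG) (ξ : Euc k) :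
    (mfderiv (𝓡 (m - k)) (𝓡 m) (reductionIncl k G C hG) x
      (infinitesimalAction (n := m - k) (k := k) G x ξ) : Euc m) =
      infinitesimalAction (n := m) (k := k) G x.1 ξ := by
  have := contMDiffSMul_reductionLocus hemb
  have h1 := mfderiv_comp_apply_of_eq (I := 𝓡 k) (1 : G) (y := x)
    (hemb.contMDiff.mdifferentiable (by simp) x)
    ((contMDiff_smul_const (n := m - k) (k := k) (G := G) x).mdifferentiable (by simp) (1 : G))
    (one_smul G x) ξ
  exact h1.symm

theorem mfderiv_incl_injective
    (hemb : IsSmoothEmbedding (𝓡 (m - k)) (𝓡 m) ∞ (reductionIncl k G C hG))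
    (x : reductionLocus k G C hG) :
    Function.Injective (mfderiv (𝓡 (m - k)) (𝓡 m) (reductionIncl k G C hG) x) :=
  mfderiv_injective_of_isImmersionAt (hemb.isImmersion.isImmersionAt x)

theorem infinitesimalAction_reductionLocus_injective (hfree : IsLocallyFree G M)
    (hemb : IsSmoothEmbedding (𝓡 (m - k)) (𝓡 m) ∞ (reductionIncl k G C hG))
    (x : reductionLocus k G C hG) :
    Function.Injective (infinitesimalAction (n := m - k) (k := k) G x) := by
  intro ξ η h
  refine infinitesimalAction_injective (n := m) (hfree x.1) ?_
  have h1 := congrArg (mfderiv (𝓡 (m - k)) (𝓡 m) (reductionIncl k G C hG) x) h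
  exact (mfderiv_incl_infinitesimalAction hemb x ξ).symm.trans
    (h1.trans (mfderiv_incl_infinitesimalAction hemb x η))

theorem dMomentum_mfderiv_incl (hα : IsDefiningForm C U α)
    (hemb : IsSmoothEmbedding (𝓡 (m - k)) (𝓡 m) ∞ (reductionIncl k G C hG))
    {x : reductionLocus k G C hG} (hx : x.1 ∈ U) (w : Euc (m - k)) :
    dMomentum (k := k) G α x.1
      (mfderiv (𝓡 (m - k)) (𝓡 m) (reductionIncl k G C hG) x w : Euc m) = 0 := by
  have h1 : MDifferentiableAt (𝓡 m) 𝓘(ℝ, Euc k →L[ℝ] ℝ) (momentum (k := k) G α) x.1 :=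
    ((contMDiffOn_momentum hα.isOpen hα.smoothOn).contMDiffAt
      (hα.isOpen.mem_nhds hx)).mdifferentiableAt (by simp)
  have h2 := mfderiv_comp_apply_of_eq (I := 𝓡 (m - k)) x (y := x.1) h1
    (hemb.contMDiff.mdifferentiable (by simp) x) rfl w
  have h3 : momentum (k := k) G α ∘ reductionIncl k G C hG =ᶠ[𝓝 x] fun _ => 0 := by
    filter_upwards [hemb.contMDiff.continuous.continuousAt.eventually_mem
      (hα.isOpen.mem_nhds hx)] with y hy
    exact (momentum_eq_zero_iff (hG := hG) hα hy).1 y.2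
  rw [h3.mfderiv_eq, mfderiv_const] at h2
  exact h2.symm

/-- The tangent space of the reduction locus is the kernel of the differential of the momentum. -/
theorem exists_mfderiv_incl_eq_iff (hC : IsContact C) (hfree : IsLocallyFree G M)
    (hα : IsDefiningForm C U α)
    (hemb : IsSmoothEmbedding (𝓡 (m - k)) (𝓡 m) ∞ (reductionIncl k G C hG))
    {x : reductionLocus k G C hG} (hx : x.1 ∈ U) (v : Euc m) :
    dMomentum (k := k) G α x.1 v = 0 ↔
      ∃ w : Euc (m - k), (mfderiv (𝓡 (m - k)) (𝓡 m) (reductionIncl k G C hG) x w : Euc m) = v := by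
  constructor
  · intro hv
    let A : Euc (m - k) →L[ℝ] Euc m := mfderiv (𝓡 (m - k)) (𝓡 m) (reductionIncl k G C hG) x
    have hle : LinearMap.range A.toLinearMap ≤
        LinearMap.ker (dMomentum (k := k) G α x.1).toLinearMap := by
      rintro _ ⟨w, rfl⟩
      exact dMomentum_mfderiv_incl hα hemb hx w
    have hL := linearReduction_of_mem hC hfree hα hx x.2
    have h1 := LinearMap.finrank_range_add_finrank_ker (dMomentum (k := k) G α x.1).toLinearMap
    rw [LinearMap.range_eq_top.2 hL.surjective, finrank_top, finrank_dual_euc] at h1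
    have heq : LinearMap.range A.toLinearMap =
        LinearMap.ker (dMomentum (k := k) G α x.1).toLinearMap := by
      refine Submodule.eq_of_le_of_finrank_le hle ?_
      rw [LinearMap.finrank_range_of_inj (f := A.toLinearMap) (mfderiv_incl_injective hemb x)]
      simp at h1 ⊢
      omega
    have : v ∈ LinearMap.range A.toLinearMap := by rw [heq]; exact hv
    exact this
  · rintro ⟨w, rfl⟩
    exact dMomentum_mfderiv_incl hα hemb hx w

theorem exists_mfderiv_incl_not_mem (hC : IsContact C) (hfree : IsLocallyFree G M)
    (hemb : IsSmoothEmbedding (𝓡 (m - k)) (𝓡 m) ∞ (reductionIncl k G C hG))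
    (x : reductionLocus k G C hG) : ∃ v : TangentSpace (𝓡 (m - k)) x,
      mfderiv (𝓡 (m - k)) (𝓡 m) (reductionIncl k G C hG) x v ∉ C x.1 := by
  obtain ⟨U, α, hα, hx⟩ := hC.1.exists_isDefiningForm x.1
  obtain ⟨v, hv, hv'⟩ := (linearReduction_of_mem hC hfree hα hx x.2).exists_ker_not
  obtain ⟨w, hw⟩ := (exists_mfderiv_incl_eq_iff hC hfree hα hemb hx v).1 hv
  refine ⟨w, fun h => hv' ?_⟩
  rw [← hw]
  exact ((hα.spec _ hx).2 _).1 h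

theorem isDefiningForm_pullback (hC : IsContact C) (hfree : IsLocallyFree G M)
    (hα : IsDefiningForm C U α)
    (hemb : IsSmoothEmbedding (𝓡 (m - k)) (𝓡 m) ∞ (reductionIncl k G C hG)) :
    IsDefiningForm (pullback (m - k) (reductionIncl k G C hG) C)
      (reductionIncl k G C hG ⁻¹' U) (pullForm (E := Euc (m - k)) (reductionIncl k G C hG) α) where
  isOpen := hα.isOpen.preimage hemb.contMDiff.continuous
  smoothOn := hα.smoothOn.pullForm (hα.isOpen.preimage hemb.contMDiff.continuous)
    hemb.contMDiff.contMDiffOn fun _ h => h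
  spec y hy := by
    refine ⟨fun h0 => ?_, fun v => (hα.spec _ hy).2 _⟩
    obtain ⟨v, hv⟩ := exists_mfderiv_incl_not_mem hC hfree hemb y
    exact hv (((hα.spec _ hy).2 _).2 (congrArg (fun T : Euc (m - k) →L[ℝ] ℝ => T v) h0))

theorem isHyperplaneField_pullback_incl (hC : IsContact C) (hfree : IsLocallyFree G M)
    (hemb : IsSmoothEmbedding (𝓡 (m - k)) (𝓡 m) ∞ (reductionIncl k G C hG)) :
    IsHyperplaneField (pullback (m - k) (reductionIncl k G C hG) C) := by
  intro x
  obtain ⟨U, α, hα, hx⟩ := hC.1.exists_isDefiningForm x.1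
  have h := isDefiningForm_pullback (k := k) (G := G) hC hfree hα hemb
  exact ⟨_, h.isOpen, hx, _, h.smoothOn, h.spec⟩

/-- The characteristic directions of the field on the reduction locus are the directions of the
orbits. -/
theorem characteristicDirections_pullback_incl (hC : IsContact C) (hfree : IsLocallyFree G M)
    (hemb : IsSmoothEmbedding (𝓡 (m - k)) (𝓡 m) ∞ (reductionIncl k G C hG))
    (x : reductionLocus k G C hG) :
    characteristicDirections (pullback (m - k) (reductionIncl k G C hG) C) x =
      Set.range (infinitesimalAction (n := m - k) (k := k) G x) := by
  obtain ⟨U, α, hα, hx⟩ := hC.1.exists_isDefiningForm x.1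
  have h := isDefiningForm_pullback (k := k) (G := G) hC hfree hα hemb
  have hL := linearReduction_of_mem hC hfree hα hx x.2
  rw [characteristicDirections_eq h.isOpen h.smoothOn h.spec hx]
  have hd : ∀ u v : Euc (m - k),
      dForm (pullForm (E := Euc (m - k)) (reductionIncl k G C hG) α) x u v =
      dForm α x.1 (mfderiv (𝓡 (m - k)) (𝓡 m) (reductionIncl k G C hG) x u : Euc m)
        (mfderiv (𝓡 (m - k)) (𝓡 m) (reductionIncl k G C hG) x v : Euc m) := fun u v =>
    dForm_pullForm hα.isOpen hα.smoothOn isOpen_univ hemb.contMDiff.contMDiffOn (mem_univ x) hx u v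
  ext u
  constructor
  · rintro ⟨hu, huv⟩
    obtain ⟨ξ, hξ⟩ := hL.characteristic_iff.1 ⟨dMomentum_mfderiv_incl hα hemb hx u,
      ((hα.spec _ hx).2 _).1 hu, fun v hv hv' => by
        obtain ⟨w, rfl⟩ := (exists_mfderiv_incl_eq_iff hC hfree hα hemb hx v).1 hv
        refine (hd u w).symm.trans (huv w ?_)
        exact ((hα.spec _ hx).2 _).2 hv'⟩
    refine ⟨ξ, mfderiv_incl_injective hemb x ?_⟩
    exact (mfderiv_incl_infinitesimalAction hemb x ξ).trans hξ
  · rintro ⟨ξ, rfl⟩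
    obtain ⟨h1, h2, h3⟩ := hL.characteristic_iff.2
      ⟨ξ, (mfderiv_incl_infinitesimalAction hemb x ξ).symm⟩
    refine ⟨((hα.spec _ hx).2 _).2 h2, fun v hv => (hd _ v).trans (h3 _ ?_ ?_)⟩
    · exact dMomentum_mfderiv_incl hα hemb hx v
    · exact ((hα.spec _ hx).2 _).1 hv

end Locus

/-! ### Submanifolds and submersions -/

section Slices

variable {E : Type*} [NormedAddCommGroup E] [NormedSpace ℝ E] [FiniteDimensional ℝ E]
  {E' : Type*} [NormedAddCommGroup E'] [NormedSpace ℝ E'] [FiniteDimensional ℝ E']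
  {F : Type*} [NormedAddCommGroup F] [NormedSpace ℝ F] [FiniteDimensional ℝ F]
  {F' : Type*} [NormedAddCommGroup F'] [NormedSpace ℝ F'] [FiniteDimensional ℝ F']
  {K : Type*} [NormedAddCommGroup K] [NormedSpace ℝ K] [FiniteDimensional ℝ K]
  {N : Type*} [TopologicalSpace N] [ChartedSpace E N] [IsManifold 𝓘(ℝ, E) ∞ N]
  {Q : Type*} [TopologicalSpace Q] [ChartedSpace E' Q] [IsManifold 𝓘(ℝ, E') ∞ Q]
  {p : N → Q} {x : N} {Λ : Set Q}

theorem mdifferentiableAt_snd_isDiffeo {Ψ : OpenPartialHomeomorph N (F × K)}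
    (hΨ : IsDiffeo E (F × K) Ψ) (hx : x ∈ Ψ.source) :
    MDifferentiableAt 𝓘(ℝ, E) 𝓘(ℝ, K) (fun y => (Ψ y).2) x :=
  ((ContinuousLinearMap.snd ℝ F K).mdifferentiableAt).comp x (hΨ.mdifferentiableAt hx)

theorem contMDiffOn_snd_isDiffeo {Ψ : OpenPartialHomeomorph N (F × K)}
    (hΨ : IsDiffeo E (F × K) Ψ) :
    ContMDiffOn 𝓘(ℝ, E) 𝓘(ℝ, K) ∞ (fun y => (Ψ y).2) Ψ.source :=
  (ContinuousLinearMap.snd ℝ F K).contMDiff.comp_contMDiffOn hΨ.1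

theorem mfderiv_snd_isDiffeo_surjective {Ψ : OpenPartialHomeomorph N (F × K)}
    (hΨ : IsDiffeo E (F × K) Ψ) (hx : x ∈ Ψ.source) :
    Function.Surjective (mfderiv 𝓘(ℝ, E) 𝓘(ℝ, K) (fun y => (Ψ y).2) x) := by
  intro c
  obtain ⟨v, hv⟩ := hΨ.mfderiv_surjective hx ((0, c) : F × K)
  have h1 := mfderiv_comp_apply (I := 𝓘(ℝ, E)) x
    ((ContinuousLinearMap.snd ℝ F K).mdifferentiableAt (x := Ψ x)) (hΨ.mdifferentiableAt hx) v
  rw [hv, mfderiv_eq_fderiv, ContinuousLinearMap.fderiv] at h1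
  exact ⟨v, h1⟩

/-- Preimages of submanifolds under submersions are submanifolds. -/
theorem HasSliceChart.preimage (hp : IsSubmersionAt 𝓘(ℝ, E) 𝓘(ℝ, E') ∞ p x)
    (hΛ : HasSliceChart E' F' K Λ (p x))
    (hdim : Module.finrank ℝ F + Module.finrank ℝ K = Module.finrank ℝ E) :
    HasSliceChart E F K (p ⁻¹' Λ) x := by
  obtain ⟨Ψ, h1, h2, h3⟩ := hΛ
  have hps := hp.contMDiffOn
  set O := hp.domChart.source ∩ p ⁻¹' Ψ.source
  have hO : IsOpen O := hps.continuousOn.isOpen_inter_preimage hp.domChart.open_source Ψ.open_source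
  refine hasSliceChart_of_zeroSet hO (x := x) (h := fun y => (Ψ (p y)).2)
    ⟨hp.mem_domChart_source, h1⟩ ?_ ?_ (fun y hy => h3 _ hy.2) hdim
  · exact (contMDiffOn_snd_isDiffeo h2).comp (hps.mono inter_subset_left) fun y hy => hy.2
  · intro c
    obtain ⟨w, hw⟩ := mfderiv_snd_isDiffeo_surjective h2 h1 c
    obtain ⟨v, rfl⟩ := mfderiv_surjective_of_isSubmersionAt hp w
    have h4 := mfderiv_comp_apply (I := 𝓘(ℝ, E)) x (mdifferentiableAt_snd_isDiffeo h2 h1)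
      (hp.contMDiffAt.mdifferentiableAt (by simp)) v
    exact ⟨v, h4.trans hw⟩

/-- A set whose preimage under a submersion is a submanifold is a submanifold. -/
theorem HasSliceChart.of_preimage (hp : IsSubmersionAt 𝓘(ℝ, E) 𝓘(ℝ, E') ∞ p x) (hx : p x ∈ Λ)
    (hΛ : HasSliceChart E F K (p ⁻¹' Λ) x)
    (hdim : Module.finrank ℝ F' + Module.finrank ℝ K = Module.finrank ℝ E') :
    HasSliceChart E' F' K Λ (p x) := by
  obtain ⟨Ψ, h1, h2, h3⟩ := hΛ
  obtain ⟨V, σ, hV, hxV, hσ, hσx, hpσ⟩ := exists_section_of_isSubmersionAt hp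
  have h1' : σ (p x) ∈ Ψ.source := by rwa [hσx]
  set O := V ∩ σ ⁻¹' Ψ.source
  have hO : IsOpen O := hσ.continuousOn.isOpen_inter_preimage hV Ψ.open_source
  refine hasSliceChart_of_zeroSet hO (x := p x) (h := fun q => (Ψ (σ q)).2)
    ⟨hxV, h1'⟩ ?_ ?_ (fun q hq => ?_) hdim
  · exact (contMDiffOn_snd_isDiffeo h2).comp (hσ.mono inter_subset_left) fun y hy => hy.2
  · intro c
    have hpd : MDifferentiableAt 𝓘(ℝ, E) 𝓘(ℝ, E') p x := hp.contMDiffAt.mdifferentiableAt (by simp)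
    have hσd : MDifferentiableAt 𝓘(ℝ, E') 𝓘(ℝ, E) σ (p x) :=
      (hσ.contMDiffAt (hV.mem_nhds hxV)).mdifferentiableAt (by simp)
    let D : E →L[ℝ] K := mfderiv 𝓘(ℝ, E) 𝓘(ℝ, K) (fun y => (Ψ y).2) x
    let P : E →L[ℝ] E' := mfderiv 𝓘(ℝ, E) 𝓘(ℝ, E') p x
    let S : E' →L[ℝ] E := mfderiv 𝓘(ℝ, E') 𝓘(ℝ, E) σ (p x)
    obtain ⟨v, hv⟩ : ∃ v, D v = c := mfderiv_snd_isDiffeo_surjective h2 h1 c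
    have hPS : ∀ w, P (S w) = w := by
      intro w
      have e1 := mfderiv_comp_apply_of_eq (p x) (y := x) hpd hσd hσx w
      have e2 : p ∘ σ =ᶠ[𝓝 (p x)] id := by
        filter_upwards [hV.mem_nhds hxV] with q hq using hpσ q hq
      rw [e2.mfderiv_eq, mfderiv_id] at e1
      exact e1.symm
    -- the fibre through `x` is contained in the preimage, so `D` vanishes on the kernel of `P`
    have hD : ∀ u, P u = 0 → D u = 0 := by
      intro u hu
      obtain ⟨η, hη, hη0, hηu, hηp⟩ := exists_curve_in_fiber hp hu
      have e1 := mfderiv_comp_apply_of_eq (0 : ℝ) (y := x) (mdifferentiableAt_snd_isDiffeo h2 h1)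
        hη hη0 (1 : ℝ)
      have e2 : (fun y => (Ψ y).2) ∘ η =ᶠ[𝓝 (0 : ℝ)] fun _ => 0 := by
        filter_upwards [hηp, hη.continuousAt.eventually_mem
          (Ψ.open_source.mem_nhds (by rwa [hη0]))] with t ht hts
        refine (h3 _ hts).1 ?_
        rw [mem_preimage, ht]
        exact hx
      rw [e2.mfderiv_eq, mfderiv_const] at e1
      have e3 := congrArg D hηu
      exact e3.symm.trans e1.symm
    refine ⟨P v, ?_⟩
    have e1 := mfderiv_comp_apply_of_eq (p x) (y := x) (mdifferentiableAt_snd_isDiffeo h2 h1)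
      hσd hσx (P v)
    refine e1.trans ?_
    have e2 := hD (S (P v) - v) (by rw [map_sub, hPS, sub_self])
    rw [map_sub, sub_eq_zero] at e2
    exact e2.trans hv
  · have := h3 _ hq.2
    rwa [mem_preimage, hpσ q hq.1] at this

end Slices

/-! ### Descent of hyperplane fields along submersions -/

section Descent

variable {n d : ℕ} {N : Type*} [TopologicalSpace N] [ChartedSpace (Euc n) N]
  [IsManifold (𝓡 n) ∞ N] {Q : Type*} [TopologicalSpace Q] [ChartedSpace (Euc d) Q]
  [IsManifold (𝓡 d) ∞ Q] {p : N → Q} {C : SubspaceField n N} {C' : SubspaceField d Q}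

/-- Membership in the pulled back field, with the image point and the image vector named
separately. -/
theorem mem_iff_of_pullback_eq (h : pullback n p C' = C) {x : N} {q : Q} (hq : p x = q)
    (u : TangentSpace (𝓡 n) x) {w : Euc d} (hw : (mfderiv (𝓡 n) (𝓡 d) p x u : Euc d) = w) :
    w ∈ C' q ↔ u ∈ C x := by
  subst hq hw
  rw [← h]
  rfl

theorem mfderiv_section_apply (hp : IsSubmersion (𝓡 n) (𝓡 d) ∞ p) {V : Set Q} {σ : Q → N}
    (hV : IsOpen V) (hσ : ContMDiffOn (𝓡 d) (𝓡 n) ∞ σ V) (hpσ : ∀ q ∈ V, p (σ q) = q) {q : Q}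
    (hq : q ∈ V) (w : Euc d) :
    (mfderiv (𝓡 n) (𝓡 d) p (σ q) (mfderiv (𝓡 d) (𝓡 n) σ q w) : Euc d) = w := by
  have e1 := mfderiv_comp_apply (I := 𝓡 d) q (hp.contMDiff.mdifferentiable (by simp) (σ q))
    ((hσ.contMDiffAt (hV.mem_nhds hq)).mdifferentiableAt (by simp)) w
  have e2 : p ∘ σ =ᶠ[𝓝 q] id := by
    filter_upwards [hV.mem_nhds hq] with q hq using hpσ q hq
  rw [e2.mfderiv_eq, mfderiv_id] at e1
  exact e1.symm

/-- The pullback of a defining form along a local section defines the descended field. -/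
theorem IsDefiningForm.descend (hp : IsSubmersion (𝓡 n) (𝓡 d) ∞ p) (h : pullback n p C' = C)
    {U : Set N} {α : OneForm (Euc n) N} (hα : IsDefiningForm C U α) {V : Set Q} {σ : Q → N}
    (hV : IsOpen V) (hσ : ContMDiffOn (𝓡 d) (𝓡 n) ∞ σ V) (hpσ : ∀ q ∈ V, p (σ q) = q) :
    IsDefiningForm C' (V ∩ σ ⁻¹' U) (pullForm (E := Euc d) σ α) where
  isOpen := hσ.continuousOn.isOpen_inter_preimage hV hα.isOpen
  smoothOn := hα.smoothOn.pullForm (hσ.continuousOn.isOpen_inter_preimage hV hα.isOpen)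
    (hσ.mono inter_subset_left) fun _ h => h.2
  spec q hq := by
    have hmem : ∀ w : Euc d, w ∈ C' q ↔ pullForm (E := Euc d) σ α q w = 0 := fun w =>
      (mem_iff_of_pullback_eq h (hpσ q hq.1) (mfderiv (𝓡 d) (𝓡 n) σ q w)
        (mfderiv_section_apply hp hV hσ hpσ hq.1 w)).trans ((hα.spec _ hq.2).2 _)
    refine ⟨fun h0 => (hα.spec _ hq.2).1 ?_, hmem⟩
    refine ContinuousLinearMap.ext fun u => ?_
    have h1 : (mfderiv (𝓡 n) (𝓡 d) p (σ q) u : Euc d) ∈ C' q :=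
      (hmem _).2 (congrArg (fun T : Euc d →L[ℝ] ℝ => T _) h0)
    exact ((hα.spec _ hq.2).2 u).1 ((mem_iff_of_pullback_eq h (hpσ q hq.1) u rfl).1 h1)

/-- If the characteristic directions of a hyperplane field are the directions of the fibres of a
submersion along which the field descends, then the descended field is a contact structure. -/
theorem isContact_of_pullback_eq (hp : IsSubmersion (𝓡 n) (𝓡 d) ∞ p) (hsurj : Function.Surjective p)
    (h : pullback n p C' = C) (hC : IsHyperplaneField C)
    (hchar : ∀ (x : N) (u : Euc n), u ∈ characteristicDirections C x ↔
      (mfderiv (𝓡 n) (𝓡 d) p x u : Euc d) = 0) : IsContact C' := by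
  have key : ∀ q : Q, ∃ (V : Set Q) (σ : Q → N) (U : Set N) (α : OneForm (Euc n) N),
      IsOpen V ∧ ContMDiffOn (𝓡 d) (𝓡 n) ∞ σ V ∧ (∀ q ∈ V, p (σ q) = q) ∧ IsDefiningForm C U α ∧
      q ∈ V ∩ σ ⁻¹' U := by
    intro q
    obtain ⟨x, rfl⟩ := hsurj q
    obtain ⟨U, α, hα, hx⟩ := hC.exists_isDefiningForm x
    obtain ⟨V, σ, hV, hxV, hσ, hσx, hpσ⟩ := exists_section_of_isSubmersionAt (hp.isSubmersionAt x)
    exact ⟨V, σ, U, α, hV, hσ, hpσ, hα, hxV, by rwa [mem_preimage, hσx]⟩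
  constructor
  · intro q
    obtain ⟨V, σ, U, α, hV, hσ, hpσ, hα, hq⟩ := key q
    have h1 := hα.descend hp h hV hσ hpσ
    exact ⟨_, h1.isOpen, hq, _, h1.smoothOn, h1.spec⟩
  · intro q w hw
    obtain ⟨V, σ, U, α, hV, hσ, hpσ, hα, hq⟩ := key q
    have h1 := hα.descend hp h hV hσ hpσ
    rw [characteristicDirections_eq h1.isOpen h1.smoothOn h1.spec hq] at hw
    obtain ⟨hw1, hw2⟩ := hw
    let P : Euc n →L[ℝ] Euc d := mfderiv (𝓡 n) (𝓡 d) p (σ q)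
    let S : Euc d →L[ℝ] Euc n := mfderiv (𝓡 d) (𝓡 n) σ q
    have hPS : ∀ w, P (S w) = w := mfderiv_section_apply hp hV hσ hpσ hq.1
    have hchar' : ∀ u : Euc n, P u = 0 ↔ u ∈ C (σ q) ∧ ∀ v ∈ C (σ q), dForm α (σ q) u v = 0 := by
      intro u
      have := hchar (σ q) u
      rw [characteristicDirections_eq hα.isOpen hα.smoothOn hα.spec hq.2] at this
      exact this.symm
    have hd : ∀ w w' : Euc d, dForm (pullForm (E := Euc d) σ α) q w w' =
        dForm α (σ q) (S w) (S w') := fun w w' =>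
      dForm_pullForm hα.isOpen hα.smoothOn hV hσ hq.1 hq.2 w w'
    have hSw : (S w : Euc n) ∈ C (σ q) :=
      (mem_iff_of_pullback_eq h (hpσ q hq.1) (S w) (hPS w)).1 hw1
    -- each `v` in `C` differs from the lift of its image by a characteristic direction
    have h2 : P (S w) = 0 := by
      refine (hchar' _).2 ⟨hSw, fun (v : Euc n) hv => ?_⟩
      have h3 : P (v - S (P v)) = 0 := by rw [map_sub, hPS, sub_self]
      have h4 := ((hchar' _).1 h3).2 _ hSw
      rw [dForm_apply_swap, neg_eq_zero, map_sub, sub_eq_zero] at h4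
      rw [h4]
      exact (hd w (P v)).symm.trans (hw2 _ ((mem_iff_of_pullback_eq h (hpσ q hq.1) v rfl).2 hv))
    exact (hPS w).symm.trans h2

end Descent

/-! ### The reduced space -/

section Legendre

variable {m k d : ℕ} {M : Type*} [TopologicalSpace M] [ChartedSpace (Euc m) M]
  [IsManifold (𝓡 m) ∞ M]
  {G : Type*} [TopologicalSpace G] [ChartedSpace (Euc k) G] [Group G] [LieGroup (𝓡 k) ∞ G]
  [MulAction G M] [ContMDiffSMul (𝓡 k) (𝓡 m) ∞ G M]
  {C : SubspaceField m M} {hG : Preserves G C}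

/-- An invariant Legendre submanifold contains the orbits of its points, so that the infinitesimal
action is tangent to it, hence contained in `C`. -/
theorem subset_reductionLocus_of_isLegendre {L : Set M} (hL : IsLegendre C L)
    (hinv : ∀ (g : G), ∀ x ∈ L, g • x ∈ L) : L ⊆ (reductionLocus k G C hG : Set M) := by
  obtain ⟨l, -, cs, hman, hemb, htan⟩ := hL
  intro x hx ξ
  obtain ⟨w, hw⟩ := mfderiv_mem_range_of_eventually_mem_range hemb.contMDiff hemb.isEmbedding
    (y := (⟨x, hx⟩ : L)) (mfderiv_injective_of_isImmersionAt (hemb.isImmersion.isImmersionAt _))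
    (f := fun g : G => g • x) (x := (1 : G))
    ((contMDiff_smul_const (n := m) (k := k) x).mdifferentiable (by simp) 1) (one_smul G x)
    (Filter.Eventually.of_forall fun g => ⟨⟨g • x, hinv g x hx⟩, rfl⟩) ξ
  have h1 := htan ⟨x, hx⟩ w
  rw [hw] at h1
  exact h1

variable [ChartedSpace (Euc (m - k)) (reductionLocus k G C hG)]
  [IsManifold (𝓡 (m - k)) ∞ (reductionLocus k G C hG)]

/-- The field cut out on the reduction locus is invariant. -/
theorem mem_pullback_incl_smul
    (hemb : IsSmoothEmbedding (𝓡 (m - k)) (𝓡 m) ∞ (reductionIncl k G C hG)) (g : G)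
    (x : reductionLocus k G C hG) (u : Euc (m - k))
    (hu : u ∈ pullback (m - k) (reductionIncl k G C hG) C x) :
    (mfderiv (𝓡 (m - k)) (𝓡 (m - k)) (fun y : reductionLocus k G C hG => g • y) x u :
      Euc (m - k)) ∈ pullback (m - k) (reductionIncl k G C hG) C (g • x) := by
  have := contMDiffSMul_reductionLocus hemb
  have hsm : ContMDiff (𝓡 (m - k)) (𝓡 (m - k)) ∞ (fun y : reductionLocus k G C hG => g • y) :=
    ContMDiffSMul.contMDiff_const_smul (I := 𝓡 k) g
  have hsm' : ContMDiff (𝓡 m) (𝓡 m) ∞ (fun y : M => g • y) :=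
    ContMDiffSMul.contMDiff_const_smul (I := 𝓡 k) g
  have h1 := mfderiv_comp_apply (I := 𝓡 (m - k)) x
    (hemb.contMDiff.mdifferentiable (by simp) (g • x)) (hsm.mdifferentiable (by simp) x) u
  have h2 := mfderiv_comp_apply (I := 𝓡 (m - k)) x (g := fun y : M => g • y)
    (hsm'.mdifferentiable (by simp) x.1) (hemb.contMDiff.mdifferentiable (by simp) x) u
  change mfderiv (𝓡 (m - k)) (𝓡 m) (reductionIncl k G C hG) (g • x) _ ∈ C (g • x.1)
  have h3 := hG g x.1 _ hu
  rw [← h1]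
  exact h2 ▸ h3

variable [ChartedSpace (Euc d) (ReducedSpace k G C hG)] [IsManifold (𝓡 d) ∞ (ReducedSpace k G C hG)]

theorem reductionProj_eq_iff (x y : reductionLocus k G C hG) :
    reductionProj k G C hG x = reductionProj k G C hG y ↔ x ∈ MulAction.orbit G y :=
  Quotient.eq

theorem reductionProj_surjective : Function.Surjective (reductionProj k G C hG) :=
  Quotient.mk_surjective

variable (k G C hG d) in
/-- The field of hyperplanes on the reduced space: the image of the field on the reduction locus,
computed at a representative of each orbit. -/
noncomputable def reducedField : SubspaceField d (ReducedSpace k G C hG) := fun q =>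
  Submodule.map (mfderiv (𝓡 (m - k)) (𝓡 d) (reductionProj k G C hG) q.out :
    Euc (m - k) →L[ℝ] Euc d).toLinearMap
    (pullback (m - k) (reductionIncl k G C hG) C q.out : Submodule ℝ (Euc (m - k)))

theorem mfderiv_reductionProj_eq_zero_iff (hfree : IsLocallyFree G M)
    (hemb : IsSmoothEmbedding (𝓡 (m - k)) (𝓡 m) ∞ (reductionIncl k G C hG))
    [ProperSMul G (reductionLocus k G C hG)]
    (hp : IsSubmersion (𝓡 (m - k)) (𝓡 d) ∞ (reductionProj k G C hG))
    (x : reductionLocus k G C hG) (v : Euc (m - k)) :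
    (mfderiv (𝓡 (m - k)) (𝓡 d) (reductionProj k G C hG) x v : Euc d) = 0 ↔
      ∃ ξ : Euc k, (infinitesimalAction (n := m - k) (k := k) G x ξ : Euc (m - k)) = v := by
  have := contMDiffSMul_reductionLocus hemb
  exact mfderiv_eq_zero_iff_of_isSubmersion hp reductionProj_eq_iff
    (infinitesimalAction_reductionLocus_injective hfree hemb x) v

/-- The differential of the projection is onto, with the image of the Lie algebra as its kernel. -/
theorem dim_reducedSpace (hC : IsContact C) (hfree : IsLocallyFree G M)
    (hemb : IsSmoothEmbedding (𝓡 (m - k)) (𝓡 m) ∞ (reductionIncl k G C hG))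
    [ProperSMul G (reductionLocus k G C hG)]
    (hp : IsSubmersion (𝓡 (m - k)) (𝓡 d) ∞ (reductionProj k G C hG))
    (x : reductionLocus k G C hG) : d + 2 * k = m := by
  let P : Euc (m - k) →L[ℝ] Euc d := mfderiv (𝓡 (m - k)) (𝓡 d) (reductionProj k G C hG) x
  let A : Euc k →L[ℝ] Euc (m - k) := infinitesimalAction (n := m - k) (k := k) G x
  have h1 := LinearMap.finrank_range_add_finrank_ker P.toLinearMap
  have h2 : LinearMap.ker P.toLinearMap = LinearMap.range A.toLinearMap := by
    ext v
    exact mfderiv_reductionProj_eq_zero_iff hfree hemb hp x v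
  have hs : Function.Surjective P.toLinearMap :=
    mfderiv_surjective_of_isSubmersionAt (hp.isSubmersionAt x)
  rw [LinearMap.range_eq_top.2 hs, h2, finrank_top,
    LinearMap.finrank_range_of_inj (f := A.toLinearMap)
      (infinitesimalAction_reductionLocus_injective hfree hemb x)] at h1
  have h3 := two_mul_add_one_le_of_mem hC hfree x.2
  simp at h1
  omega

/-- The field on the reduction locus is the pullback of its image on the reduced space: it contains
the kernel of the differential of the projection and is invariant. -/
theorem pullback_reducedField (hfree : IsLocallyFree G M)
    (hemb : IsSmoothEmbedding (𝓡 (m - k)) (𝓡 m) ∞ (reductionIncl k G C hG))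
    [ProperSMul G (reductionLocus k G C hG)]
    (hp : IsSubmersion (𝓡 (m - k)) (𝓡 d) ∞ (reductionProj k G C hG)) :
    pullback (m - k) (reductionProj k G C hG) (reducedField k d G C hG) =
      pullback (m - k) (reductionIncl k G C hG) C := by
  have := contMDiffSMul_reductionLocus hemb
  -- the field at `x` contains the orbit directions and is invariant, so that its image depends on
  -- the orbit of `x` only
  have key : ∀ (x y : reductionLocus k G C hG) (u v : Euc (m - k)),
      reductionProj k G C hG x = reductionProj k G C hG y →
      (mfderiv (𝓡 (m - k)) (𝓡 d) (reductionProj k G C hG) x u : Euc d) =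
        mfderiv (𝓡 (m - k)) (𝓡 d) (reductionProj k G C hG) y v →
      u ∈ pullback (m - k) (reductionIncl k G C hG) C x →
      v ∈ pullback (m - k) (reductionIncl k G C hG) C y := by
    intro x y u v hxy huv hu
    obtain ⟨g, rfl⟩ := (reductionProj_eq_iff y x).1 hxy.symm
    have hsm : ContMDiff (𝓡 (m - k)) (𝓡 (m - k)) ∞ (fun y : reductionLocus k G C hG => g • y) :=
      ContMDiffSMul.contMDiff_const_smul (I := 𝓡 k) g
    obtain ⟨u', hu'⟩ : ∃ u' : Euc (m - k), u' =
        mfderiv (𝓡 (m - k)) (𝓡 (m - k)) (fun y : reductionLocus k G C hG => g • y) x u := ⟨_, rfl⟩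
    have h1 := mfderiv_comp_apply (I := 𝓡 (m - k)) x
      (hp.contMDiff.mdifferentiable (by simp) (g • x)) (hsm.mdifferentiable (by simp) x) u
    have h2 : reductionProj k G C hG ∘ (fun y : reductionLocus k G C hG => g • y) =
        reductionProj k G C hG := by
      funext y
      exact (reductionProj_eq_iff _ _).2 ⟨g, rfl⟩
    rw [h2] at h1
    let P : Euc (m - k) →L[ℝ] Euc d := mfderiv (𝓡 (m - k)) (𝓡 d) (reductionProj k G C hG) (g • x)
    have h3 : P (v - u') = 0 := by
      rw [map_sub, sub_eq_zero, hu']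
      exact huv.symm.trans h1
    obtain ⟨ξ, hξ⟩ := (mfderiv_reductionProj_eq_zero_iff hfree hemb hp (g • x) (v - u')).1 h3
    have h4 : (v - u' : Euc (m - k)) ∈ (pullback (m - k) (reductionIncl k G C hG) C (g • x) :
        Submodule ℝ (Euc (m - k))) := by
      rw [← hξ]
      change mfderiv (𝓡 (m - k)) (𝓡 m) (reductionIncl k G C hG) (g • x) _ ∈ C (g • x.1)
      have h5 := (g • x).2 ξ
      rw [← mfderiv_incl_infinitesimalAction hemb (g • x) ξ] at h5
      exact h5
    have h6 : u' ∈ (pullback (m - k) (reductionIncl k G C hG) C (g • x) :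
        Submodule ℝ (Euc (m - k))) := hu' ▸ mem_pullback_incl_smul hemb g x u hu
    have h7 := Submodule.add_mem _ h4 h6
    have h8 : v - u' + u' = v := sub_add_cancel v u'
    exact h8 ▸ h7
  funext x
  ext u
  have hout : reductionProj k G C hG (Quotient.out (reductionProj k G C hG x)) =
      reductionProj k G C hG x := Quotient.out_eq _
  constructor
  · rintro ⟨v, hv, hvu⟩
    exact key _ x v u hout hvu hv
  · intro hu
    obtain ⟨v, hv⟩ := mfderiv_surjective_of_isSubmersionAt
      (hp.isSubmersionAt (Quotient.out (reductionProj k G C hG x)))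
      (mfderiv (𝓡 (m - k)) (𝓡 d) (reductionProj k G C hG) x u : Euc d)
    exact ⟨v, key x _ u v hout.symm hv.symm hu, hv⟩

end Legendre

/-! ### The correspondence of Legendre submanifolds -/

section Correspondence

variable {m n d : ℕ} {M : Type*} [TopologicalSpace M] [ChartedSpace (Euc m) M]
  [IsManifold (𝓡 m) ∞ M] {N : Type*} [TopologicalSpace N] [ChartedSpace (Euc n) N]
  [IsManifold (𝓡 n) ∞ N] {Q : Type*} [TopologicalSpace Q] [ChartedSpace (Euc d) Q]
  [IsManifold (𝓡 d) ∞ Q] {i : N → M} {p : N → Q} {C : SubspaceField m M} {C' : SubspaceField d Q}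

theorem mem_field_congr {x y : M} (hxy : x = y) {v : Euc m} (h : v ∈ C x) : v ∈ C y := hxy ▸ h

/-- A smooth map with values in an embedded submanifold is smooth as a map to the submanifold. -/
theorem exists_lift {l : ℕ} {L : Type*} [TopologicalSpace L] [ChartedSpace (Euc l) L]
    [IsManifold (𝓡 l) ∞ L] (hi : IsSmoothEmbedding (𝓡 n) (𝓡 m) ∞ i) {j : L → M}
    (hj : ContMDiff (𝓡 l) (𝓡 m) ∞ j) (hr : ∀ x, ∃ y, i y = j x) :
    ∃ f : L → N, ContMDiff (𝓡 l) (𝓡 n) ∞ f ∧ ∀ x, i (f x) = j x := by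
  choose f hf using hr
  have h : i ∘ f = j := funext hf
  refine ⟨f, ?_, hf⟩
  rw [ContMDiff.iff_comp_isImmersion hi.isImmersion, hi.isEmbedding.continuous_iff, h]
  exact ⟨hj.continuous, hj⟩

/-- Let `N` be embedded in `M` by `i` and let `p` be a submersion from `N` such that the fields `C`
on `M` and `C'` on `Q` have the same pullback to `N`. Then preimages of Legendre submanifolds of
`Q` are Legendre submanifolds of `M`, if the dimensions match. -/
theorem isLegendre_image_preimage (hi : IsSmoothEmbedding (𝓡 n) (𝓡 m) ∞ i)
    (hp : IsSubmersion (𝓡 n) (𝓡 d) ∞ p) (h : pullback n p C' = pullback n i C)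
    {k : ℕ} (hm : d + 2 * k = m) (hn : d + k = n) {Λ : Set Q} (hΛ : IsLegendre C' Λ) :
    IsLegendre C (i '' (p ⁻¹' Λ)) := by
  obtain ⟨l, hl, csΛ, hmanΛ, hembΛ, htan⟩ := hΛ
  have hsP : ∀ x : p ⁻¹' Λ, HasSliceChart (Euc n) (Euc (l + k)) (Euc (d - l))
      (range (Subtype.val : p ⁻¹' Λ → N)) x.1 := by
    intro x
    rw [Subtype.range_coe]
    refine HasSliceChart.preimage (F' := Euc l) (hp.isSubmersionAt x.1) ?_ ?_
    · have h1 := hasSliceChart_range (K := Euc (d - l)) hembΛ.contMDiff hembΛ.isEmbedding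
        (⟨p x.1, x.2⟩ : Λ) (mfderiv_injective_of_isImmersionAt (hembΛ.isImmersion.isImmersionAt _))
        (by simp; omega)
      rwa [Subtype.range_coe] at h1
    · simp; omega
  obtain ⟨csP, hmanP, hembP⟩ := exists_chartedSpace_of_hasSliceChart IsEmbedding.subtypeVal hsP
  have hj : ContMDiff (𝓡 (l + k)) (𝓡 m) ∞ (fun x : p ⁻¹' Λ => i x.1) :=
    hi.contMDiff.comp hembP.contMDiff
  have hje : IsEmbedding (fun x : p ⁻¹' Λ => i x.1) := hi.isEmbedding.comp hembP.isEmbedding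
  have hjinj : ∀ x : p ⁻¹' Λ, Function.Injective
      (mfderiv (𝓡 (l + k)) (𝓡 m) (fun x : p ⁻¹' Λ => i x.1) x) := by
    intro x u v huv
    have e : ∀ w, (mfderiv (𝓡 (l + k)) (𝓡 m) (fun x : p ⁻¹' Λ => i x.1) x w : Euc m) = _ :=
      fun w => mfderiv_comp_apply (I := 𝓡 (l + k)) x (hi.contMDiff.mdifferentiable (by simp) x.1)
        (hembP.contMDiff.mdifferentiable (by simp) x) w
    exact mfderiv_injective_of_isImmersionAt (hembP.isImmersion.isImmersionAt x)
      (mfderiv_injective_of_isImmersionAt (hi.isImmersion.isImmersionAt x.1)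
        ((e u).symm.trans (huv.trans (e v))))
  have hrange : range (fun x : p ⁻¹' Λ => i x.1) = i '' (p ⁻¹' Λ) := by
    ext y
    simp
  have hsL : ∀ y : i '' (p ⁻¹' Λ), HasSliceChart (Euc m) (Euc (l + k)) (Euc (m - (l + k)))
      (range (Subtype.val : i '' (p ⁻¹' Λ) → M)) y.1 := by
    rintro ⟨_, x, hx, rfl⟩
    have h1 := hasSliceChart_range (K := Euc (m - (l + k))) hj hje ⟨x, hx⟩ (hjinj _)
      (by simp; omega)
    rw [hrange] at h1
    rwa [Subtype.range_coe]
  obtain ⟨csL, hmanL, hembL⟩ := exists_chartedSpace_of_hasSliceChart IsEmbedding.subtypeVal hsL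
  refine ⟨l + k, by omega, csL, hmanL, hembL, fun y v => ?_⟩
  obtain ⟨f, hf, hif⟩ := exists_lift hi hembL.contMDiff
    (fun y => (show ∃ x, i x = y.1 from ⟨y.2.choose, y.2.choose_spec.2⟩))
  -- a tangent vector of the preimage is mapped by `p` to a tangent vector of `Λ`
  have hpf : ∀ y, p (f y) ∈ Λ := by
    intro y
    obtain ⟨x, hx, hxy⟩ := y.2
    rwa [hi.isEmbedding.injective ((hif y).trans hxy.symm)]
  have hfy := hf.mdifferentiable (by simp) y
  obtain ⟨w, hw⟩ := mfderiv_mem_range_of_eventually_mem_range hembΛ.contMDiff hembΛ.isEmbedding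
    (y := (⟨p (f y), hpf y⟩ : Λ))
    (mfderiv_injective_of_isImmersionAt (hembΛ.isImmersion.isImmersionAt _))
    (f := p ∘ f) (x := y) ((hp.contMDiff.comp hf).mdifferentiable (by simp) y) rfl
    (Filter.Eventually.of_forall fun y' => ⟨⟨p (f y'), hpf y'⟩, rfl⟩) v
  have h1 := htan ⟨p (f y), hpf y⟩ w
  rw [hw] at h1
  have h2 := mfderiv_comp_apply (I := 𝓡 (l + k)) y
    (hp.contMDiff.mdifferentiable (by simp) (f y)) hfy v
  have h3 : (mfderiv (𝓡 (l + k)) (𝓡 n) f y v) ∈ pullback n i C (f y) :=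
    (mem_iff_of_pullback_eq h rfl _ h2.symm).1 h1
  have h4 := mfderiv_comp_apply (I := 𝓡 (l + k)) y
    (hi.contMDiff.mdifferentiable (by simp) (f y)) hfy v
  have h5 : i ∘ f = Subtype.val := funext hif
  rw [h5] at h4
  refine mem_field_congr (hif y) (v := mfderiv (𝓡 (l + k)) (𝓡 m) Subtype.val y v) ?_
  exact h4 ▸ h3

/-- Conversely, a Legendre submanifold of `M` which is a union of fibres of `p` is the preimage of
a Legendre submanifold of `Q`. -/
theorem exists_isLegendre_preimage (hi : IsSmoothEmbedding (𝓡 n) (𝓡 m) ∞ i)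
    (hp : IsSubmersion (𝓡 n) (𝓡 d) ∞ p) (h : pullback n p C' = pullback n i C)
    {k : ℕ} (hm : d + 2 * k = m) (hn : d + k = n) (hk : 2 * k + 1 ≤ m) {L : Set M}
    (hL : IsLegendre C L) (hsub : ∀ x ∈ L, ∃ y, i y = x)
    (hsat : ∀ x y, p x = p y → i x ∈ L → i y ∈ L) :
    ∃ Λ : Set Q, IsLegendre C' Λ ∧ L = i '' (p ⁻¹' Λ) := by
  obtain ⟨l, hl, csL, hmanL, hembL, htan⟩ := hL
  obtain ⟨f, hf, hif⟩ := exists_lift hi hembL.contMDiff (fun y => hsub y.1 y.2)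
  have h5 : i ∘ f = Subtype.val := funext hif
  have hcomp : ∀ (y : L) (v : Euc l), (mfderiv (𝓡 l) (𝓡 m) (Subtype.val : L → M) y v : Euc m) =
      mfderiv (𝓡 n) (𝓡 m) i (f y) (mfderiv (𝓡 l) (𝓡 n) f y v) := by
    intro y v
    have h4 := mfderiv_comp_apply (I := 𝓡 l) y
      (hi.contMDiff.mdifferentiable (by simp) (f y)) (hf.mdifferentiable (by simp) y) v
    rwa [h5] at h4
  have hfinj : ∀ y, Function.Injective (mfderiv (𝓡 l) (𝓡 n) f y) := by
    intro y u v huv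
    refine mfderiv_injective_of_isImmersionAt (hembL.isImmersion.isImmersionAt y) ?_
    exact (hcomp y u).trans ((congrArg (mfderiv (𝓡 n) (𝓡 m) i (f y)) huv).trans (hcomp y v).symm)
  have hfe : IsEmbedding f := by
    refine IsEmbedding.of_comp hf.continuous hi.contMDiff.continuous ?_
    rw [h5]
    exact IsEmbedding.subtypeVal
  have hfr : ∀ x, x ∈ range f ↔ i x ∈ L := by
    refine fun x => ⟨?_, fun hx => ⟨⟨i x, hx⟩, hi.isEmbedding.injective (hif _)⟩⟩
    rintro ⟨y, rfl⟩
    exact (hif y).symm ▸ y.2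
  set Λ : Set Q := p '' range f with hΛ
  have hpre : p ⁻¹' Λ = range f := by
    refine Subset.antisymm ?_ (subset_preimage_image _ _)
    rintro x ⟨y, hy, hyx⟩
    exact (hfr x).2 (hsat y x hyx ((hfr y).1 hy))
  have hs : ∀ q : Λ, HasSliceChart (Euc d) (Euc (l - k)) (Euc (n - l))
      (range (Subtype.val : Λ → Q)) q.1 := by
    rintro ⟨q, hq⟩
    obtain ⟨x, ⟨y, rfl⟩, rfl⟩ := id hq
    rw [Subtype.range_coe]
    refine HasSliceChart.of_preimage (F := Euc l) (p := p) (x := f y) (Λ := Λ)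
      (hp.isSubmersionAt (f y)) hq ?_ (by simp; omega)
    rw [hpre]
    exact hasSliceChart_range hf hfe y (hfinj y) (by simp; omega)
  obtain ⟨csΛ, hmanΛ, hembΛ⟩ := exists_chartedSpace_of_hasSliceChart IsEmbedding.subtypeVal hs
  refine ⟨Λ, ⟨l - k, by omega, csΛ, hmanΛ, hembΛ, fun q w => ?_⟩, ?_⟩
  · obtain ⟨x, ⟨y, hyx⟩, hxq⟩ := id q.2
    obtain ⟨V, σ, hV, hxV, hσ, hσx, hpσ⟩ := exists_section_of_isSubmersionAt (hp.isSubmersionAt x)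
    rw [hxq] at hxV hσx
    have hσq : MDifferentiableAt (𝓡 d) (𝓡 n) σ q.1 :=
      (hσ.contMDiffAt (hV.mem_nhds hxV)).mdifferentiableAt (by simp)
    have hval := hembΛ.contMDiff.mdifferentiable (by simp) q
    -- a local section of `p` lifts a tangent vector of `Λ` to a tangent vector of `L`
    obtain ⟨u, hu⟩ := mfderiv_mem_range_of_eventually_mem_range hf hfe (y := y) (hfinj y)
      (f := σ ∘ (Subtype.val : Λ → Q)) (x := q) (hσq.comp q hval) (hσx.trans hyx.symm)
      (by
        filter_upwards [(hV.preimage continuous_subtype_val).mem_nhds hxV] with q' hq'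
        rw [← hpre]
        change p (σ q'.1) ∈ Λ
        rw [hpσ _ hq']
        exact q'.2) w
    have h1 := mfderiv_comp_apply (I := 𝓡 (l - k)) q hσq hval w
    have h2 := mfderiv_section_apply hp hV hσ hpσ hxV
      (mfderiv (𝓡 (l - k)) (𝓡 d) (Subtype.val : Λ → Q) q w)
    have h3 : (mfderiv (𝓡 l) (𝓡 n) f y u : Euc n) ∈ pullback n i C (f y) := by
      change mfderiv (𝓡 n) (𝓡 m) i (f y) (mfderiv (𝓡 l) (𝓡 n) f y u) ∈ C (i (f y))
      exact mem_field_congr (hif y).symm (hcomp y u ▸ htan y u)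
    rw [hu, h1] at h3
    exact (mem_iff_of_pullback_eq h (hpσ _ hxV) _ h2).2
      (mem_field_congr (C := pullback n i C) (hyx.trans hσx.symm) h3)
  · rw [hpre]
    ext x
    constructor
    · intro hx
      exact ⟨f ⟨x, hx⟩, mem_range_self _, hif _⟩
    · rintro ⟨_, hy, rfl⟩
      exact (hfr _).1 hy

end Correspondence

end ContactReduction

theorem mainTheorem1 {m k : ℕ}
    {M : Type*} [TopologicalSpace M] [T2Space M] [SecondCountableTopology M]
    [ChartedSpace (EuclideanSpace ℝ (Fin m)) M] [IsManifold (𝓡 m) ∞ M]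
    {G : Type*} [TopologicalSpace G] [ChartedSpace (EuclideanSpace ℝ (Fin k)) G] [Group G]
    [LieGroup (𝓡 k) ∞ G] [MulAction G M] [ContMDiffSMul (𝓡 k) (𝓡 m) ∞ G M]
    (C : SubspaceField m M) (hC : IsContact C)
    (hG : Preserves G C) (hfree : IsLocallyFree G M) :
    -- invariant Legendre submanifolds are contained in `M_𝔤`
    (∀ L : Set M, IsLegendre C L → (∀ (g : G), ∀ x ∈ L, g • x ∈ L) →
      L ⊆ (reductionLocus k G C hG : Set M)) ∧
    ((reductionLocus k G C hG : Set M).Nonempty → 2 * k + 1 ≤ m) ∧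
    -- `M_𝔤` is an embedded submanifold of codimension `dim G`
    ∃ (_ : ChartedSpace (EuclideanSpace ℝ (Fin (m - k))) (reductionLocus k G C hG))
      (_ : IsManifold (𝓡 (m - k)) ∞ (reductionLocus k G C hG)),
      Manifold.IsSmoothEmbedding (𝓡 (m - k)) (𝓡 m) ∞ (reductionIncl k G C hG) ∧
      -- `C` touches `M_𝔤` nowhere and cuts a smooth hyperplane field there,
      (∀ x : reductionLocus k G C hG, ∃ v : TangentSpace (𝓡 (m - k)) x,
        mfderiv (𝓡 (m - k)) (𝓡 m) (reductionIncl k G C hG) x v ∉ C x.1) ∧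
      IsHyperplaneField (pullback (m - k) (reductionIncl k G C hG) C) ∧
      -- whose characteristic directions are the directions tangent to the orbits of `G`
      (∀ x : reductionLocus k G C hG,
        characteristicDirections (pullback (m - k) (reductionIncl k G C hG) C) x =
          Set.range (infinitesimalAction (n := m - k) (k := k) G x)) ∧
      -- and whose characteristics are the orbits (of the identity component of `G`)
      (∀ x : reductionLocus k G C hG,
        characteristicLeaf (pullback (m - k) (reductionIncl k G C hG) C) x =
          {y | ∃ g ∈ connectedComponent (1 : G), g • x = y}) ∧
      -- suppose that `G` acts properly on `M_𝔤`
      (ProperSMul G (reductionLocus k G C hG) →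
        -- if it also acts freely there, `M_𝔤 / G` is a manifold of dimension `dim M - 2 dim G`
        ((∀ (g : G) (x : reductionLocus k G C hG), g • x = x → g = 1) →
          T2Space (ReducedSpace k G C hG) ∧
          SecondCountableTopology (ReducedSpace k G C hG) ∧
          ∃ _ : ChartedSpace (EuclideanSpace ℝ (Fin (m - 2 * k))) (ReducedSpace k G C hG),
            IsManifold (𝓡 (m - 2 * k)) ∞ (ReducedSpace k G C hG) ∧
            Manifold.IsSubmersion (𝓡 (m - k)) (𝓡 (m - 2 * k)) ∞ (reductionProj k G C hG)) ∧
        -- whenever `M_𝔤 / G` is a nonempty manifold (with the projection a submersion),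
        (∀ (d : ℕ) (_ : ChartedSpace (EuclideanSpace ℝ (Fin d)) (ReducedSpace k G C hG))
          (_ : IsManifold (𝓡 d) ∞ (ReducedSpace k G C hG)),
          Manifold.IsSubmersion (𝓡 (m - k)) (𝓡 d) ∞ (reductionProj k G C hG) →
          Nonempty (reductionLocus k G C hG) →
          -- it is of dimension `dim M - 2 dim G`, the field on `M_𝔤` descends to a contact
          -- structure on it,
          d + 2 * k = m ∧
          ∃ C' : SubspaceField d (ReducedSpace k G C hG),
            pullback (m - k) (reductionProj k G C hG) C' =
              pullback (m - k) (reductionIncl k G C hG) C ∧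
            IsContact C' ∧
            -- and invariant Legendre submanifolds are the preimages of Legendre submanifolds
            ∀ L : Set M,
              (IsLegendre C L ∧ ∀ (g : G), ∀ x ∈ L, g • x ∈ L) ↔
              ∃ Λ : Set (ReducedSpace k G C hG), IsLegendre C' Λ ∧
                L = reductionIncl k G C hG '' (reductionProj k G C hG ⁻¹' Λ))) := by
  refine ⟨fun L hL hinv => subset_reductionLocus_of_isLegendre hL hinv,
    fun ⟨x, hx⟩ => two_mul_add_one_le_of_mem hC hfree hx, ?_⟩
  obtain ⟨cs, hman, hemb⟩ := exists_chartedSpace_reductionLocus (k := k) (hG := hG) hC hfree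
  have hsmul := contMDiffSMul_reductionLocus hemb
  have hinj := infinitesimalAction_reductionLocus_injective hfree hemb
  have hchar := characteristicDirections_pullback_incl hC hfree hemb
  refine ⟨cs, hman, hemb, exists_mfderiv_incl_not_mem hC hfree hemb,
    isHyperplaneField_pullback_incl hC hfree hemb, hchar, characteristicLeaf_eq hchar hinj,
    fun hprop => ⟨fun hfree' => ?_, fun d csQ hmanQ hp ⟨x₀⟩ => ?_⟩⟩
  · have hdim : Nonempty (reductionLocus k G C hG) → k + (m - 2 * k) = m - k := fun ⟨x⟩ => by
      have := two_mul_add_one_le_of_mem hC hfree x.2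
      omega
    have : SecondCountableTopology (reductionLocus k G C hG) :=
      hemb.isEmbedding.secondCountableTopology
    exact ⟨inferInstanceAs (T2Space (Quotient (MulAction.orbitRel G (reductionLocus k G C hG)))),
      ContinuousConstSMul.secondCountableTopology,
      exists_chartedSpace_quotient hdim hinj hfree'⟩
  · have hd := dim_reducedSpace hC hfree hemb hp x₀
    have hk := two_mul_add_one_le_of_mem hC hfree x₀.2
    have hpull := pullback_reducedField hfree hemb hp
    refine ⟨hd, reducedField k d G C hG, hpull, ?_, fun L => ⟨fun ⟨hL, hinv⟩ => ?_, ?_⟩⟩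
    · refine isContact_of_pullback_eq hp reductionProj_surjective hpull
        (isHyperplaneField_pullback_incl hC hfree hemb) fun x u => ?_
      rw [hchar x]
      exact (mfderiv_reductionProj_eq_zero_iff hfree hemb hp x u).symm
    · refine exists_isLegendre_preimage hemb hp hpull hd (by omega) hk hL
        (fun x hx =>
          ⟨⟨x, subset_reductionLocus_of_isLegendre (k := k) (hG := hG) hL hinv hx⟩, rfl⟩) ?_
      intro x y hxy hx
      obtain ⟨g, rfl⟩ := (reductionProj_eq_iff y x).1 hxy.symm
      exact hinv g _ hx
    · rintro ⟨Λ, hΛ, rfl⟩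
      refine ⟨isLegendre_image_preimage hemb hp hpull hd (by omega) hΛ, ?_⟩
      rintro g _ ⟨x, hx, rfl⟩
      refine ⟨g • x, ?_, rfl⟩
      have h1 : reductionProj k G C hG (g • x) = reductionProj k G C hG x :=
        (reductionProj_eq_iff _ _).2 ⟨g, rfl⟩
      change reductionProj k G C hG (g • x) ∈ Λ
      rwa [h1]
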